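/- Let $n\ge 1$, $d=n+1$, $0<\nu<1$, $f\ge 0$, and $A_\nu=2^{2\nu}\pi^{d/2}\,\Gamma(\nu)/\Gamma(\tfrac d2-\nu)$. For a momentum $p=(\omega,\vec k)\in\mathbb R\times\mathbb R^{n}$ write $-p^2=\omega^2-|\vec k|^2$ and $p\cdot x=-\omega t+\vec k\cdot\vec x$ for $x=(t,\vec x)$; $\theta$ is the Heaviside function. **(1) Analytic continuation.** For Euclidean time $\tau\neq0$ the Schwinger function of the double-trace deformed CFT, $$s(\tau,\vec x)=\int\frac{d^{n}k}{(2\pi)^{n}}\,e^{i\vec k\cdot\vec x}\int_{-\infty}^{\infty}\frac{dk_d}{2\pi}\,e^{ik_d\tau}\,\frac{A_\nu}{(|\vec k|^2+k_d^2)^{\nu}+fA_\nu},$$ is well defined: the inner integral converges as an improper integral for every $\vec k\ne0$, and is then an integrable function of $\vec k$. The integral $$\omega_2(z,\vec x)=2A_\nu\sin(\pi\nu)\int\frac{d^dp}{(2\pi)^d}\,e^{i\vec k\cdot\vec x-i\omega z}\,\frac{(-p^2)^\nu\,\theta(-p^2)\,\theta(\omega)}{(-p^2)^{2\nu}+2fA_\nu\cos(\pi\nu)(-p^2)^\nu+(fA_\nu)^2}$$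 converges absolutely for $\operatorname{Im}z<0$, is holomorphic in $z$ there, and satisfies $\omega_2(-i|\tau|,\vec x)=s(\tau,\vec x)$ for all $\tau\neq0$. So $\omega_2(t-i\varepsilon,\vec x)$ is the Wightman function obtained from $s$ by analytic continuation. **(2) Support.** As $\varepsilon\to0^+$, $\omega_2(t-i\varepsilon,\vec x)$ converges to a tempered distribution. Its Fourier transform is the (locally integrable, tempered) function of $p$ multiplying the exponential above, and the support of that Fourier transform is the closed future light cone $\{\omega\ge|\vec k|\}$. **(3) Map to the bulk.** Let $J_{\pm\nu}$ be Bessel functions, and let the Robin kernel with angle $\gamma$, for a boundary point $x$ and a bulk point $X=(x',Z')$, $Z'>0$, be $$K_R(x|x',Z')=\int\frac{d^dp}{(2\pi)^d}\,e^{ip\cdot(x'-x)}\Big[\cos\gamma\,2^{\nu}\Gamma(1+\nu)(-p^2)^{-\nu/2}Z'^{d/2}J_\nu(\sqrt{-p^2}Z')+\sin\gamma\,2^{-\nu}\Gamma(1-\nu)(-p^2)^{\nu/2}Z'^{d/2}J_{-\nu}(\sqrt{-p^2}Z')\Big].$$ The bracket is entire in $p^2$ and is used for all $p$. The integral is an oscillatory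 integral: multiply the bracket by $\chi(p/\Lambda)$ with $\chi\in C_c^\infty$ real-valued, $\chi(0)=1$, and let $\Lambda\to\infty$ at the end. Let the bulk Wightman function with Robin parameter $\alpha$ be $$G_\alpha^{\varepsilon}(X_1,X_2)=\int\frac{d^{n}k}{(2\pi)^{n}}\int_0^\infty dq\;\frac{V_q(Z_1)V_q(Z_2)}{2\omega}\,e^{i\vec k\cdot(\vec x_1-\vec x_2)-i\omega(t_1-t_2-i\varepsilon)},\qquad \omega=\sqrt{|\vec k|^2+q^2},$$ $$V_q(Z)=Z^{n/2}\sqrt{qZ}\;\frac{\cos\alpha\,J_\nu(qZ)-\sin\alpha\,q^{2\nu}J_{-\nu}(qZ)}{\sqrt{\cos^2\alpha-2\sin\alpha\cos\alpha\cos(\pi\nu)q^{2\nu}+\sin^2\alpha\,q^{4\nu}}}.$$ Suppose $\alpha,\gamma\in(0,\pi)$, $$\cot\alpha=-fA_\nu ,\qquad \cot\gamma=-2^{-2\nu}\,\frac{\Gamma(1-\nu)}{\Gamma(1+\nu)}\,\cot\alpha .$$ Then: * For every $q>0$, $V_q$ is smooth on $(0,\infty)$ and solves the radial Klein-Gordon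 equation $Z^2V''-(d-1)ZV'+(q^2Z^2-\nu^2+\tfrac{d^2}4)V=0$. It obeys the Robin boundary condition $V_q\sim\phi\,(\sin\gamma\,Z^{d/2-\nu}+\cos\gamma\,Z^{d/2+\nu})$ as $Z\to0^+$ with some $\phi\ne0$, in the sense that $Z^{-(d/2-\nu)}V_q\to\phi\sin\gamma$ and $Z^{-(d/2+\nu)}\big(V_q-\phi\sin\gamma\,Z^{d/2-\nu}\big)\to\phi\cos\gamma$. * For every $\varepsilon>0$ and all bulk points $X_1=(x_1',Z_1)$, $X_2=(x_2',Z_2)$ with $Z_1,Z_2>0$, the integral defining $G^\varepsilon_\alpha(X_1,X_2)$ converges absolutely, and so does the double integral below when the two kernels carry cutoffs at finite scales $\Lambda_1,\Lambda_2>0$. As $\Lambda_1,\Lambda_2\to\infty$, with arbitrary cutoff functions $\chi_1,\chi_2$, $$\int d^dx_1\,d^dx_2\,K_R(x_1|X_1)\,K_R(x_2|X_2)\,\omega_2(t_1-t_2-i\varepsilon,\vec x_1-\vec x_2)= \frac{2\pi^{d/2}\,\Gamma(1-\nu)}{\Gamma(\frac d2-\nu)}\,\sin^2\gamma\;\,G_\alpha^{\varepsilon}(X_1,X_2).$$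 * For every smooth compactly supported test function $F$ of pairs of bulk points with $Z_1,Z_2>0$, $\int G^\varepsilon_\alpha F$ converges absolutely for each $\varepsilon>0$ and has a limit as $\varepsilon\to0^+$. -/

import Mathlib

open Real Set Filter Topology MeasureTheory
open scoped SchwartzMap ContDiff RealInnerProductSpace

namespace RobinHolography

/-- Minkowski space (and its momentum space) of dimension `d = n + 1`: pairs (time, position),
respectively (frequency, spatial momentum). -/
abbrev Mink (n : ℕ) : Type := ℝ × EuclideanSpace ℝ (Fin n)

/-- The Poincaré patch of anti-de Sitter space of dimension `d + 1`: pairs (boundary point, `Z`);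
the points of the patch are those with `0 < Z`. -/
abbrev Bulk (n : ℕ) : Type := Mink n × ℝ

/-- The Minkowski product `p · x = -ω t + k · x`. -/
noncomputable def minkProd {n : ℕ} (p x : Mink n) : ℝ := -(p.1 * x.1) + ⟪p.2, x.2⟫

/-- The invariant `-p² = ω² - |k|²`. -/
noncomputable def negSq {n : ℕ} (p : Mink n) : ℝ := p.1 ^ 2 - ‖p.2‖ ^ 2

/-- The constant `A_ν = 2^(2ν) π^(d/2) Γ(ν) / Γ(d/2 - ν)` with `d = n + 1`. -/
noncomputable def Aconst (n : ℕ) (ν : ℝ) : ℝ :=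
  2 ^ (2 * ν) * π ^ (((n : ℝ) + 1) / 2) * Real.Gamma ν / Real.Gamma (((n : ℝ) + 1) / 2 - ν)

/-! ### The boundary theory -/

/-- The inner integral over the Euclidean frequency of the Schwinger function, cut off at `±R`. -/
noncomputable def schwingerCutoff (n : ℕ) (ν f τ : ℝ) (k : EuclideanSpace ℝ (Fin n)) (R : ℝ) : ℂ :=
  ∫ s in (-R)..R, Complex.exp (Complex.I * ((s * τ : ℝ) : ℂ)) *
    ((Aconst n ν / ((‖k‖ ^ 2 + s ^ 2) ^ ν + f * Aconst n ν) / (2 * π) : ℝ) : ℂ)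

/-- The inner integral of the Schwinger function, as an improper integral. -/
noncomputable def schwingerMode (n : ℕ) (ν f τ : ℝ) (k : EuclideanSpace ℝ (Fin n)) : ℂ :=
  limUnder atTop (schwingerCutoff n ν f τ k)

/-- The Schwinger two-point function `s((τ, x); 0)` of the double-trace deformed theory. -/
noncomputable def schwinger (n : ℕ) (ν f τ : ℝ) (x : EuclideanSpace ℝ (Fin n)) : ℂ :=
  ∫ k : EuclideanSpace ℝ (Fin n),
    Complex.exp (Complex.I * ((⟪k, x⟫ : ℝ) : ℂ)) * schwingerMode n ν f τ k / (2 * π) ^ n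

/-- The momentum-space density of the boundary Wightman function, with respect to
`d^d p / (2π)^d`; the condition `‖k‖ < ω` is the factor `θ(-p²) θ(ω)`. -/
noncomputable def wightmanDensity (n : ℕ) (ν f : ℝ) (p : Mink n) : ℝ :=
  if ‖p.2‖ < p.1 then
    2 * Aconst n ν * Real.sin (π * ν) *
      (negSq p ^ ν / (negSq p ^ (2 * ν) + f * Aconst n ν * (2 * Real.cos (π * ν)) * negSq p ^ ν
        + (f * Aconst n ν) ^ 2))
  else 0

/-- The integrand of the boundary Wightman function at complex time `z` (`z = t - iε`). -/
noncomputable def wightmanIntegrand (n : ℕ) (ν f : ℝ) (z : ℂ) (x : EuclideanSpace ℝ (Fin n))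
    (p : Mink n) : ℂ :=
  Complex.exp (Complex.I * ((⟪p.2, x⟫ : ℝ) : ℂ) - Complex.I * (p.1 : ℂ) * z) *
    (wightmanDensity n ν f p : ℂ) / (2 * π) ^ (n + 1)

/-- The boundary Wightman function at complex time `z` (`z = t - iε`). -/
noncomputable def wightman (n : ℕ) (ν f : ℝ) (z : ℂ) (x : EuclideanSpace ℝ (Fin n)) : ℂ :=
  ∫ p : Mink n, wightmanIntegrand n ν f z x p

/-- The boundary Wightman function with its `iε` regulator, at a point of real Minkowski space. -/
noncomputable def wightmanReg (n : ℕ) (ν f ε : ℝ) (x : Mink n) : ℂ :=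
  wightman n ν f ((x.1 : ℂ) - Complex.I * (ε : ℂ)) x.2

/-- The Fourier transform `p ↦ ∫ e^{i p · x} h(x) dx` with the Minkowski product. -/
noncomputable def minkFourier {n : ℕ} (h : Mink n → ℂ) (p : Mink n) : ℂ :=
  ∫ x : Mink n, Complex.exp (Complex.I * (minkProd p x : ℂ)) * h x

/-! ### Bessel functions and the Robin kernel -/

/-- The Bessel function `J_μ(x)` for `x > 0`. -/
noncomputable def besselJ (μ x : ℝ) : ℝ :=
  ∑' m : ℕ, (-1) ^ m / ((m.factorial : ℝ) * Real.Gamma (m + μ + 1)) * (x / 2) ^ (2 * (m : ℝ) + μ)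

/-- The entire function `s ↦ (√s / 2)^(-μ) J_μ(√s)`. -/
noncomputable def besselEntire (μ s : ℝ) : ℝ :=
  ∑' m : ℕ, (-1) ^ m / ((m.factorial : ℝ) * Real.Gamma (m + μ + 1)) * (s / 4) ^ m

theorem besselJ_eq_besselEntire (μ : ℝ) {s Z : ℝ} (hs : 0 < s) (hZ : 0 < Z) :
    s ^ (-μ / 2) * besselJ μ (√s * Z) = (Z / 2) ^ μ * besselEntire μ (s * Z ^ 2) := by
  unfold besselJ besselEntire
  rw [← tsum_mul_left, ← tsum_mul_left]
  refine tsum_congr fun m => ?_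
  have hq : 0 < √s := Real.sqrt_pos.2 hs
  have h0 : (0 : ℝ) < √s * Z / 2 := by positivity
  have h1 : (√s * Z / 2) ^ (2 * (m : ℝ) + μ)
      = (s * Z ^ 2 / 4) ^ m * (s ^ (μ / 2) * (Z / 2) ^ μ) := by
    rw [Real.rpow_add h0]
    congr 1
    · rw [Real.rpow_mul h0.le, Real.rpow_natCast, Real.rpow_two]
      congr 1
      rw [div_pow, mul_pow, Real.sq_sqrt hs.le]
      norm_num
    · rw [mul_div_assoc, Real.mul_rpow hq.le (by positivity), Real.sqrt_eq_rpow,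
        ← Real.rpow_mul hs.le]
      congr 2
      ring
  have h2 : s ^ (-μ / 2) * s ^ (μ / 2) = 1 := by
    rw [← Real.rpow_add hs, neg_div, neg_add_cancel, Real.rpow_zero]
  rw [h1]
  linear_combination
    ((-1) ^ m / ((m.factorial : ℝ) * Real.Gamma (m + μ + 1)) * (s * Z ^ 2 / 4) ^ m * (Z / 2) ^ μ) * h2

/-- The momentum-space Robin kernel as an entire function of `s = -p²`; for `s > 0` it is the
combination of Bessel functions in `robinProfile_eq`. -/
noncomputable def robinProfile (n : ℕ) (ν γ Z s : ℝ) : ℝ :=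
  Z ^ (((n : ℝ) + 1) / 2) *
    (Real.cos γ * (2 ^ ν * Real.Gamma (1 + ν)) * ((Z / 2) ^ ν * besselEntire ν (s * Z ^ 2))
      + Real.sin γ * (2 ^ (-ν) * Real.Gamma (1 - ν)) *
        ((Z / 2) ^ (-ν) * besselEntire (-ν) (s * Z ^ 2)))

theorem robinProfile_eq (n : ℕ) (ν γ : ℝ) {Z s : ℝ} (hZ : 0 < Z) (hs : 0 < s) :
    robinProfile n ν γ Z s =
      Real.cos γ * 2 ^ ν * Real.Gamma (1 + ν) * s ^ (-ν / 2)
          * (Z ^ (((n : ℝ) + 1) / 2) * besselJ ν (√s * Z))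
        + Real.sin γ * 2 ^ (-ν) * Real.Gamma (1 - ν) * s ^ (ν / 2)
          * (Z ^ (((n : ℝ) + 1) / 2) * besselJ (-ν) (√s * Z)) := by
  have h1 := besselJ_eq_besselEntire ν hs hZ
  have h2 := besselJ_eq_besselEntire (-ν) hs hZ
  rw [neg_neg] at h2
  unfold robinProfile
  rw [← h1, ← h2]
  ring

/-- A smooth momentum cutoff: `χ(p / Λ) → 1` as `Λ → ∞`. -/
structure IsCutoff {n : ℕ} (χ : Mink n → ℝ) : Prop where
  smooth : ContDiff ℝ ∞ χ
  compact : HasCompactSupport χ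
  one : χ 0 = 1

/-- The Robin kernel `K_R(x | x', Z')`, with bulk point `X = (x', Z')`: the oscillatory integral
`∫ d^d p / (2π)^d e^{i p · (x' - x)} robinProfile(Z', -p²)` over all momenta, regulated by the
cutoff `χ` at scale `Λ`. -/
noncomputable def robinKernel {n : ℕ} (ν γ : ℝ) (χ : Mink n → ℝ) (Λ : ℝ) (x : Mink n)
    (X : Bulk n) : ℂ :=
  ∫ p : Mink n, Complex.exp (Complex.I * (minkProd p (X.1 - x) : ℂ)) *
    ((χ (Λ⁻¹ • p) * robinProfile n ν γ X.2 (negSq p) : ℝ) : ℂ) / (2 * π) ^ (n + 1)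

/-- The integrand `K_R(x₁ | X₁) K_R(x₂ | X₂) ω₂(x₁, x₂)` with cutoffs in the two kernels. -/
noncomputable def mappedIntegrand {n : ℕ} (ν γ f ε : ℝ) (χ₁ χ₂ : Mink n → ℝ) (Λ₁ Λ₂ : ℝ)
    (X₁ X₂ : Bulk n) (x : Mink n × Mink n) : ℂ :=
  robinKernel ν γ χ₁ Λ₁ x.1 X₁ * robinKernel ν γ χ₂ Λ₂ x.2 X₂ * wightmanReg n ν f ε (x.1 - x.2)

/-! ### The bulk theory -/

/-- The normalized radial mode of "mass" `q` with Robin parameter `α`: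
`Z^(n/2) √(qZ) (cos α J_ν(qZ) - sin α q^(2ν) J_{-ν}(qZ)) / √D`, where
`D = cos² α - 2 sin α cos α cos(πν) q^(2ν) + sin² α q^(4ν)`. -/
noncomputable def robinMode (n : ℕ) (ν α q Z : ℝ) : ℝ :=
  Z ^ ((n : ℝ) / 2) * √(q * Z) *
    (Real.cos α * besselJ ν (q * Z) - Real.sin α * q ^ (2 * ν) * besselJ (-ν) (q * Z)) /
    √(Real.cos α ^ 2 - 2 * Real.sin α * Real.cos α * Real.cos (π * ν) * q ^ (2 * ν)
      + Real.sin α ^ 2 * q ^ (4 * ν))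

/-- The energy `√(|k|² + q²)`. -/
noncomputable def energy {n : ℕ} (k : EuclideanSpace ℝ (Fin n)) (q : ℝ) : ℝ :=
  √(‖k‖ ^ 2 + q ^ 2)

/-- The integrand of the mode expansion of the bulk Wightman function. -/
noncomputable def bulkIntegrand (n : ℕ) (ν α ε : ℝ) (X₁ X₂ : Bulk n)
    (y : EuclideanSpace ℝ (Fin n) × ℝ) : ℂ :=
  Complex.exp (Complex.I * ((⟪y.1, X₁.1.2 - X₂.1.2⟫ : ℝ) : ℂ)
      - Complex.I * (energy y.1 y.2 : ℂ) * (((X₁.1.1 - X₂.1.1 : ℝ) : ℂ) - Complex.I * (ε : ℂ))) *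
    ((robinMode n ν α y.2 X₁.2 * robinMode n ν α y.2 X₂.2 / (2 * energy y.1 y.2) : ℝ) : ℂ)
    / (2 * π) ^ n

/-- The Wightman function of the ground state of the Klein-Gordon field on the Poincaré patch with
Robin boundary conditions, with its `iε` regulator: the sum over the modes with spatial momentum
`k` and radial parameter `q > 0`. -/
noncomputable def bulkWightman (n : ℕ) (ν α ε : ℝ) (X₁ X₂ : Bulk n) : ℂ :=
  ∫ y in (univ : Set (EuclideanSpace ℝ (Fin n))) ×ˢ Ioi (0 : ℝ), bulkIntegrand n ν α ε X₁ X₂ y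

end RobinHolography

open RobinHolography

/-!
With `a = f A_ν`, the function `1 / (u ^ ν + a)` is holomorphic in the plane cut along the negative
axis. In the coordinate `w = log u` the cut plane is a strip, and Cauchy's theorem for the strip
recovers the function from the jump across the cut: it is `π⁻¹ ∫ ρ(s) / (u + s) ds` over `s > 0`,
where `ρ` is the spectral density. At `u = |k|² + k_d²` and `s = q²` the Fourier integral over
`k_d` turns each resolvent into `exp (-E |τ|) / (2 E)`, `E = √(|k|² + q²)`. The Schwinger function
is therefore a superposition of mass shells, and in the coordinates `(k, q) ↦ (E, k)` of the open
future cone it is the integral of `exp (i k·x - ω |τ|)` against a positive measure. Replacing `|τ|`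
by `i z` continues it analytically, and as the density is positive exactly on the open cone, the
Fourier transform of the boundary value is supported on the closed cone.

The regulated Robin kernels are Schwartz functions, so integrating them against the Wightman
function multiplies this measure by the Robin profiles of the two bulk points and by the cutoffs,
which disappear by dominated convergence. On the shell of mass `q` the mode `V_q` is a multiple of
the profile: both are the same combination of the two Frobenius solutions of the radial equation.
The square of this multiple is, up to a constant independent of `q`, the factor `q ρ(q²)` by which
the measure differs from the one defining the bulk Wightman function.

A decreasing energy bounds the profiles polynomially in `-p²`. Integrating by parts in the first
time coordinate of a test function gains any power of `1 / ω`, which makes the integral over the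
measure converge absolutely at `ε = 0`.
-/

namespace RobinHolography

/-! ### Integrals over half-lines and strips -/

section ExponentialCoordinates

open scoped ENNReal

theorem integrableOn_rpow_mul_one_add_rpow {a b : ℝ} (ha : -1 < a) (hab : a + b < -1) :
    IntegrableOn (fun y : ℝ => y ^ a * (1 + y) ^ b) (Ioi 0) := by
  have hb : b ≤ 0 := by linarith
  have hmeas : Measurable fun y : ℝ => y ^ a * (1 + y) ^ b := by fun_prop
  rw [← Ioc_union_Ioi_eq_Ioi (zero_le_one' ℝ)]
  refine IntegrableOn.union ?_ ?_
  · have near_zero : IntegrableOn (fun y : ℝ => y ^ a) (Ioc 0 1) :=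
      (intervalIntegrable_iff_integrableOn_Ioc_of_le zero_le_one).1
        (intervalIntegral.intervalIntegrable_rpow' ha)
    refine Integrable.mono' near_zero hmeas.aestronglyMeasurable ?_
    filter_upwards [ae_restrict_mem measurableSet_Ioc] with y ⟨hy, _⟩
    rw [Real.norm_of_nonneg (by positivity)]
    exact mul_le_of_le_one_right (by positivity)
      (Real.rpow_le_one_of_one_le_of_nonpos (by linarith) hb)
  · have near_top : IntegrableOn (fun y : ℝ => y ^ (a + b)) (Ioi 1) :=
      integrableOn_Ioi_rpow_of_lt hab one_pos
    refine Integrable.mono' near_top hmeas.aestronglyMeasurable ?_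
    filter_upwards [ae_restrict_mem measurableSet_Ioi] with y (hy : 1 < y)
    have hy₀ : 0 < y := one_pos.trans hy
    rw [Real.norm_of_nonneg (by positivity), Real.rpow_add hy₀]
    exact mul_le_mul_of_nonneg_left
      (Real.rpow_le_rpow_of_nonpos hy₀ (by linarith) hb) (by positivity)

theorem integrable_norm_rpow_mul_one_add_norm_rpow {E : Type*} [NormedAddCommGroup E]
    [NormedSpace ℝ E] [FiniteDimensional ℝ E] [Nontrivial E] [MeasurableSpace E] [BorelSpace E]
    (μ : Measure E) [μ.IsAddHaarMeasure] {a b : ℝ} (ha : 0 < Module.finrank ℝ E + a)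
    (hab : Module.finrank ℝ E + a + b < 0) :
    Integrable (fun x : E => ‖x‖ ^ a * (1 + ‖x‖) ^ b) μ := by
  rw [integrable_fun_norm_addHaar μ (f := fun y : ℝ => y ^ a * (1 + y) ^ b)]
  refine (integrableOn_rpow_mul_one_add_rpow (a := Module.finrank ℝ E - 1 + a) (b := b)
    (by linarith) (by linarith)).congr_fun (fun y (hy : 0 < y) => ?_) measurableSet_Ioi
  have hdim : ((Module.finrank ℝ E - 1 : ℕ) : ℝ) = Module.finrank ℝ E - 1 :=
    Nat.cast_pred Module.finrank_pos
  rw [smul_eq_mul, ← mul_assoc, ← Real.rpow_natCast, ← Real.rpow_add hy, hdim]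

theorem integrable_exp_smul_comp_exp_iff {E : Type*} [NormedAddCommGroup E] [NormedSpace ℝ E]
    {g : ℝ → E} :
    Integrable (fun x : ℝ => Real.exp x • g (Real.exp x)) ↔ IntegrableOn g (Ioi 0) := by
  rw [← Real.range_exp, ← image_univ, integrableOn_image_iff_integrableOn_abs_deriv_smul .univ
    (fun x _ => (Real.hasDerivAt_exp x).hasDerivWithinAt) Real.exp_injective.injOn,
    integrableOn_univ]
  simp only [abs_of_pos (Real.exp_pos _)]

theorem integral_exp_smul_comp_exp {E : Type*} [NormedAddCommGroup E] [NormedSpace ℝ E]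
    (g : ℝ → E) : ∫ x : ℝ, Real.exp x • g (Real.exp x) = ∫ s in Ioi 0, g s := by
  rw [← Real.range_exp, ← image_univ, integral_image_eq_integral_abs_deriv_smul .univ
    (fun x _ => (Real.hasDerivAt_exp x).hasDerivWithinAt) Real.exp_injective.injOn,
    setIntegral_univ]
  simp only [abs_of_pos (Real.exp_pos _)]

theorem tendsto_intervalIntegral_vertical {E : Type*} [NormedAddCommGroup E] [NormedSpace ℂ E]
    [CompleteSpace E] {F : ℂ → E} {b : ℝ} (hb : 0 ≤ b)
    (hF : ContinuousOn F (Complex.im ⁻¹' Icc (-b) b)) {l : Filter ℝ} [l.IsCountablyGenerated]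
    {c : E} (hlim : Tendsto F (comap Complex.re l ⊓ 𝓟 (Complex.im ⁻¹' Icc (-b) b)) (𝓝 c)) :
    Tendsto (fun L : ℝ => ∫ y in (-b)..b, F (L + y * Complex.I)) l (𝓝 ((2 * b : ℂ) • c)) := by
  have hconst : (2 * b : ℂ) • c = ∫ _ in (-b)..b, c := by
    rw [intervalIntegral.integral_const, sub_neg_eq_add, ← two_mul, ← Complex.coe_smul]
    push_cast
    rfl
  have hseg : ∀ L : ℝ, MapsTo (fun y : ℝ => (L : ℂ) + y * Complex.I) (Icc (-b) b)
      (Complex.im ⁻¹' Icc (-b) b) := fun L y hy => by simpa using hy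
  have heventually : ∀ s ∈ 𝓝 c, ∀ᶠ L : ℝ in l, ∀ y ∈ Icc (-b) b, F (L + y * Complex.I) ∈ s := by
    intro s hs
    obtain ⟨t, ht, hts⟩ := mem_comap.1 (mem_inf_principal.1 (hlim hs))
    filter_upwards [ht] with L hL y hy
    exact hts (by simpa using hL) (hseg L hy)
  rw [hconst]
  refine intervalIntegral.tendsto_integral_filter_of_dominated_convergence (fun _ => ‖c‖ + 1)
    (.of_forall fun L => ?_) ?_ intervalIntegrable_const (.of_forall fun y hy s hs => ?_)
  · rw [uIoc_of_le (by linarith)]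
    exact ((hF.comp (by fun_prop) (hseg L)).mono Ioc_subset_Icc_self).aestronglyMeasurable
      measurableSet_Ioc
  · filter_upwards [heventually _ (Metric.ball_mem_nhds c one_pos)] with L hL
    refine .of_forall fun y hy => ?_
    rw [uIoc_of_le (by linarith)] at hy
    have := norm_le_norm_add_norm_sub' (F (L + y * Complex.I)) c
    linarith [mem_ball_iff_norm.1 (hL y (Ioc_subset_Icc_self hy))]
  · rw [uIoc_of_le (by linarith)] at hy
    exact (heventually s hs).mono fun L hL => hL y (Ioc_subset_Icc_self hy)

theorem integral_boundary_strip {E : Type*} [NormedAddCommGroup E] [NormedSpace ℂ E]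
    [CompleteSpace E] {F : ℂ → E} {b : ℝ} (hb : 0 ≤ b)
    (hF : DifferentiableOn ℂ F (Complex.im ⁻¹' Icc (-b) b)) {cbot ctop : E}
    (hbot : Tendsto F (comap Complex.re atBot ⊓ 𝓟 (Complex.im ⁻¹' Icc (-b) b)) (𝓝 cbot))
    (htop : Tendsto F (comap Complex.re atTop ⊓ 𝓟 (Complex.im ⁻¹' Icc (-b) b)) (𝓝 ctop))
    (hint : Integrable fun x : ℝ => F (x + (-b : ℝ) * Complex.I) - F (x + b * Complex.I)) :
    ∫ x : ℝ, F (x + (-b : ℝ) * Complex.I) - F (x + b * Complex.I)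
      = Complex.I • (2 * b : ℂ) • (cbot - ctop) := by
  have hside : ∀ y ∈ Icc (-b) b, Continuous fun x : ℝ => F (x + y * Complex.I) := fun y hy =>
    hF.continuousOn.comp_continuous (by fun_prop) fun x => by simpa using hy
  have hrect : ∀ L : ℝ, ∫ x in (-L)..L, F (x + (-b : ℝ) * Complex.I) - F (x + b * Complex.I)
      = Complex.I • ((∫ y in (-b)..b, F ((-L : ℝ) + y * Complex.I))
        - ∫ y in (-b)..b, F (L + y * Complex.I)) := by
    intro L
    have hCauchy := Complex.integral_boundary_rect_eq_zero_of_differentiableOn F ⟨-L, -b⟩ ⟨L, b⟩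
      (hF.mono fun w hw => by simpa [uIcc_of_le (neg_le_self hb)] using hw.2)
    rw [intervalIntegral.integral_sub
      ((hside _ (left_mem_Icc.2 (neg_le_self hb))).intervalIntegrable _ _)
      ((hside _ (right_mem_Icc.2 (neg_le_self hb))).intervalIntegrable _ _), smul_sub,
      ← sub_eq_zero, ← hCauchy]
    abel
  refine tendsto_nhds_unique (intervalIntegral_tendsto_integral hint tendsto_neg_atTop_atBot
    tendsto_id) ?_
  simp only [hrect, id, smul_sub]
  exact (((tendsto_intervalIntegral_vertical hb hF.continuousOn hbot).comp
    tendsto_neg_atTop_atBot).const_smul _).sub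
    ((tendsto_intervalIntegral_vertical hb hF.continuousOn htop).const_smul _)

end ExponentialCoordinates

/-! ### Dispersion relation for `1 / (u ^ ν + a)` -/

theorem sin_pi_mul_pos {ν : ℝ} (hν : ν ∈ Ioo (0 : ℝ) 1) : 0 < Real.sin (π * ν) :=
  Real.sin_pos_of_pos_of_lt_pi (mul_pos pi_pos hν.1) (mul_lt_of_lt_one_right pi_pos hν.2)

/-- The spectral density of `1 / (u ^ ν + a)`: minus the imaginary part of the boundary value of
this function on the upper side of its cut, at `u = -s + i0`. -/
noncomputable def spectralDensity (ν a s : ℝ) : ℝ :=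
  Real.sin (π * ν) * (s ^ ν / (s ^ (2 * ν) + a * (2 * Real.cos (π * ν)) * s ^ ν + a ^ 2))

theorem measurable_spectralDensity (ν a : ℝ) : Measurable (spectralDensity ν a) := by
  unfold spectralDensity
  fun_prop

theorem sq_rpow_mul_sin_le_spectralDenom (ν a : ℝ) {s : ℝ} (hs : 0 ≤ s) :
    (s ^ ν * Real.sin (π * ν)) ^ 2
      ≤ s ^ (2 * ν) + a * (2 * Real.cos (π * ν)) * s ^ ν + a ^ 2 := by
  rw [mul_comm 2 ν, Real.rpow_mul hs, Real.rpow_two]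
  nlinarith [sq_nonneg (a + Real.cos (π * ν) * s ^ ν), Real.sin_sq_add_cos_sq (π * ν)]

section SpectralDensity

variable {ν : ℝ} (hν : ν ∈ Ioo (0 : ℝ) 1) (a : ℝ) {s : ℝ} (hs : 0 < s)
include hν hs

theorem spectralDenom_pos :
    0 < s ^ (2 * ν) + a * (2 * Real.cos (π * ν)) * s ^ ν + a ^ 2 :=
  lt_of_lt_of_le (pow_pos (mul_pos (Real.rpow_pos_of_pos hs ν) (sin_pi_mul_pos hν)) 2)
    (sq_rpow_mul_sin_le_spectralDenom ν a hs.le)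

theorem spectralDensity_pos : 0 < spectralDensity ν a s :=
  mul_pos (sin_pi_mul_pos hν) (div_pos (Real.rpow_pos_of_pos hs ν) (spectralDenom_pos hν a hs))

theorem spectralDensity_le : spectralDensity ν a s ≤ s ^ (-ν) / Real.sin (π * ν) := by
  have hsin := sin_pi_mul_pos hν
  have : 0 < s ^ ν := Real.rpow_pos_of_pos hs ν
  calc spectralDensity ν a s
      ≤ Real.sin (π * ν) * (s ^ ν / (s ^ ν * Real.sin (π * ν)) ^ 2) := by
        unfold spectralDensity
        gcongr
        exact sq_rpow_mul_sin_le_spectralDenom ν a hs.le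
    _ = s ^ (-ν) / Real.sin (π * ν) := by
        rw [Real.rpow_neg hs.le]
        field_simp

end SpectralDensity

/-- The function `1 / (z ^ ν + a)` in the logarithmic coordinate `z = exp w`. -/
noncomputable def logPropagator (ν a : ℝ) (w : ℂ) : ℂ := (Complex.exp (ν * w) + a)⁻¹

/-- The closed strip of width `2π` which `exp` maps onto the plane cut along the negative axis,
both sides of the cut included. -/
abbrev logStrip : Set ℂ := Complex.im ⁻¹' Icc (-π) π

theorem logPropagator_jump (ν a x : ℝ) :
    logPropagator ν a (x + (-π : ℝ) * Complex.I) - logPropagator ν a (x + π * Complex.I)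
      = 2 * Complex.I * (spectralDensity ν a (Real.exp x) : ℂ) := by
  set z : ℂ := Complex.exp (ν * (x + π * Complex.I)) + a with hz
  have hpow : Real.exp x ^ ν = Real.exp (ν * x) := by rw [← Real.exp_mul, mul_comm]
  have hpow_two : Real.exp x ^ (2 * ν) = Real.exp (ν * x) ^ 2 := by
    rw [mul_comm, Real.rpow_mul (Real.exp_pos x).le, Real.rpow_two, hpow]
  have hre : z.re = Real.exp (ν * x) * Real.cos (π * ν) + a := by
    simp [hz, Complex.exp_re, mul_comm π]
  have him : z.im = Real.exp (ν * x) * Real.sin (π * ν) := by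
    simp [hz, Complex.exp_im, mul_comm π]
  have hconj : Complex.exp (ν * (x + (-π : ℝ) * Complex.I)) + a = (starRingEnd ℂ) z := by
    rw [hz, map_add, ← Complex.exp_conj]
    simp
  have hnormSq : Complex.normSq z = Real.exp x ^ (2 * ν)
      + a * (2 * Real.cos (π * ν)) * Real.exp x ^ ν + a ^ 2 := by
    rw [Complex.normSq_apply, hre, him, hpow, hpow_two]
    linear_combination Real.exp (ν * x) ^ 2 * Real.sin_sq_add_cos_sq (π * ν)
  unfold logPropagator
  rw [hconj, ← hz, Complex.inv_def, Complex.inv_def, Complex.conj_conj, Complex.normSq_conj,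
    ← sub_mul, Complex.sub_conj, him, hnormSq, spectralDensity, hpow]
  push_cast
  ring

theorem exp_add_ofReal_ne_zero {a : ℝ} (ha : 0 ≤ a) {w : ℂ} (hw : |w.im| < π) :
    Complex.exp w + a ≠ 0 := by
  intro h
  have hexp : Complex.exp w = ((-a : ℝ) : ℂ) := by rw [eq_neg_of_add_eq_zero_left h]; simp
  have him : w.im = 0 := by
    have := congrArg Complex.im hexp
    rwa [Complex.exp_im, Complex.ofReal_im, mul_eq_zero, or_iff_right (Real.exp_pos w.re).ne',
      Real.sin_eq_zero_iff_of_lt_of_lt (abs_lt.1 hw).1 (abs_lt.1 hw).2] at this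
  have hre := congrArg Complex.re hexp
  rw [Complex.exp_re, him, Real.cos_zero, mul_one, Complex.ofReal_re] at hre
  linarith [Real.exp_pos w.re]

theorem eq_ofReal_of_exp_eq {w : ℂ} (hw : w ∈ logStrip) {x : ℝ}
    (h : Complex.exp w = Complex.exp x) : w = x := by
  obtain ⟨m, hm⟩ := Complex.exp_eq_exp_iff_exists_int.1 h
  have him : w.im = m * (2 * π) := by simpa using congrArg Complex.im hm
  have hm_abs : |(m : ℝ)| * (2 * π) ≤ 1 * π := by
    rw [← abs_of_pos two_pi_pos, ← abs_mul, ← him, one_mul]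
    exact abs_le.2 hw
  have hm_zero : m = 0 := by
    have : |(m : ℝ)| < 1 := by nlinarith [pi_pos, abs_nonneg (m : ℝ)]
    exact Int.abs_lt_one_iff.1 (by exact_mod_cast this)
  rw [hm, hm_zero]
  simp

section LogPropagator

variable {ν : ℝ} (hν : ν ∈ Ioo (0 : ℝ) 1) {a : ℝ} (ha : 0 ≤ a)
include hν ha

theorem differentiableOn_logPropagator : DifferentiableOn ℂ (logPropagator ν a) logStrip := by
  refine fun w hw => DifferentiableAt.differentiableWithinAt
    (DifferentiableAt.inv (h := fun w => Complex.exp (ν * w) + a) (by fun_prop)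
      (exp_add_ofReal_ne_zero ha ?_))
  rw [Complex.im_ofReal_mul, abs_mul, abs_of_pos hν.1]
  exact (mul_le_mul_of_nonneg_left (abs_le.2 hw) hν.1.le).trans_lt
    (mul_lt_of_lt_one_left pi_pos hν.2)

theorem norm_logPropagator_le {w : ℂ} (hw : w ∈ logStrip) :
    ‖logPropagator ν a w‖ ≤ Real.exp (-(ν * w.re)) / Real.sin (π * ν) := by
  have hsin := sin_pi_mul_pos hν
  set t := Real.exp (ν * w.re) with ht
  have ht₀ : 0 < t := Real.exp_pos _
  have hcos : Real.cos (π * ν) ≤ Real.cos (ν * w.im) := by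
    rw [← Real.cos_abs (ν * w.im), abs_mul, abs_of_pos hν.1, mul_comm π]
    exact Real.cos_le_cos_of_nonneg_of_le_pi (mul_nonneg hν.1.le (abs_nonneg _))
      (mul_le_of_le_one_left pi_pos.le hν.2.le) (mul_le_mul_of_nonneg_left (abs_le.2 hw) hν.1.le)
  have hnorm_sq : ‖Complex.exp (ν * w) + a‖ ^ 2 = t ^ 2 + 2 * (a * t) * Real.cos (ν * w.im)
      + a ^ 2 := by
    rw [← Complex.normSq_eq_norm_sq, Complex.normSq_apply]
    simp only [Complex.add_re, Complex.add_im, Complex.exp_re, Complex.exp_im, Complex.ofReal_re,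
      Complex.ofReal_im, Complex.re_ofReal_mul, Complex.im_ofReal_mul, add_zero, ← ht]
    linear_combination t ^ 2 * Real.sin_sq_add_cos_sq (ν * w.im)
  have hle : t * Real.sin (π * ν) ≤ ‖Complex.exp (ν * w) + a‖ := by
    refine (sq_le_sq₀ (by positivity) (norm_nonneg _)).1 ?_
    rw [hnorm_sq]
    nlinarith [sq_nonneg (a + Real.cos (π * ν) * t), Real.sin_sq_add_cos_sq (π * ν),
      mul_le_mul_of_nonneg_left hcos (mul_nonneg ha ht₀.le)]
  rw [logPropagator, norm_inv, Real.exp_neg, ← ht, div_eq_mul_inv, ← mul_inv]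
  exact inv_anti₀ (by positivity) hle

theorem tendsto_logPropagator_atTop :
    Tendsto (logPropagator ν a) (comap Complex.re atTop ⊓ 𝓟 logStrip) (𝓝 0) := by
  have hbound : Tendsto (fun x : ℝ => Real.exp (-(ν * x)) / Real.sin (π * ν)) atTop (𝓝 0) := by
    simpa using (Real.tendsto_exp_neg_atTop_nhds_zero.comp
      (tendsto_id.const_mul_atTop hν.1)).div_const (Real.sin (π * ν))
  refine squeeze_zero_norm' ?_ ((hbound.comp tendsto_comap).mono_left inf_le_left)
  exact (eventually_principal.2 fun w hw => norm_logPropagator_le hν ha hw).filter_mono inf_le_right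

theorem tendsto_logPropagator_mul_exp_atBot :
    Tendsto (fun w => logPropagator ν a w * Complex.exp w)
      (comap Complex.re atBot ⊓ 𝓟 logStrip) (𝓝 0) := by
  have hbound : Tendsto (fun x : ℝ => Real.exp ((1 - ν) * x) / Real.sin (π * ν)) atBot (𝓝 0) := by
    simpa using (Real.tendsto_exp_atBot.comp
      (tendsto_id.const_mul_atBot (sub_pos.2 hν.2))).div_const (Real.sin (π * ν))
  refine squeeze_zero_norm' ?_ ((hbound.comp tendsto_comap).mono_left inf_le_left)
  refine (eventually_principal.2 fun w hw => ?_).filter_mono inf_le_right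
  calc ‖logPropagator ν a w * Complex.exp w‖
      ≤ Real.exp (-(ν * w.re)) / Real.sin (π * ν) * Real.exp w.re := by
        rw [norm_mul, Complex.norm_exp]
        gcongr
        exact norm_logPropagator_le hν ha hw
    _ = Real.exp ((1 - ν) * w.re) / Real.sin (π * ν) := by
        rw [div_mul_eq_mul_div, ← Real.exp_add]
        ring_nf

end LogPropagator

/-- The integrand of the Cauchy formula for `1 / (u ^ ν + a)`, `u = exp x₀`, in the logarithmic
coordinate. The value at the pole is subtracted, and the quotient of `dslope`s extends the result
holomorphically to `w = x₀`. -/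
noncomputable def dispersionIntegrand (ν a x₀ : ℝ) (w : ℂ) : ℂ :=
  dslope (logPropagator ν a) x₀ w / dslope Complex.exp x₀ w * Complex.exp w

theorem dispersionIntegrand_of_ne (ν a : ℝ) {x₀ : ℝ} {w : ℂ} (hw : w ≠ x₀) :
    dispersionIntegrand ν a x₀ w = (logPropagator ν a w - logPropagator ν a x₀)
      * (Complex.exp w / (Complex.exp w - Complex.exp x₀)) := by
  rw [dispersionIntegrand, dslope_of_ne _ hw, dslope_of_ne _ hw, slope_def_field, slope_def_field,
    div_div_div_cancel_right₀ (sub_ne_zero.2 hw)]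
  ring

theorem dispersionIntegrand_jump (ν a x₀ x : ℝ) :
    dispersionIntegrand ν a x₀ (x + (-π : ℝ) * Complex.I)
        - dispersionIntegrand ν a x₀ (x + π * Complex.I)
      = (2 * Complex.I) * ((Real.exp x • (spectralDensity ν a (Real.exp x)
          / (Real.exp x + Real.exp x₀)) : ℝ) : ℂ) := by
  have hoff : ∀ y : ℝ, y ≠ 0 → (x : ℂ) + y * Complex.I ≠ x₀ := fun y hy h => hy (by
    simpa using congrArg Complex.im h)
  have hexp : Complex.exp (x + π * Complex.I) = -(Real.exp x : ℂ) := by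
    rw [Complex.exp_add, Complex.exp_pi_mul_I, Complex.ofReal_exp, mul_neg_one]
  have hexp_neg : Complex.exp (x + (-π : ℝ) * Complex.I) = -(Real.exp x : ℂ) := by
    rw [Complex.exp_add, Complex.ofReal_neg, neg_mul, Complex.exp_neg_pi_mul_I, Complex.ofReal_exp,
      mul_neg_one]
  rw [dispersionIntegrand_of_ne ν a (hoff _ (neg_ne_zero.2 pi_ne_zero)),
    dispersionIntegrand_of_ne ν a (hoff _ pi_ne_zero), hexp, hexp_neg, ← sub_mul,
    sub_sub_sub_cancel_right, logPropagator_jump, ← neg_add', neg_div_neg_eq, ← Complex.ofReal_exp,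
    smul_eq_mul]
  push_cast
  ring

section DispersionRelation

variable {ν : ℝ} (hν : ν ∈ Ioo (0 : ℝ) 1)
include hν

theorem integrableOn_spectralDensity_div_add (a : ℝ) {u : ℝ} (hu : 0 < u) :
    IntegrableOn (fun s => spectralDensity ν a s / (s + u)) (Ioi 0) := by
  have hsin := sin_pi_mul_pos hν
  have hmajorant : IntegrableOn (fun s : ℝ => s ^ (-ν) * (1 + s) ^ (-1 : ℝ)) (Ioi 0) :=
    integrableOn_rpow_mul_one_add_rpow (by linarith [hν.2]) (by linarith [hν.1])
  have hmeas : Measurable fun s => spectralDensity ν a s / (s + u) :=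
    (measurable_spectralDensity ν a).div (by fun_prop)
  have : 0 < min 1 u := lt_min one_pos hu
  refine Integrable.mono' (hmajorant.const_mul (Real.sin (π * ν) * min 1 u)⁻¹)
    hmeas.aestronglyMeasurable ?_
  filter_upwards [ae_restrict_mem measurableSet_Ioi] with s (hs : 0 < s)
  have hρ := spectralDensity_pos hν a hs
  have hadd : min 1 u * (1 + s) ≤ s + u := by nlinarith [min_le_left 1 u, min_le_right 1 u]
  rw [Real.norm_of_nonneg (by positivity)]
  calc spectralDensity ν a s / (s + u)
      ≤ (s ^ (-ν) / Real.sin (π * ν)) / (min 1 u * (1 + s)) := by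
        gcongr
        exact spectralDensity_le hν a hs
    _ = _ := by
        rw [Real.rpow_neg_one]
        field_simp

variable {a : ℝ} (ha : 0 ≤ a)
include ha

theorem differentiableOn_dispersionIntegrand (x₀ : ℝ) :
    DifferentiableOn ℂ (dispersionIntegrand ν a x₀) logStrip := by
  have hstrip : logStrip ∈ 𝓝 (x₀ : ℂ) :=
    Complex.continuous_im.continuousAt.preimage_mem_nhds
      (Icc_mem_nhds (by simp [pi_pos]) (by simp [pi_pos]))
  have hexp : DifferentiableOn ℂ Complex.exp logStrip := Complex.differentiable_exp.differentiableOn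
  refine (((Complex.differentiableOn_dslope hstrip).2 (differentiableOn_logPropagator hν ha)).div
    ((Complex.differentiableOn_dslope hstrip).2 hexp) fun w hw => ?_).mul hexp
  rcases eq_or_ne w x₀ with rfl | hne
  · rw [dslope_same, Complex.deriv_exp]
    exact Complex.exp_ne_zero _
  · rw [dslope_of_ne _ hne, slope_def_field]
    exact div_ne_zero (sub_ne_zero.2 fun h => hne (eq_ofReal_of_exp_eq hw h)) (sub_ne_zero.2 hne)

theorem tendsto_dispersionIntegrand_atTop (x₀ : ℝ) :
    Tendsto (dispersionIntegrand ν a x₀) (comap Complex.re atTop ⊓ 𝓟 logStrip)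
      (𝓝 (-logPropagator ν a x₀)) := by
  have hkernel : Tendsto (fun z : ℂ => 1 + Complex.exp x₀ * (z - Complex.exp x₀)⁻¹)
      (Bornology.cobounded ℂ) (𝓝 1) := by
    simpa using ((tendsto_inv₀_cobounded.comp
      (tendsto_sub_const_cobounded (Complex.exp x₀))).const_mul (Complex.exp x₀)).const_add 1
  have hlim := ((tendsto_logPropagator_atTop hν ha).sub_const (logPropagator ν a x₀)).mul
    ((hkernel.comp Complex.tendsto_exp_comap_re_atTop).mono_left inf_le_left)
  rw [zero_sub, mul_one] at hlim
  refine hlim.congr' ?_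
  have hright : ∀ᶠ w in comap Complex.re atTop, x₀ < w.re :=
    tendsto_comap.eventually (eventually_gt_atTop x₀)
  filter_upwards [hright.filter_mono inf_le_left, mem_inf_of_right (mem_principal_self _)]
    with w hw hstrip
  have hne : w ≠ x₀ := fun h => hw.ne' (by simp [h])
  have : Complex.exp w - Complex.exp x₀ ≠ 0 :=
    sub_ne_zero.2 fun h => hne (eq_ofReal_of_exp_eq hstrip h)
  rw [dispersionIntegrand_of_ne ν a hne, Function.comp_apply]
  field_simp
  ring

theorem tendsto_dispersionIntegrand_atBot (x₀ : ℝ) :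
    Tendsto (dispersionIntegrand ν a x₀) (comap Complex.re atBot ⊓ 𝓟 logStrip) (𝓝 0) := by
  have hexp := Complex.tendsto_exp_comap_re_atBot.mono_left
    (inf_le_left (b := 𝓟 logStrip))
  have hlim := (((tendsto_logPropagator_mul_exp_atBot hν ha).sub
    (hexp.const_mul (logPropagator ν a x₀))).div (hexp.sub_const (Complex.exp x₀))
    (by simp [Complex.exp_ne_zero]))
  rw [mul_zero, sub_zero, zero_div] at hlim
  refine hlim.congr' ?_
  have hleft : ∀ᶠ w in comap Complex.re atBot, w.re < x₀ :=
    tendsto_comap.eventually (eventually_lt_atBot x₀)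
  filter_upwards [hleft.filter_mono inf_le_left] with w hw
  rw [dispersionIntegrand_of_ne ν a fun h => hw.ne (by simp [h])]
  simp only [Pi.div_apply]
  ring

theorem integral_spectralDensity_div_add {u : ℝ} (hu : 0 < u) :
    ∫ s in Ioi 0, spectralDensity ν a s / (s + u) = π * (u ^ ν + a)⁻¹ := by
  obtain ⟨x₀, rfl⟩ : ∃ x₀, Real.exp x₀ = u := ⟨Real.log u, Real.exp_log hu⟩
  have hpole : logPropagator ν a x₀ = (((Real.exp x₀ ^ ν + a)⁻¹ : ℝ) : ℂ) := by
    rw [logPropagator, ← Real.exp_mul, mul_comm]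
    push_cast
    rfl
  have hint := integrable_exp_smul_comp_exp_iff.2 (integrableOn_spectralDensity_div_add hν a hu)
  have hCauchy := integral_boundary_strip pi_pos.le (differentiableOn_dispersionIntegrand hν ha x₀)
    (tendsto_dispersionIntegrand_atBot hν ha x₀) (tendsto_dispersionIntegrand_atTop hν ha x₀)
    (by simp only [dispersionIntegrand_jump]; exact hint.ofReal.const_mul _)
  simp only [dispersionIntegrand_jump, integral_const_mul, integral_complex_ofReal,
    integral_exp_smul_comp_exp fun s => spectralDensity ν a s / (s + Real.exp x₀), zero_sub,
    neg_neg, hpole] at hCauchy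
  have : (2 * Complex.I) * ((∫ s in Ioi 0, spectralDensity ν a s / (s + Real.exp x₀) : ℝ) : ℂ)
      = 2 * Complex.I * ((π * (Real.exp x₀ ^ ν + a)⁻¹ : ℝ) : ℂ) := by
    rw [hCauchy, smul_eq_mul, smul_eq_mul]
    push_cast
    ring
  exact_mod_cast mul_left_cancel₀ (by simp) this

end DispersionRelation

/-! ### Mass-shell coordinates on the future cone -/

section MassShell

open scoped ENNReal

variable {n : ℕ}

theorem energy_pos (k : EuclideanSpace ℝ (Fin n)) {q : ℝ} (hq : 0 < q) : 0 < energy k q :=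
  Real.sqrt_pos.2 (by positivity)

theorem energy_sq (k : EuclideanSpace ℝ (Fin n)) (q : ℝ) : energy k q ^ 2 = ‖k‖ ^ 2 + q ^ 2 :=
  Real.sq_sqrt (by positivity)

theorem norm_lt_energy (k : EuclideanSpace ℝ (Fin n)) {q : ℝ} (hq : 0 < q) : ‖k‖ < energy k q :=
  Real.lt_sqrt_of_sq_lt (lt_add_of_pos_right _ (by positivity))

theorem le_energy (k : EuclideanSpace ℝ (Fin n)) (q : ℝ) : q ≤ energy k q :=
  Real.le_sqrt_of_sq_le (le_add_of_nonneg_left (sq_nonneg _))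

theorem negSq_energy (k : EuclideanSpace ℝ (Fin n)) (q : ℝ) : negSq (energy k q, k) = q ^ 2 := by
  rw [negSq, energy_sq, add_sub_cancel_left]

theorem continuous_energy : Continuous fun y : EuclideanSpace ℝ (Fin n) × ℝ => energy y.1 y.2 := by
  unfold energy
  fun_prop

theorem hasDerivAt_energy (k : EuclideanSpace ℝ (Fin n)) {q : ℝ} (hq : 0 < q) :
    HasDerivAt (energy k) (q / energy k q) q := by
  have h : HasDerivAt (energy k) ((2 : ℕ) * q ^ (2 - 1) / (2 * energy k q)) q :=
    ((hasDerivAt_pow 2 q).const_add (‖k‖ ^ 2)).sqrt (by positivity)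
  convert h using 1
  simp only [Nat.cast_ofNat, Nat.add_one_sub_one, pow_one]
  rw [mul_div_mul_left _ _ two_ne_zero]

theorem image_energy (k : EuclideanSpace ℝ (Fin n)) : energy k '' Ioi 0 = Ioi ‖k‖ := by
  refine Subset.antisymm (image_subset_iff.2 fun q hq => norm_lt_energy k hq) fun w hw => ?_
  have hgap : 0 < w ^ 2 - ‖k‖ ^ 2 := sub_pos.2 (by have : ‖k‖ < w := hw; gcongr)
  refine ⟨√(w ^ 2 - ‖k‖ ^ 2), Real.sqrt_pos.2 hgap, ?_⟩
  rw [energy, Real.sq_sqrt hgap.le, add_sub_cancel,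
    Real.sqrt_sq ((norm_nonneg k).trans (le_of_lt hw))]

theorem injOn_energy (k : EuclideanSpace ℝ (Fin n)) : InjOn (energy k) (Ioi 0) := by
  intro q hq q' hq' h
  have hsq : q ^ 2 = q' ^ 2 := by rw [← negSq_energy k q, h, negSq_energy]
  exact (sq_eq_sq₀ (le_of_lt hq) (le_of_lt hq')).1 hsq

theorem rpow_one_sub_mul_norm_rpow_le_energy {ν : ℝ} (hν : ν ∈ Ioo (0 : ℝ) 1)
    (k : EuclideanSpace ℝ (Fin n)) {q : ℝ} (hq : 0 < q) :
    q ^ (1 - ν) * ‖k‖ ^ ν ≤ energy k q := by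
  have hE := energy_pos k hq
  calc q ^ (1 - ν) * ‖k‖ ^ ν ≤ energy k q ^ (1 - ν) * energy k q ^ ν := by
        gcongr
        exacts [sub_nonneg.2 hν.2.le, le_energy k q, hν.1.le, (norm_lt_energy k hq).le]
    _ = energy k q := by
        rw [← Real.rpow_add hE, sub_add_cancel, Real.rpow_one]

/-- The open future light cone. -/
def futureCone (n : ℕ) : Set (Mink n) := {p | ‖p.2‖ < p.1}

theorem isOpen_futureCone : IsOpen (futureCone n) :=
  isOpen_lt continuous_snd.norm continuous_fst

theorem continuous_negSq : Continuous (negSq : Mink n → ℝ) := by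
  unfold negSq
  fun_prop

theorem negSq_pos {p : Mink n} (hp : p ∈ futureCone n) : 0 < negSq p :=
  sub_pos.2 (pow_lt_pow_left₀ hp (norm_nonneg _) two_ne_zero)

theorem norm_eq_fst_of_mem_futureCone {p : Mink n} (hp : p ∈ futureCone n) : ‖p‖ = p.1 := by
  rw [Prod.norm_def, Real.norm_of_nonneg ((norm_nonneg p.2).trans (le_of_lt hp)),
    max_eq_left (le_of_lt hp)]

/-- The momentum `(√(|k|² + q²), k)` of mass `q` and spatial momentum `k`: for `0 < q` these are
coordinates on the open future light cone. -/
noncomputable def shell (y : EuclideanSpace ℝ (Fin n) × ℝ) : Mink n := (energy y.1 y.2, y.1)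

/-- The range of the mass-shell coordinates `(k, q)`. -/
abbrev shellDomain (n : ℕ) : Set (EuclideanSpace ℝ (Fin n) × ℝ) := univ ×ˢ Ioi 0

theorem continuous_shell : Continuous (shell (n := n)) := continuous_energy.prodMk continuous_fst

theorem measurableSet_shellDomain : MeasurableSet (shellDomain n) :=
  MeasurableSet.univ.prod measurableSet_Ioi

theorem setLIntegral_futureCone {F : Mink n → ℝ≥0∞} (hF : Measurable F) :
    ∫⁻ p in futureCone n, F p
      = ∫⁻ y in shellDomain n, ENNReal.ofReal (y.2 / energy y.1 y.2) * F (shell y) := by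
  have hcone := isOpen_futureCone (n := n).measurableSet
  have hshell : Measurable fun y : EuclideanSpace ℝ (Fin n) × ℝ =>
      ENNReal.ofReal (y.2 / energy y.1 y.2) * F (shell y) :=
    (measurable_snd.div continuous_energy.measurable).ennreal_ofReal.mul
      (hF.comp continuous_shell.measurable)
  rw [← lintegral_indicator hcone, Measure.volume_eq_prod,
    lintegral_prod_symm' _ (hF.indicator hcone), Measure.volume_eq_prod, ← Measure.prod_restrict,
    Measure.restrict_univ, lintegral_prod _ hshell.aemeasurable]
  refine lintegral_congr fun k => ?_
  calc ∫⁻ w, (futureCone n).indicator F (w, k)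
      = ∫⁻ w in energy k '' Ioi 0, F (w, k) := by
        rw [image_energy, ← lintegral_indicator measurableSet_Ioi]
        rfl
    _ = ∫⁻ q in Ioi 0, ENNReal.ofReal |q / energy k q| * F (energy k q, k) :=
        lintegral_image_eq_lintegral_abs_deriv_mul measurableSet_Ioi
          (fun q hq => (hasDerivAt_energy k hq).hasDerivWithinAt) (injOn_energy k) _
    _ = _ := setLIntegral_congr_fun measurableSet_Ioi fun q (hq : 0 < q) => by
        simp only [abs_of_nonneg (div_nonneg hq.le (energy_pos k hq).le), shell]

theorem Aconst_pos {ν : ℝ} (hn : 1 ≤ n) (hν : ν ∈ Ioo (0 : ℝ) 1) : 0 < Aconst n ν := by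
  have hn' : (1 : ℝ) ≤ n := by exact_mod_cast hn
  have : 0 < Real.Gamma ν := Real.Gamma_pos_of_pos hν.1
  have : 0 < Real.Gamma (((n : ℝ) + 1) / 2 - ν) := Real.Gamma_pos_of_pos (by linarith [hν.2])
  unfold Aconst
  positivity

theorem wightmanDensity_eq_indicator (n : ℕ) (ν f : ℝ) :
    wightmanDensity n ν f = (futureCone n).indicator fun p =>
      2 * Aconst n ν * spectralDensity ν (f * Aconst n ν) (negSq p) := by
  ext p
  simp only [wightmanDensity, indicator, futureCone, mem_ofPred_eq, spectralDensity, mul_assoc]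

theorem measurable_wightmanDensity (n : ℕ) (ν f : ℝ) : Measurable (wightmanDensity n ν f) := by
  rw [wightmanDensity_eq_indicator]
  exact (((measurable_spectralDensity _ _).comp continuous_negSq.measurable).const_mul _).indicator
    isOpen_futureCone.measurableSet

/-- The momentum-space measure of the boundary Wightman function, up to the factor `(2π)^d`. -/
noncomputable def wightmanMeasure (n : ℕ) (ν f : ℝ) : Measure (Mink n) :=
  volume.withDensity fun p => ENNReal.ofReal (wightmanDensity n ν f p)

instance instSFiniteWightmanMeasure (n : ℕ) (ν f : ℝ) : SFinite (wightmanMeasure n ν f) :=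
  inferInstanceAs (SFinite (volume.withDensity _))

theorem ae_mem_futureCone (n : ℕ) (ν f : ℝ) : ∀ᵐ p ∂wightmanMeasure n ν f, p ∈ futureCone n := by
  rw [wightmanMeasure, ae_withDensity_iff (measurable_wightmanDensity n ν f).ennreal_ofReal]
  refine ae_of_all _ fun p hp => ?_
  contrapose! hp
  simp [wightmanDensity_eq_indicator, hp]

/-- The density of the Wightman measure in mass-shell coordinates. -/
noncomputable def shellDensity (n : ℕ) (ν f : ℝ) (y : EuclideanSpace ℝ (Fin n) × ℝ) : ℝ :=
  2 * Aconst n ν * spectralDensity ν (f * Aconst n ν) (y.2 ^ 2) * (y.2 / energy y.1 y.2)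

theorem measurable_shellDensity (n : ℕ) (ν f : ℝ) : Measurable (shellDensity n ν f) :=
  (((measurable_spectralDensity _ _).comp (measurable_snd.pow_const 2)).const_mul _).mul
    (measurable_snd.div continuous_energy.measurable)

/-- The Wightman measure in mass-shell coordinates. -/
noncomputable def shellMeasure (n : ℕ) (ν f : ℝ) : Measure (EuclideanSpace ℝ (Fin n) × ℝ) :=
  (volume.restrict (shellDomain n)).withDensity fun y => ENNReal.ofReal (shellDensity n ν f y)

theorem map_shell_shellMeasure (n : ℕ) (ν f : ℝ) :
    (shellMeasure n ν f).map shell = wightmanMeasure n ν f := by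
  refine Measure.ext_of_lintegral _ fun F hF => ?_
  have hdens : Measurable fun p : Mink n =>
      ENNReal.ofReal (2 * Aconst n ν * spectralDensity ν (f * Aconst n ν) (negSq p)) :=
    (((measurable_spectralDensity _ _).comp continuous_negSq.measurable).const_mul _).ennreal_ofReal
  have hcone : ∀ p, ENNReal.ofReal (wightmanDensity n ν f p) * F p
      = (futureCone n).indicator (fun p => ENNReal.ofReal
          (2 * Aconst n ν * spectralDensity ν (f * Aconst n ν) (negSq p)) * F p) p := by
    intro p
    by_cases hp : p ∈ futureCone n <;> simp [wightmanDensity_eq_indicator, hp]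
  rw [lintegral_map hF continuous_shell.measurable, shellMeasure, wightmanMeasure,
    lintegral_withDensity_eq_lintegral_mul _ (measurable_shellDensity n ν f).ennreal_ofReal
      (g := fun y => F (shell y)) (hF.comp continuous_shell.measurable),
    lintegral_withDensity_eq_lintegral_mul _ (measurable_wightmanDensity n ν f).ennreal_ofReal hF]
  simp only [Pi.mul_apply, hcone]
  rw [lintegral_indicator isOpen_futureCone.measurableSet,
    setLIntegral_futureCone (F := fun p => _ * F p) (hdens.mul hF)]
  refine setLIntegral_congr_fun measurableSet_shellDomain fun y hy => ?_
  have hjac : 0 ≤ y.2 / energy y.1 y.2 := div_nonneg (le_of_lt hy.2) (Real.sqrt_nonneg _)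
  simp only [shellDensity, shell, negSq_energy, ENNReal.ofReal_mul' hjac]
  ring

section Positivity

variable {ν : ℝ} (hn : 1 ≤ n) (hν : ν ∈ Ioo (0 : ℝ) 1) (f : ℝ)
include hn hν

theorem wightmanDensity_nonneg (p : Mink n) : 0 ≤ wightmanDensity n ν f p := by
  rw [wightmanDensity_eq_indicator]
  refine indicator_nonneg (fun p hp => ?_) p
  exact mul_nonneg (by linarith [Aconst_pos hn hν]) (spectralDensity_pos hν _ (negSq_pos hp)).le

theorem shellDensity_nonneg {y : EuclideanSpace ℝ (Fin n) × ℝ} (hy : 0 < y.2) :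
    0 ≤ shellDensity n ν f y :=
  mul_nonneg (mul_nonneg (by linarith [Aconst_pos hn hν])
    (spectralDensity_pos hν _ (by positivity)).le) (div_nonneg hy.le (Real.sqrt_nonneg _))

section VectorValued

variable {E : Type*} [NormedAddCommGroup E] [NormedSpace ℝ E]

theorem integrable_wightmanMeasure_iff {G : Mink n → E} :
    Integrable G (wightmanMeasure n ν f) ↔ Integrable fun p => wightmanDensity n ν f p • G p := by
  rw [wightmanMeasure, integrable_withDensity_iff_integrable_smul'
    (measurable_wightmanDensity n ν f).ennreal_ofReal (by simp)]
  simp only [ENNReal.toReal_ofReal (wightmanDensity_nonneg hn hν f _)]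

theorem integral_wightmanMeasure (G : Mink n → E) :
    ∫ p, G p ∂wightmanMeasure n ν f = ∫ p, wightmanDensity n ν f p • G p := by
  rw [wightmanMeasure, integral_withDensity_eq_integral_toReal_smul
    (measurable_wightmanDensity n ν f).ennreal_ofReal (by simp)]
  simp only [ENNReal.toReal_ofReal (wightmanDensity_nonneg hn hν f _)]

theorem integrable_shellMeasure_iff {G : EuclideanSpace ℝ (Fin n) × ℝ → E} :
    Integrable G (shellMeasure n ν f)
      ↔ IntegrableOn (fun y => shellDensity n ν f y • G y) (shellDomain n) := by
  rw [shellMeasure, integrable_withDensity_iff_integrable_smul'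
    (measurable_shellDensity n ν f).ennreal_ofReal (by simp)]
  refine integrableOn_congr_fun (fun y hy => ?_) measurableSet_shellDomain
  simp only [ENNReal.toReal_ofReal (shellDensity_nonneg hn hν f hy.2)]

theorem integral_shellMeasure (G : EuclideanSpace ℝ (Fin n) × ℝ → E) :
    ∫ y, G y ∂shellMeasure n ν f = ∫ y in shellDomain n, shellDensity n ν f y • G y := by
  rw [shellMeasure, integral_withDensity_eq_integral_toReal_smul
    (measurable_shellDensity n ν f).ennreal_ofReal (by simp)]
  refine setIntegral_congr_fun measurableSet_shellDomain fun y hy => ?_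
  simp only [ENNReal.toReal_ofReal (shellDensity_nonneg hn hν f hy.2)]

end VectorValued

theorem shellDensity_le {k : EuclideanSpace ℝ (Fin n)} (hk : k ≠ 0) {q : ℝ} (hq : 0 < q) :
    shellDensity n ν f (k, q)
      ≤ 2 * Aconst n ν / Real.sin (π * ν) * (‖k‖ ^ (-ν) * q ^ (-ν)) := by
  have hE := energy_pos k hq
  have hk₀ : 0 < ‖k‖ := norm_pos_iff.2 hk
  have hA := Aconst_pos hn hν
  have hsin := sin_pi_mul_pos hν
  have hpow : (q ^ 2) ^ (-ν) * q = q ^ (-ν) * q ^ (1 - ν) := by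
    rw [← Real.rpow_natCast, ← Real.rpow_mul hq.le, ← Real.rpow_add_one hq.ne',
      ← Real.rpow_add hq]
    push_cast
    ring_nf
  have hjac : q ^ (1 - ν) / energy k q ≤ ‖k‖ ^ (-ν) := by
    rw [div_le_iff₀ hE, Real.rpow_neg hk₀.le, inv_mul_eq_div, le_div_iff₀ (by positivity)]
    exact rpow_one_sub_mul_norm_rpow_le_energy hν k hq
  calc shellDensity n ν f (k, q)
      ≤ 2 * Aconst n ν * ((q ^ 2) ^ (-ν) / Real.sin (π * ν)) * (q / energy k q) := by
        unfold shellDensity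
        gcongr
        exact spectralDensity_le hν _ (by positivity)
    _ = 2 * Aconst n ν / Real.sin (π * ν) * ((q ^ 2) ^ (-ν) * q / energy k q) := by ring
    _ = 2 * Aconst n ν / Real.sin (π * ν) * (q ^ (1 - ν) / energy k q * q ^ (-ν)) := by
        rw [hpow]
        ring
    _ ≤ _ := by gcongr

theorem integrableOn_shellDomain_majorant :
    IntegrableOn (fun y : EuclideanSpace ℝ (Fin n) × ℝ =>
      (‖y.1‖ ^ (-ν) * (1 + ‖y.1‖) ^ (-((n : ℝ) + 1))) * (y.2 ^ (-ν) * (1 + y.2) ^ (-2 : ℝ)))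
      (shellDomain n) := by
  have : Nonempty (Fin n) := ⟨⟨0, hn⟩⟩
  have hn' : (1 : ℝ) ≤ n := by exact_mod_cast hn
  rw [IntegrableOn, Measure.volume_eq_prod, ← Measure.prod_restrict, Measure.restrict_univ]
  exact (integrable_norm_rpow_mul_one_add_norm_rpow volume
      (by rw [finrank_euclideanSpace_fin]; linarith [hν.2])
      (by rw [finrank_euclideanSpace_fin]; linarith [hν.1])).mul_prod
    (integrableOn_rpow_mul_one_add_rpow (by linarith [hν.2]) (by linarith [hν.1]))

theorem integrable_inv_one_add_fst_pow :
    Integrable (fun p : Mink n => ((1 + p.1) ^ (n + 3))⁻¹) (wightmanMeasure n ν f) := by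
  have : Nonempty (Fin n) := ⟨⟨0, hn⟩⟩
  have hmeas : Measurable fun p : Mink n => ((1 + p.1) ^ (n + 3))⁻¹ := by fun_prop
  have hk : ∀ᵐ y : EuclideanSpace ℝ (Fin n) × ℝ, y.1 ≠ 0 :=
    Measure.quasiMeasurePreserving_fst.ae (Measure.ae_ne volume 0)
  rw [← map_shell_shellMeasure, integrable_map_measure hmeas.aestronglyMeasurable
    continuous_shell.aemeasurable, integrable_shellMeasure_iff hn hν]
  refine Integrable.mono'
    ((integrableOn_shellDomain_majorant hn hν).const_mul (2 * Aconst n ν / Real.sin (π * ν)))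
    (((measurable_shellDensity n ν f).mul
      (hmeas.comp continuous_shell.measurable)).aestronglyMeasurable) ?_
  filter_upwards [ae_restrict_mem measurableSet_shellDomain, ae_restrict_of_ae hk]
    with ⟨k, q⟩ ⟨_, (hq : 0 < q)⟩ hk
  have hE := energy_pos k hq
  have hle := shellDensity_le hn hν f hk hq
  have hdecay : ((1 + energy k q) ^ (n + 3))⁻¹
      ≤ (1 + ‖k‖) ^ (-((n : ℝ) + 1)) * (1 + q) ^ (-2 : ℝ) := by
    rw [Real.rpow_neg (by positivity), Real.rpow_neg (by positivity), Real.rpow_two,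
      ← Nat.cast_add_one, Real.rpow_natCast, ← mul_inv, show n + 3 = (n + 1) + 2 by ring, pow_add]
    gcongr
    exacts [(norm_lt_energy k hq).le, le_energy k q]
  change ‖shellDensity n ν f (k, q) * ((1 + energy k q) ^ (n + 3))⁻¹‖ ≤ _
  rw [Real.norm_of_nonneg (mul_nonneg (shellDensity_nonneg hn hν f hq) (by positivity))]
  calc shellDensity n ν f (k, q) * ((1 + energy k q) ^ (n + 3))⁻¹
      ≤ 2 * Aconst n ν / Real.sin (π * ν) * (‖k‖ ^ (-ν) * q ^ (-ν))
        * ((1 + ‖k‖) ^ (-((n : ℝ) + 1)) * (1 + q) ^ (-2 : ℝ)) :=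
        mul_le_mul hle hdecay (by positivity) ((shellDensity_nonneg hn hν f hq).trans hle)
    _ = _ := by ring

theorem integrable_wightmanMeasure_of_le {E : Type*} [NormedAddCommGroup E] {G : Mink n → E}
    (hG : AEStronglyMeasurable G (wightmanMeasure n ν f)) {C : ℝ}
    (hb : ∀ p ∈ futureCone n, ‖G p‖ ≤ C * ((1 + p.1) ^ (n + 3))⁻¹) :
    Integrable G (wightmanMeasure n ν f) :=
  ((integrable_inv_one_add_fst_pow hn hν f).const_mul C).mono' hG <| by
    filter_upwards [ae_mem_futureCone n ν f] using hb

end Positivity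

end MassShell

/-! ### Källén-Lehmann representation -/

section Lorentzian

variable {E : ℝ}

theorem integrable_inv_sq_add_sq (hE : 0 < E) : Integrable fun s : ℝ => (s ^ 2 + E ^ 2)⁻¹ := by
  refine ((integrable_inv_one_add_sq.comp_div hE.ne').const_mul (E ^ 2)⁻¹).congr
    (.of_forall fun s => ?_)
  simp only [← mul_inv]
  congr 1
  field_simp
  ring

theorem integrable_exp_mul_inv_sq_add_sq (hE : 0 < E) (τ : ℝ) :
    Integrable fun s : ℝ =>
      Complex.exp (Complex.I * ((s * τ : ℝ) : ℂ)) * (((s ^ 2 + E ^ 2)⁻¹ : ℝ) : ℂ) := by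
  refine (integrable_inv_sq_add_sq hE).ofReal.bdd_mul (c := 1) (by fun_prop)
    (.of_forall fun s => ?_)
  rw [mul_comm, Complex.norm_exp_ofReal_mul_I]

theorem eqOn_Iic_exp_mul_exp_neg_abs (E η : ℝ) :
    EqOn (fun x : ℝ => Complex.exp (η * x * Complex.I) * (Real.exp (-(E * |x|)) : ℂ))
      (fun x => Complex.exp ((E + η * Complex.I) * x)) (Iic 0) := by
  intro x hx
  simp only [Complex.ofReal_exp, ← Complex.exp_add, abs_of_nonpos (mem_Iic.1 hx)]
  congr 1
  push_cast
  ring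

theorem eqOn_Ioi_exp_mul_exp_neg_abs (E η : ℝ) :
    EqOn (fun x : ℝ => Complex.exp (η * x * Complex.I) * (Real.exp (-(E * |x|)) : ℂ))
      (fun x => Complex.exp ((-E + η * Complex.I) * x)) (Ioi 0) := by
  intro x hx
  simp only [Complex.ofReal_exp, ← Complex.exp_add, abs_of_pos (mem_Ioi.1 hx)]
  congr 1
  push_cast
  ring

theorem integrableOn_Iic_exp_mul_exp_neg_abs (hE : 0 < E) (η : ℝ) :
    IntegrableOn (fun x : ℝ => Complex.exp (η * x * Complex.I) * (Real.exp (-(E * |x|)) : ℂ))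
      (Iic 0) :=
  (integrableOn_congr_fun (eqOn_Iic_exp_mul_exp_neg_abs E η) measurableSet_Iic).2
    (integrableOn_exp_mul_complex_Iic (by simpa using hE) 0)

theorem integrableOn_Ioi_exp_mul_exp_neg_abs (hE : 0 < E) (η : ℝ) :
    IntegrableOn (fun x : ℝ => Complex.exp (η * x * Complex.I) * (Real.exp (-(E * |x|)) : ℂ))
      (Ioi 0) :=
  (integrableOn_congr_fun (eqOn_Ioi_exp_mul_exp_neg_abs E η) measurableSet_Ioi).2
    (integrableOn_exp_mul_complex_Ioi (by simpa using hE) 0)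

theorem integrable_exp_neg_mul_abs (hE : 0 < E) :
    Integrable fun x : ℝ => (Real.exp (-(E * |x|)) : ℂ) := by
  rw [← integrableOn_univ, ← Iic_union_Ioi (a := (0 : ℝ))]
  simpa using (integrableOn_Iic_exp_mul_exp_neg_abs hE 0).union
    (integrableOn_Ioi_exp_mul_exp_neg_abs hE 0)

theorem integral_exp_mul_exp_neg_abs (hE : 0 < E) (η : ℝ) :
    ∫ x : ℝ, Complex.exp (η * x * Complex.I) * (Real.exp (-(E * |x|)) : ℂ)
      = 2 * E * (((η ^ 2 + E ^ 2)⁻¹ : ℝ) : ℂ) := by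
  have hpos : (E + η * Complex.I : ℂ) ≠ 0 := fun h => hE.ne' (by simpa using congrArg Complex.re h)
  have hneg : (-E + η * Complex.I : ℂ) ≠ 0 := fun h =>
    hE.ne' (by simpa using congrArg Complex.re h)
  have hprod : (E + η * Complex.I : ℂ) * (-E + η * Complex.I) = -((η : ℂ) ^ 2 + (E : ℂ) ^ 2) := by
    linear_combination (η : ℂ) ^ 2 * Complex.I_sq
  have hsum : (η : ℂ) ^ 2 + (E : ℂ) ^ 2 ≠ 0 := by
    exact_mod_cast (by positivity : η ^ 2 + E ^ 2 ≠ 0)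
  rw [← setIntegral_univ, ← Iic_union_Ioi (a := (0 : ℝ)),
    setIntegral_union (Iic_disjoint_Ioi le_rfl) measurableSet_Ioi
      (integrableOn_Iic_exp_mul_exp_neg_abs hE η) (integrableOn_Ioi_exp_mul_exp_neg_abs hE η),
    setIntegral_congr_fun measurableSet_Iic (eqOn_Iic_exp_mul_exp_neg_abs E η),
    setIntegral_congr_fun measurableSet_Ioi (eqOn_Ioi_exp_mul_exp_neg_abs E η),
    integral_exp_mul_complex_Iic (by simpa using hE),
    integral_exp_mul_complex_Ioi (by simpa using hE)]
  simp only [Complex.ofReal_zero, mul_zero, Complex.exp_zero]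
  rw [neg_div, ← sub_eq_add_neg, div_sub_div _ _ hpos hneg, hprod, div_neg]
  push_cast
  field_simp
  ring

open FourierTransform in
theorem fourier_exp_neg_mul_abs (hE : 0 < E) (ξ : ℝ) :
    𝓕 (fun x : ℝ => (Real.exp (-(E * |x|)) : ℂ)) ξ
      = 2 * E * ((((2 * π * ξ) ^ 2 + E ^ 2)⁻¹ : ℝ) : ℂ) := by
  rw [Real.fourier_real_eq_integral_exp_smul, ← neg_sq (2 * π * ξ),
    ← integral_exp_mul_exp_neg_abs hE (-(2 * π * ξ))]
  refine integral_congr_ae (.of_forall fun x => ?_)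
  simp only [smul_eq_mul]
  push_cast
  ring_nf

open FourierTransform in
theorem integral_exp_mul_inv_sq_add_sq (hE : 0 < E) (τ : ℝ) :
    ∫ s : ℝ, Complex.exp (Complex.I * ((s * τ : ℝ) : ℂ)) * (((s ^ 2 + E ^ 2)⁻¹ : ℝ) : ℂ)
      = ((π / E * Real.exp (-(E * |τ|)) : ℝ) : ℂ) := by
  have hfourier := funext (fourier_exp_neg_mul_abs hE)
  have hintegrable : Integrable (𝓕 fun x : ℝ => (Real.exp (-(E * |x|)) : ℂ)) := by
    rw [hfourier]
    exact (((integrable_inv_sq_add_sq hE).comp_mul_left'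
      (by positivity : 2 * π ≠ 0)).ofReal).const_mul _
  have hinversion := congrFun (Continuous.fourierInv_fourier_eq
    (by fun_prop : Continuous fun x : ℝ => (Real.exp (-(E * |x|)) : ℂ))
    (integrable_exp_neg_mul_abs hE) hintegrable) τ
  have hscale := Measure.integral_comp_mul_left (fun s : ℝ => 2 * E *
    (Complex.exp (Complex.I * ((s * τ : ℝ) : ℂ)) * (((s ^ 2 + E ^ 2)⁻¹ : ℝ) : ℂ))) (2 * π)
  have hintegrand : ∀ ξ : ℝ, Complex.exp ((-2 * π * ξ * -τ : ℝ) * Complex.I) •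
      (2 * E * ((((2 * π * ξ) ^ 2 + E ^ 2)⁻¹ : ℝ) : ℂ)) = 2 * E * (Complex.exp
        (Complex.I * ((2 * π * ξ * τ : ℝ) : ℂ)) * ((((2 * π * ξ) ^ 2 + E ^ 2)⁻¹ : ℝ) : ℂ)) := by
    intro ξ
    rw [smul_eq_mul]
    push_cast
    ring_nf
  rw [fourierInv_eq_fourier_neg, Real.fourier_real_eq_integral_exp_smul, hfourier] at hinversion
  simp only [hintegrand] at hinversion
  rw [hscale, integral_const_mul, abs_of_pos (by positivity), Complex.real_smul] at hinversion
  rw [Complex.ofReal_mul, ← hinversion, ← mul_assoc, ← mul_assoc]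
  have hE0 : (E : ℂ) ≠ 0 := by exact_mod_cast hE.ne'
  have hconst : ((π / E : ℝ) : ℂ) * ((2 * π)⁻¹ : ℝ) * (2 * E) = 1 := by
    push_cast
    field_simp
  rw [hconst, one_mul]

theorem integral_inv_sq_add_sq (hE : 0 < E) : ∫ s : ℝ, (s ^ 2 + E ^ 2)⁻¹ = π / E :=
  Complex.ofReal_injective (integral_complex_ofReal.symm.trans
    (by simpa using integral_exp_mul_inv_sq_add_sq hE 0))

end Lorentzian

section ResolventCutoff

/-- The Fourier integral at `τ` of the Lorentzian `(s² + E²)⁻¹`, truncated to `|s| ≤ R`. -/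
noncomputable def resolventCutoff (E τ R : ℝ) : ℂ :=
  ∫ s in (-R)..R, Complex.exp (Complex.I * ((s * τ : ℝ) : ℂ)) * (((s ^ 2 + E ^ 2)⁻¹ : ℝ) : ℂ)

variable {E τ R : ℝ}

theorem tendsto_resolventCutoff (hE : 0 < E) (τ : ℝ) :
    Tendsto (resolventCutoff E τ) atTop (𝓝 ((π / E * Real.exp (-(E * |τ|)) : ℝ) : ℂ)) := by
  rw [← integral_exp_mul_inv_sq_add_sq hE τ]
  exact intervalIntegral_tendsto_integral (integrable_exp_mul_inv_sq_add_sq hE τ)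
    tendsto_neg_atTop_atBot tendsto_id

theorem hasDerivAt_ofReal_inv_sq_add_sq (hE : 0 < E) (s : ℝ) :
    HasDerivAt (fun s : ℝ => (((s ^ 2 + E ^ 2)⁻¹ : ℝ) : ℂ))
      ((-(2 * s) / (s ^ 2 + E ^ 2) ^ 2 : ℝ) : ℂ) s := by
  refine HasDerivAt.ofReal_comp ?_
  simpa using ((hasDerivAt_pow 2 s).add_const (E ^ 2)).fun_inv (by positivity)

theorem hasDerivAt_exp_div (hτ : τ ≠ 0) (s : ℝ) :
    HasDerivAt (fun s : ℝ => Complex.exp (Complex.I * ((s * τ : ℝ) : ℂ)) / (Complex.I * τ))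
      (Complex.exp (Complex.I * ((s * τ : ℝ) : ℂ))) s := by
  have hphase : HasDerivAt (fun s : ℝ => Complex.I * ((s * τ : ℝ) : ℂ)) (Complex.I * τ) s := by
    simpa using (((hasDerivAt_id s).mul_const τ).ofReal_comp).const_mul Complex.I
  simpa [hτ] using hphase.cexp.div_const (Complex.I * τ)

theorem norm_exp_div (τ s : ℝ) :
    ‖Complex.exp (Complex.I * ((s * τ : ℝ) : ℂ)) / (Complex.I * τ)‖ = |τ|⁻¹ := by
  rw [norm_div, mul_comm, Complex.norm_exp_ofReal_mul_I, norm_mul, Complex.norm_I, one_mul,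
    Complex.norm_real, Real.norm_eq_abs, one_div]

theorem inv_sq_add_sq_le (hE : 0 < E) (s : ℝ) : (s ^ 2 + E ^ 2)⁻¹ ≤ (E ^ 2)⁻¹ :=
  inv_anti₀ (by positivity) (by nlinarith)

theorem abs_deriv_inv_sq_add_sq_le (hE : 0 < E) (s : ℝ) :
    |-(2 * s) / (s ^ 2 + E ^ 2) ^ 2| ≤ E⁻¹ * (s ^ 2 + E ^ 2)⁻¹ := by
  have hpos : 0 < s ^ 2 + E ^ 2 := by positivity
  have ham_gm : 2 * |s| * E ≤ s ^ 2 + E ^ 2 := by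
    rw [← sq_abs s]
    exact two_mul_le_add_sq _ _
  rw [abs_div, abs_neg, abs_mul, abs_two, abs_of_pos (pow_pos hpos 2), ← mul_inv, inv_eq_one_div,
    div_le_div_iff₀ (by positivity) (by positivity)]
  nlinarith

theorem resolventCutoff_eq_by_parts (hE : 0 < E) (hτ : τ ≠ 0) (R : ℝ) :
    resolventCutoff E τ R
      = (((R ^ 2 + E ^ 2)⁻¹ : ℝ) : ℂ)
          * (Complex.exp (Complex.I * ((R * τ : ℝ) : ℂ)) / (Complex.I * τ))
        - ((((-R) ^ 2 + E ^ 2)⁻¹ : ℝ) : ℂ)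
          * (Complex.exp (Complex.I * ((-R * τ : ℝ) : ℂ)) / (Complex.I * τ))
        - ∫ s in (-R)..R, ((-(2 * s) / (s ^ 2 + E ^ 2) ^ 2 : ℝ) : ℂ)
          * (Complex.exp (Complex.I * ((s * τ : ℝ) : ℂ)) / (Complex.I * τ)) := by
  have hcont : Continuous fun s : ℝ => ((-(2 * s) / (s ^ 2 + E ^ 2) ^ 2 : ℝ) : ℂ) :=
    Complex.continuous_ofReal.comp
      (Continuous.div (by fun_prop) (by fun_prop) fun s => by positivity)
  rw [← intervalIntegral.integral_mul_deriv_eq_deriv_mul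
    (fun s _ => hasDerivAt_ofReal_inv_sq_add_sq hE s) (fun s _ => hasDerivAt_exp_div hτ s)
    (hcont.intervalIntegrable _ _) (Continuous.intervalIntegrable (by fun_prop) _ _)]
  exact intervalIntegral.integral_congr fun s _ => mul_comm _ _

theorem norm_resolventCutoff_le (hE : 0 < E) (hτ : τ ≠ 0) (hR : 0 ≤ R) :
    ‖resolventCutoff E τ R‖ ≤ (2 + π) / |τ| * (E ^ 2)⁻¹ := by
  have hboundary : ∀ s : ℝ, ‖(((s ^ 2 + E ^ 2)⁻¹ : ℝ) : ℂ)
      * (Complex.exp (Complex.I * ((s * τ : ℝ) : ℂ)) / (Complex.I * τ))‖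
      ≤ (E ^ 2)⁻¹ * |τ|⁻¹ := by
    intro s
    rw [norm_mul, norm_exp_div, Complex.norm_real, Real.norm_of_nonneg (by positivity)]
    exact mul_le_mul_of_nonneg_right (inv_sq_add_sq_le hE s) (by positivity)
  have hintegrand : ∀ s : ℝ, ‖((-(2 * s) / (s ^ 2 + E ^ 2) ^ 2 : ℝ) : ℂ)
      * (Complex.exp (Complex.I * ((s * τ : ℝ) : ℂ)) / (Complex.I * τ))‖
      ≤ E⁻¹ * |τ|⁻¹ * (s ^ 2 + E ^ 2)⁻¹ := by
    intro s
    rw [norm_mul, norm_exp_div, Complex.norm_real, Real.norm_eq_abs, mul_right_comm]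
    gcongr
    exact abs_deriv_inv_sq_add_sq_le hE s
  have hbulk : ‖∫ s in (-R)..R, ((-(2 * s) / (s ^ 2 + E ^ 2) ^ 2 : ℝ) : ℂ)
      * (Complex.exp (Complex.I * ((s * τ : ℝ) : ℂ)) / (Complex.I * τ))‖
      ≤ E⁻¹ * |τ|⁻¹ * (π / E) := by
    have hmajorant := (integrable_inv_sq_add_sq hE).const_mul (E⁻¹ * |τ|⁻¹)
    rw [← integral_inv_sq_add_sq hE, ← integral_const_mul]
    refine (intervalIntegral.norm_integral_le_of_norm_le (by linarith)
      (.of_forall fun s _ => hintegrand s) hmajorant.intervalIntegrable).trans ?_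
    rw [intervalIntegral.integral_of_le (by linarith)]
    exact setIntegral_le_integral hmajorant (.of_forall fun s => by positivity)
  rw [resolventCutoff_eq_by_parts hE hτ]
  calc _ ≤ (E ^ 2)⁻¹ * |τ|⁻¹ + (E ^ 2)⁻¹ * |τ|⁻¹ + E⁻¹ * |τ|⁻¹ * (π / E) :=
        (norm_sub_le _ _).trans (add_le_add ((norm_sub_le _ _).trans
          (add_le_add (hboundary _) (hboundary _))) hbulk)
    _ = (2 + π) / |τ| * (E ^ 2)⁻¹ := by
        field_simp
        ring

end ResolventCutoff

section Superposition

variable {α : Type*} [MeasurableSpace α] {μ : Measure α} [SFinite μ] {g E : α → ℝ} {τ : ℝ}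

theorem measurable_resolventCutoff_comp (hE : Measurable E) (τ R : ℝ) :
    Measurable fun a => resolventCutoff (E a) τ R := by
  have hjoint : StronglyMeasurable fun y : α × ℝ =>
      Complex.exp (Complex.I * ((y.2 * τ : ℝ) : ℂ)) * (((y.2 ^ 2 + E y.1 ^ 2)⁻¹ : ℝ) : ℂ) :=
    Measurable.stronglyMeasurable (by fun_prop)
  simp only [resolventCutoff, intervalIntegral]
  exact (hjoint.integral_prod_right'.sub hjoint.integral_prod_right').measurable

theorem intervalIntegral_exp_mul_integral_inv (hE : Measurable E) (hpos : ∀ a, 0 < E a)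
    (hg : Integrable (fun a => g a * (E a ^ 2)⁻¹) μ) (τ : ℝ) {R : ℝ} (hR : 0 ≤ R) :
    ∫ s in (-R)..R, Complex.exp (Complex.I * ((s * τ : ℝ) : ℂ))
        * ((∫ a, g a * (s ^ 2 + E a ^ 2)⁻¹ ∂μ : ℝ) : ℂ)
      = ∫ a, (g a : ℂ) * resolventCutoff (E a) τ R ∂μ := by
  have hle : -R ≤ R := by linarith
  have hint : Integrable (Function.uncurry fun (s : ℝ) a =>
      Complex.exp (Complex.I * ((s * τ : ℝ) : ℂ)) * ((g a * (s ^ 2 + E a ^ 2)⁻¹ : ℝ) : ℂ))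
      ((volume.restrict (Ioc (-R) R)).prod μ) := by
    have hweight : Measurable fun y : ℝ × α => Complex.exp (Complex.I * ((y.1 * τ : ℝ) : ℂ))
        * ((E y.2 ^ 2 * (y.1 ^ 2 + E y.2 ^ 2)⁻¹ : ℝ) : ℂ) := by fun_prop
    refine (((hg.ofReal (𝕜 := ℂ)).comp_snd _).bdd_mul (c := 1) hweight.aestronglyMeasurable
      (.of_forall fun y => ?_)).congr (.of_forall fun y => ?_)
    · have := hpos y.2
      rw [norm_mul, mul_comm Complex.I, Complex.norm_exp_ofReal_mul_I, one_mul, Complex.norm_real,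
        Real.norm_of_nonneg (by positivity), ← div_eq_mul_inv]
      exact div_le_one_of_le₀ (by nlinarith) (by positivity)
    · have hcancel : E y.2 ^ 2 * (y.1 ^ 2 + E y.2 ^ 2)⁻¹ * (g y.2 * (E y.2 ^ 2)⁻¹)
          = g y.2 * (y.1 ^ 2 + E y.2 ^ 2)⁻¹ := by
        have := hpos y.2
        field_simp
      rw [Function.uncurry, ← hcancel, Complex.ofReal_mul (_ * _)]
      exact mul_assoc _ _ _
  simp only [resolventCutoff, intervalIntegral.integral_of_le hle, ← integral_const_mul,
    ← integral_complex_ofReal]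
  rw [integral_integral_swap hint]
  refine integral_congr_ae (.of_forall fun a => integral_congr_ae (.of_forall fun s => ?_))
  simp only [Complex.ofReal_mul]
  ring

theorem tendsto_intervalIntegral_exp_mul_integral_inv (hE : Measurable E) (hpos : ∀ a, 0 < E a)
    (hg : Integrable (fun a => g a * (E a ^ 2)⁻¹) μ) (hτ : τ ≠ 0) :
    Tendsto (fun R => ∫ s in (-R)..R, Complex.exp (Complex.I * ((s * τ : ℝ) : ℂ))
        * ((∫ a, g a * (s ^ 2 + E a ^ 2)⁻¹ ∂μ : ℝ) : ℂ)) atTop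
      (𝓝 (∫ a, (g a : ℂ) * ((π / E a * Real.exp (-(E a * |τ|)) : ℝ) : ℂ) ∂μ)) := by
  have hg_meas : AEStronglyMeasurable g μ := by
    refine (hg.aestronglyMeasurable.mul (hE.pow_const 2).aestronglyMeasurable).congr
      (.of_forall fun a => ?_)
    have := (hpos a).ne'
    simp [this]
  refine Tendsto.congr' (f₁ := fun R => ∫ a, (g a : ℂ) * resolventCutoff (E a) τ R ∂μ) ?_
    (tendsto_integral_filter_of_dominated_convergence
      (fun a => (2 + π) / |τ| * ‖g a * (E a ^ 2)⁻¹‖) ?_ ?_ (hg.norm.const_mul _)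
      (.of_forall fun a => (tendsto_resolventCutoff (hpos a) τ).const_mul _))
  · filter_upwards [eventually_ge_atTop 0] with R hR
    exact (intervalIntegral_exp_mul_integral_inv hE hpos hg τ hR).symm
  · exact .of_forall fun R => (Complex.continuous_ofReal.comp_aestronglyMeasurable hg_meas).mul
      (measurable_resolventCutoff_comp hE τ R).aestronglyMeasurable
  · filter_upwards [eventually_ge_atTop 0] with R hR
    refine .of_forall fun a => ?_
    rw [norm_mul, norm_mul, Complex.norm_real, Real.norm_of_nonneg (inv_nonneg.2 (sq_nonneg (E a))),
      mul_left_comm]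
    gcongr
    exact norm_resolventCutoff_le (hpos a) hτ hR

end Superposition

section KallenLehmann

variable {ν a u : ℝ}

theorem integrableOn_spectralDensity_sq_mul_inv (hν : ν ∈ Ioo (0 : ℝ) 1) (a : ℝ) (hu : 0 < u) :
    IntegrableOn (fun q => spectralDensity ν a (q ^ 2) * q * (u + q ^ 2)⁻¹) (Ioi 0) := by
  refine ((integrableOn_Ioi_comp_rpow_iff' _ two_ne_zero).2
    (integrableOn_spectralDensity_div_add hν a hu)).congr (.of_forall fun q => ?_)
  norm_num [div_eq_mul_inv, add_comm u]
  ring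

theorem integral_spectralDensity_sq_mul_inv (hν : ν ∈ Ioo (0 : ℝ) 1) (ha : 0 ≤ a) (hu : 0 < u) :
    ∫ q in Ioi 0, spectralDensity ν a (q ^ 2) * q * (u + q ^ 2)⁻¹ = π / 2 * (u ^ ν + a)⁻¹ := by
  have hsubst := integral_comp_rpow_Ioi_of_pos (g := fun s => spectralDensity ν a s / (s + u))
    two_pos
  rw [integral_spectralDensity_div_add hν ha hu] at hsubst
  rw [div_mul_eq_mul_div, ← hsubst, eq_div_iff two_ne_zero, ← integral_mul_const]
  congr 1
  ext q
  norm_num [div_eq_mul_inv, add_comm u]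
  ring

variable {n : ℕ} {f τ : ℝ} {k : EuclideanSpace ℝ (Fin n)}

theorem schwingerCutoff_eq (hn : 1 ≤ n) (hν : ν ∈ Ioo (0 : ℝ) 1) (hf : 0 ≤ f) (hk : k ≠ 0)
    (τ R : ℝ) :
    schwingerCutoff n ν f τ k R = (Aconst n ν / π ^ 2 : ℝ) *
      ∫ s in (-R)..R, Complex.exp (Complex.I * ((s * τ : ℝ) : ℂ)) * ((∫ q in Ioi (0 : ℝ),
        spectralDensity ν (f * Aconst n ν) (q ^ 2) * q * (s ^ 2 + energy k q ^ 2)⁻¹ : ℝ) : ℂ) := by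
  rw [schwingerCutoff, ← intervalIntegral.integral_const_mul]
  refine intervalIntegral.integral_congr fun s _ => ?_
  have hmass : 0 < ‖k‖ ^ 2 + s ^ 2 := by
    have := norm_pos_iff.2 hk
    positivity
  have hdispersion := integral_spectralDensity_sq_mul_inv hν
    (mul_nonneg hf (Aconst_pos hn hν).le) hmass
  simp only [energy_sq, add_left_comm (s ^ 2), ← add_assoc, hdispersion]
  rw [mul_left_comm, ← Complex.ofReal_mul]
  congr 2
  field_simp

theorem tendsto_schwingerCutoff (hn : 1 ≤ n) (hν : ν ∈ Ioo (0 : ℝ) 1) (hf : 0 ≤ f) (hτ : τ ≠ 0)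
    (hk : k ≠ 0) :
    Tendsto (schwingerCutoff n ν f τ k) atTop (𝓝 ((2 * π : ℂ)⁻¹ * ∫ q in Ioi (0 : ℝ),
      ((shellDensity n ν f (k, q) * Real.exp (-(energy k q * |τ|)) : ℝ) : ℂ))) := by
  have : 0 < ‖k‖ := norm_pos_iff.2 hk
  have hpos : ∀ q, 0 < energy k q := fun q => Real.sqrt_pos.2 (by positivity)
  have hmeas : Measurable (energy k) :=
    (continuous_energy.comp (continuous_const.prodMk continuous_id)).measurable
  have hint := integrableOn_spectralDensity_sq_mul_inv hν (f * Aconst n ν)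
    (by positivity : 0 < ‖k‖ ^ 2)
  simp only [← energy_sq] at hint
  refine ((tendsto_intervalIntegral_exp_mul_integral_inv hmeas hpos hint hτ).const_mul
    ((Aconst n ν / π ^ 2 : ℝ) : ℂ)).congr (fun R => (schwingerCutoff_eq hn hν hf hk τ R).symm)
    |>.trans (le_of_eq ?_)
  rw [← integral_const_mul, ← integral_const_mul]
  congr 2
  ext q
  have hE0 : (energy k q : ℂ) ≠ 0 := by exact_mod_cast (hpos q).ne'
  simp only [shellDensity]
  push_cast
  field_simp

theorem schwingerMode_eq (hn : 1 ≤ n) (hν : ν ∈ Ioo (0 : ℝ) 1) (hf : 0 ≤ f) (hτ : τ ≠ 0)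
    (hk : k ≠ 0) :
    schwingerMode n ν f τ k = (2 * π : ℂ)⁻¹ * ∫ q in Ioi (0 : ℝ),
      ((shellDensity n ν f (k, q) * Real.exp (-(energy k q * |τ|)) : ℝ) : ℂ) :=
  (tendsto_schwingerCutoff hn hν hf hτ hk).limUnder_eq

end KallenLehmann

/-! ### Analytic continuation to complex time -/

theorem exp_neg_mul_le_inv_pow {ε : ℝ} (hε : 0 < ε) (N : ℕ) {x : ℝ} (hx : 0 ≤ x) :
    Real.exp (-(ε * x)) ≤ (N.factorial * Real.exp ε / ε ^ N) * ((1 + x) ^ N)⁻¹ := by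
  have htaylor := Real.pow_div_factorial_le_exp (ε * (1 + x)) (by positivity) N
  have : (0 : ℝ) < N.factorial := by exact_mod_cast N.factorial_pos
  rw [mul_one_add, Real.exp_add, ← mul_one_add, mul_pow, div_le_iff₀ this] at htaylor
  rw [Real.exp_neg, ← div_eq_mul_inv, div_div, le_div_iff₀ (by positivity),
    inv_mul_le_iff₀ (Real.exp_pos _)]
  linarith

section WightmanPhase

variable {n : ℕ}

section MassShellFubini

variable {ν : ℝ} (hn : 1 ≤ n) (hν : ν ∈ Ioo (0 : ℝ) 1) (f : ℝ)
include hn hν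

theorem integrable_wightmanMeasure_of_le_exp {E : Type*} [NormedAddCommGroup E] {G : Mink n → E}
    (hG : AEStronglyMeasurable G (wightmanMeasure n ν f)) {ε : ℝ} (hε : 0 < ε) (N : ℕ) {C : ℝ}
    (hC : 0 ≤ C)
    (hb : ∀ p ∈ futureCone n, ‖G p‖ ≤ C * (1 + p.1) ^ N * Real.exp (-(ε * p.1))) :
    Integrable G (wightmanMeasure n ν f) := by
  refine integrable_wightmanMeasure_of_le hn hν f hG
    (C := C * ((N + (n + 3)).factorial * Real.exp ε / ε ^ (N + (n + 3)))) fun p hp => ?_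
  have hp₀ : 0 ≤ p.1 := (norm_nonneg _).trans (le_of_lt hp)
  calc ‖G p‖
      ≤ C * (1 + p.1) ^ N * (((N + (n + 3)).factorial * Real.exp ε / ε ^ (N + (n + 3)))
        * ((1 + p.1) ^ (N + (n + 3)))⁻¹) := by
        refine (hb p hp).trans ?_
        gcongr
        exact exp_neg_mul_le_inv_pow hε _ hp₀
    _ = _ := by
        rw [pow_add (1 + p.1) N]
        field_simp

variable {E : Type*} [NormedAddCommGroup E] [NormedSpace ℝ E] {f} {G : Mink n → E}

theorem integrable_prod_shellDensity_smul (hG : Integrable G (wightmanMeasure n ν f)) :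
    Integrable (fun y => shellDensity n ν f y • G (shell y))
      (volume.prod (volume.restrict (Ioi (0 : ℝ)))) := by
  rw [← map_shell_shellMeasure] at hG
  have hshell := (integrable_shellMeasure_iff hn hν f).1
    (hG.comp_aemeasurable continuous_shell.aemeasurable)
  rwa [IntegrableOn, shellDomain, Measure.volume_eq_prod, ← Measure.prod_restrict,
    Measure.restrict_univ] at hshell

theorem integral_wightmanMeasure_eq_integral_shell (hG : Integrable G (wightmanMeasure n ν f)) :
    ∫ p, G p ∂wightmanMeasure n ν f = ∫ k : EuclideanSpace ℝ (Fin n), ∫ q in Ioi (0 : ℝ),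
      shellDensity n ν f (k, q) • G (energy k q, k) := by
  have hprod := integrable_prod_shellDensity_smul hn hν hG
  rw [← map_shell_shellMeasure] at hG ⊢
  rw [integral_map continuous_shell.aemeasurable hG.aestronglyMeasurable,
    integral_shellMeasure hn hν, shellDomain, Measure.volume_eq_prod, ← Measure.prod_restrict,
    Measure.restrict_univ, integral_prod _ hprod]
  rfl

end MassShellFubini

section ComplexTime

/-- The plane wave `e^{i k·x - i ω z} / (2π)^d` at complex time `z`, whose integral against the
Wightman measure is the Wightman function. -/
noncomputable def wightmanPhase (z : ℂ) (x : EuclideanSpace ℝ (Fin n)) (p : Mink n) : ℂ :=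
  Complex.exp (Complex.I * ((⟪p.2, x⟫ : ℝ) : ℂ) - Complex.I * (p.1 : ℂ) * z) / (2 * π) ^ (n + 1)

theorem wightmanIntegrand_eq_smul (n : ℕ) (ν f : ℝ) (z : ℂ) (x : EuclideanSpace ℝ (Fin n)) :
    wightmanIntegrand n ν f z x = fun p => wightmanDensity n ν f p • wightmanPhase z x p := by
  ext p
  rw [wightmanIntegrand, wightmanPhase, Complex.real_smul]
  ring

theorem continuous_wightmanPhase (z : ℂ) (x : EuclideanSpace ℝ (Fin n)) :
    Continuous (wightmanPhase z x) := by
  unfold wightmanPhase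
  fun_prop

theorem one_le_two_pi_pow (m : ℕ) : 1 ≤ (2 * π) ^ m :=
  one_le_pow₀ (by nlinarith [pi_gt_three])

theorem norm_two_pi_pow (m : ℕ) : ‖(2 * π : ℂ) ^ m‖ = (2 * π) ^ m := by
  rw [norm_pow, norm_mul, Complex.norm_real, Complex.norm_two, Real.norm_of_nonneg pi_pos.le]

theorem norm_wightmanPhase_le (z : ℂ) (x : EuclideanSpace ℝ (Fin n)) (p : Mink n) :
    ‖wightmanPhase z x p‖ ≤ Real.exp (p.1 * z.im) := by
  rw [wightmanPhase, norm_div, norm_two_pi_pow, Complex.norm_exp]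
  refine (div_le_self (Real.exp_pos _).le (one_le_two_pi_pow _)).trans (le_of_eq ?_)
  simp

theorem hasDerivAt_wightmanPhase (z : ℂ) (x : EuclideanSpace ℝ (Fin n)) (p : Mink n) :
    HasDerivAt (fun z => wightmanPhase z x p) (-(Complex.I * p.1) * wightmanPhase z x p) z := by
  have hexponent : HasDerivAt
      (fun z : ℂ => Complex.I * ((⟪p.2, x⟫ : ℝ) : ℂ) - Complex.I * (p.1 : ℂ) * z)
      (-(Complex.I * p.1)) z := by
    simpa using ((hasDerivAt_id z).const_mul (Complex.I * (p.1 : ℂ))).const_sub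
      (Complex.I * ((⟪p.2, x⟫ : ℝ) : ℂ))
  refine (hexponent.cexp.div_const ((2 * π : ℂ) ^ (n + 1))).congr_deriv ?_
  rw [wightmanPhase]
  ring

theorem wightmanPhase_neg_I_mul_energy (T : ℝ) (x k : EuclideanSpace ℝ (Fin n)) (q : ℝ) :
    wightmanPhase (-(Complex.I * (T : ℂ))) x (energy k q, k)
      = Complex.exp (Complex.I * ((⟪k, x⟫ : ℝ) : ℂ)) * (Real.exp (-(energy k q * T)) : ℂ)
        / (2 * π) ^ (n + 1) := by
  rw [wightmanPhase, Complex.ofReal_exp, ← Complex.exp_add]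
  congr 2
  push_cast
  linear_combination (energy k q : ℂ) * (T : ℂ) * Complex.I_sq

variable {ν : ℝ} (hn : 1 ≤ n) (hν : ν ∈ Ioo (0 : ℝ) 1)
include hn hν

theorem wightman_eq_integral (f : ℝ) (z : ℂ) (x : EuclideanSpace ℝ (Fin n)) :
    wightman n ν f z x = ∫ p, wightmanPhase z x p ∂wightmanMeasure n ν f := by
  rw [wightman, wightmanIntegrand_eq_smul, integral_wightmanMeasure hn hν]

theorem integrable_wightmanPhase (f : ℝ) {z : ℂ} (hz : z.im < 0)
    (x : EuclideanSpace ℝ (Fin n)) : Integrable (wightmanPhase z x) (wightmanMeasure n ν f) := by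
  refine integrable_wightmanMeasure_of_le_exp hn hν f
    (continuous_wightmanPhase z x).aestronglyMeasurable (neg_pos.2 hz) 0 zero_le_one fun p _ => ?_
  simpa [mul_comm] using norm_wightmanPhase_le z x p

theorem integrable_wightmanIntegrand (f : ℝ) {z : ℂ} (hz : z.im < 0)
    (x : EuclideanSpace ℝ (Fin n)) : Integrable (wightmanIntegrand n ν f z x) := by
  rw [wightmanIntegrand_eq_smul]
  exact (integrable_wightmanMeasure_iff hn hν f).1 (integrable_wightmanPhase hn hν f hz x)

theorem integrable_fst_mul_exp (f : ℝ) {δ : ℝ} (hδ : 0 < δ) :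
    Integrable (fun p : Mink n => p.1 * Real.exp (-(δ * p.1))) (wightmanMeasure n ν f) := by
  refine integrable_wightmanMeasure_of_le_exp hn hν f
    (Continuous.aestronglyMeasurable (by fun_prop)) hδ 1 zero_le_one fun p hp => ?_
  have : 0 ≤ p.1 := (norm_nonneg _).trans (le_of_lt hp)
  rw [Real.norm_of_nonneg (by positivity), one_mul, pow_one]
  gcongr
  linarith

theorem differentiableOn_wightman (f : ℝ) (x : EuclideanSpace ℝ (Fin n)) :
    DifferentiableOn ℂ (fun z => wightman n ν f z x) {z : ℂ | z.im < 0} := by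
  intro z₀ (hz₀ : z₀.im < 0)
  have hδ : 0 < -z₀.im / 2 := by linarith
  have hnhds : {z : ℂ | z.im < z₀.im / 2} ∈ 𝓝 z₀ :=
    (isOpen_lt Complex.continuous_im continuous_const).mem_nhds (show z₀.im < z₀.im / 2 by linarith)
  have hmeas : ∀ z, AEStronglyMeasurable (wightmanPhase z x) (wightmanMeasure n ν f) :=
    fun z => (continuous_wightmanPhase z x).aestronglyMeasurable
  have hbound : ∀ᵐ p ∂wightmanMeasure n ν f, ∀ z ∈ {z : ℂ | z.im < z₀.im / 2},
      ‖-(Complex.I * p.1) * wightmanPhase z x p‖ ≤ p.1 * Real.exp (-(-z₀.im / 2 * p.1)) := by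
    filter_upwards [ae_mem_futureCone n ν f] with p hp z (hz : z.im < z₀.im / 2)
    have hp₀ : 0 ≤ p.1 := (norm_nonneg _).trans (le_of_lt hp)
    rw [norm_mul, norm_neg, norm_mul, Complex.norm_I, one_mul, Complex.norm_real,
      Real.norm_of_nonneg hp₀]
    refine mul_le_mul_of_nonneg_left ((norm_wightmanPhase_le z x p).trans ?_) hp₀
    rw [Real.exp_le_exp]
    nlinarith
  have hderiv : HasDerivAt (fun z => ∫ p, wightmanPhase z x p ∂wightmanMeasure n ν f)
      (∫ p, -(Complex.I * p.1) * wightmanPhase z₀ x p ∂wightmanMeasure n ν f) z₀ :=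
    (hasDerivAt_integral_of_dominated_loc_of_deriv_le (F := fun z p => wightmanPhase z x p)
      (F' := fun z p => -(Complex.I * p.1) * wightmanPhase z x p) hnhds (.of_forall hmeas)
      (integrable_wightmanPhase hn hν f hz₀ x)
      ((Continuous.aestronglyMeasurable (by fun_prop)).mul (hmeas z₀)) hbound
      (integrable_fst_mul_exp hn hν f hδ)
      (.of_forall fun p z _ => hasDerivAt_wightmanPhase z x p)).2
  simp only [wightman_eq_integral hn hν]
  exact hderiv.differentiableAt.differentiableWithinAt

end ComplexTime

section AnalyticContinuation

variable {ν f τ : ℝ} (hn : 1 ≤ n) (hν : ν ∈ Ioo (0 : ℝ) 1) (hf : 0 ≤ f) (hτ : τ ≠ 0)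
include hn hν hf hτ

theorem integral_shellDensity_smul_wightmanPhase (x : EuclideanSpace ℝ (Fin n))
    {k : EuclideanSpace ℝ (Fin n)} (hk : k ≠ 0) :
    ∫ q in Ioi (0 : ℝ), shellDensity n ν f (k, q) •
        wightmanPhase (-(Complex.I * ((|τ| : ℝ) : ℂ))) x (energy k q, k)
      = Complex.exp (Complex.I * ((⟪k, x⟫ : ℝ) : ℂ)) * schwingerMode n ν f τ k / (2 * π) ^ n := by
  rw [schwingerMode_eq hn hν hf hτ hk, ← integral_const_mul, ← integral_const_mul, ← integral_div]
  congr 1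
  ext q
  rw [wightmanPhase_neg_I_mul_energy, Complex.real_smul, pow_succ]
  push_cast
  field_simp

theorem integrable_schwinger_integrand (x : EuclideanSpace ℝ (Fin n)) :
    Integrable fun k : EuclideanSpace ℝ (Fin n) =>
      Complex.exp (Complex.I * ((⟪k, x⟫ : ℝ) : ℂ)) * schwingerMode n ν f τ k / (2 * π) ^ n := by
  have : Nonempty (Fin n) := ⟨⟨0, hn⟩⟩
  have him : (-(Complex.I * ((|τ| : ℝ) : ℂ))).im < 0 := by simpa using hτ
  refine (integrable_prod_shellDensity_smul hn hν
    (integrable_wightmanPhase hn hν f him x)).integral_prod_left.congr ?_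
  filter_upwards [Measure.ae_ne volume 0] with k hk
  exact integral_shellDensity_smul_wightmanPhase hn hν hf hτ x hk

theorem integrable_schwingerMode : Integrable (schwingerMode n ν f τ) := by
  refine ((integrable_schwinger_integrand hn hν hf hτ 0).mul_const ((2 * π : ℂ) ^ n)).congr
    (.of_forall fun k => ?_)
  simp

theorem schwinger_eq_wightman (x : EuclideanSpace ℝ (Fin n)) :
    schwinger n ν f τ x = wightman n ν f (-(Complex.I * ((|τ| : ℝ) : ℂ))) x := by
  have : Nonempty (Fin n) := ⟨⟨0, hn⟩⟩
  rw [schwinger, wightman_eq_integral hn hν, integral_wightmanMeasure_eq_integral_shell hn hν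
    (integrable_wightmanPhase hn hν f (by simpa using hτ) x)]
  refine integral_congr_ae ?_
  filter_upwards [Measure.ae_ne volume 0] with k hk
  exact (integral_shellDensity_smul_wightmanPhase hn hν hf hτ x hk).symm

end AnalyticContinuation

end WightmanPhase

/-! ### Boundary value and its Fourier transform -/

section MinkowskiFourier

variable {n : ℕ}

instance instIsAddHaarMeasureMink (n : ℕ) : (volume : Measure (Mink n)).IsAddHaarMeasure :=
  Measure.prod.instIsAddHaarMeasure volume volume

theorem continuous_minkProd : Continuous fun y : Mink n × Mink n => minkProd y.1 y.2 := by
  unfold minkProd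
  fun_prop

theorem norm_exp_I_mul_ofReal (r : ℝ) : ‖Complex.exp (Complex.I * (r : ℂ))‖ = 1 := by
  rw [mul_comm, Complex.norm_exp_ofReal_mul_I]

/-- Minkowski space with its Euclidean norm: Mathlib's Fourier transform needs an inner product,
whereas the product `Mink n` carries the sup norm. -/
abbrev EMink (n : ℕ) : Type := WithLp 2 (ℝ × EuclideanSpace ℝ (Fin n))

/-- The identity map from Minkowski space to its Euclidean copy. -/
noncomputable def toEMink (n : ℕ) : Mink n ≃L[ℝ] EMink n :=
  (WithLp.prodContinuousLinearEquiv 2 ℝ ℝ (EuclideanSpace ℝ (Fin n))).symm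

/-- Reflection of the spatial momentum, which turns the Minkowski product into minus the Euclidean
inner product. -/
noncomputable def reflectMink (n : ℕ) : Mink n ≃L[ℝ] Mink n :=
  (ContinuousLinearEquiv.refl ℝ ℝ).prodCongr (ContinuousLinearEquiv.neg ℝ)

/-- The Euclidean frequency `(ω, -k) / 2π` of a momentum `(ω, k)`. -/
noncomputable def toFrequency (n : ℕ) : Mink n ≃L[ℝ] EMink n :=
  ((reflectMink n).trans (ContinuousLinearEquiv.smulLeft
    (Units.mk0 ((2 * π)⁻¹ : ℝ) (inv_ne_zero (by positivity))))).trans (toEMink n)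

theorem neg_two_pi_mul_inner_toFrequency (x p : Mink n) :
    -2 * π * ⟪toEMink n x, toFrequency n p⟫ = minkProd p x := by
  have hinner : ⟪toEMink n x, toFrequency n p⟫
      = ⟪x.1, (2 * π)⁻¹ • p.1⟫ + ⟪x.2, (2 * π)⁻¹ • -p.2⟫ := rfl
  rw [hinner, inner_smul_right, inner_smul_right, inner_neg_right, minkProd, real_inner_comm p.2]
  simp only [RCLike.inner_apply, conj_trivial]
  have := pi_ne_zero
  field_simp
  ring

theorem measurePreserving_toEMink (n : ℕ) : MeasurePreserving (toEMink n) volume volume :=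
  WithLp.volume_preserving_toLp ℝ (EuclideanSpace ℝ (Fin n))

theorem measurePreserving_reflectMink (n : ℕ) : MeasurePreserving (reflectMink n) volume volume :=
  (MeasurePreserving.id (volume : Measure ℝ)).prod
    (Measure.measurePreserving_neg (volume : Measure (EuclideanSpace ℝ (Fin n))))

theorem finrank_mink (n : ℕ) : Module.finrank ℝ (Mink n) = n + 1 := by
  rw [Module.finrank_prod, Module.finrank_self, finrank_euclideanSpace_fin, add_comm]

theorem integral_eMink (g : EMink n → ℂ) :
    ∫ v, g v = (∫ p, g (toFrequency n p)) / (2 * π) ^ (n + 1) := by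
  have hreflect : ∫ p, g (toFrequency n p) = ∫ p : Mink n, g (toEMink n ((2 * π)⁻¹ • p)) :=
    (measurePreserving_reflectMink n).integral_comp
      (reflectMink n).toHomeomorph.measurableEmbedding (fun p => g (toEMink n ((2 * π)⁻¹ • p)))
  rw [hreflect, Measure.integral_comp_smul volume (fun p : Mink n => g (toEMink n p)),
    finrank_mink, (measurePreserving_toEMink n).integral_comp
      (toEMink n).toHomeomorph.measurableEmbedding,
    inv_pow, inv_inv, abs_of_pos (by positivity), Complex.real_smul]
  push_cast
  field_simp

open FourierTransform

/-- The Minkowski Fourier transform `minkFourier` as a continuous map of Schwartz functions. -/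
noncomputable def minkFourierCLM (n : ℕ) : 𝓢(Mink n, ℂ) →L[ℂ] 𝓢(Mink n, ℂ) :=
  (SchwartzMap.compCLMOfContinuousLinearEquiv ℂ (toFrequency n)).comp
    ((SchwartzMap.fourierTransformCLM ℂ).comp
      (SchwartzMap.compCLMOfContinuousLinearEquiv ℂ (toEMink n).symm))

theorem minkFourierCLM_apply (h : 𝓢(Mink n, ℂ)) (p : Mink n) :
    minkFourierCLM n h p = minkFourier h p := by
  have hfourier : minkFourierCLM n h p
      = 𝓕 (fun v => h ((toEMink n).symm v)) (toFrequency n p) := rfl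
  rw [hfourier, Real.fourier_eq', minkFourier, ← (measurePreserving_toEMink n).integral_comp
    (toEMink n).toHomeomorph.measurableEmbedding]
  simp only [neg_two_pi_mul_inner_toFrequency, ContinuousLinearEquiv.symm_apply_apply, smul_eq_mul,
    mul_comm Complex.I]

/-- The inverse of the Minkowski Fourier transform on Schwartz functions. -/
noncomputable def minkFourierInvCLM (n : ℕ) : 𝓢(Mink n, ℂ) →L[ℂ] 𝓢(Mink n, ℂ) :=
  (SchwartzMap.compCLMOfContinuousLinearEquiv ℂ (toEMink n)).comp
    ((FourierTransform.fourierInvCLM ℂ 𝓢(EMink n, ℂ)).comp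
      (SchwartzMap.compCLMOfContinuousLinearEquiv ℂ (toFrequency n).symm))

theorem minkFourierInvCLM_apply (Φ : 𝓢(Mink n, ℂ)) (x : Mink n) :
    minkFourierInvCLM n Φ x
      = (∫ p, Complex.exp (-(Complex.I * (minkProd p x : ℂ))) * Φ p) / (2 * π) ^ (n + 1) := by
  have hfourier : minkFourierInvCLM n Φ x
      = (𝓕⁻ (SchwartzMap.compCLMOfContinuousLinearEquiv ℂ (toFrequency n).symm Φ) :
          𝓢(EMink n, ℂ)) (toEMink n x) := rfl
  rw [hfourier, SchwartzMap.fourierInv_coe, Real.fourierInv_eq', integral_eMink]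
  congr 2
  ext p
  simp only [SchwartzMap.compCLMOfContinuousLinearEquiv_apply, Function.comp_apply,
    ContinuousLinearEquiv.symm_apply_apply, smul_eq_mul]
  rw [real_inner_comm, ← neg_two_pi_mul_inner_toFrequency]
  congr 2
  push_cast
  ring

theorem minkFourier_minkFourierInvCLM (Φ : 𝓢(Mink n, ℂ)) :
    minkFourier (minkFourierInvCLM n Φ) = Φ := by
  have hcancel : SchwartzMap.compCLMOfContinuousLinearEquiv ℂ (toEMink n).symm
      (minkFourierInvCLM n Φ)
      = (𝓕⁻ (SchwartzMap.compCLMOfContinuousLinearEquiv ℂ (toFrequency n).symm Φ) :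
          𝓢(EMink n, ℂ)) := by
    ext v
    exact congrArg (𝓕⁻ (SchwartzMap.compCLMOfContinuousLinearEquiv ℂ (toFrequency n).symm Φ) :
      𝓢(EMink n, ℂ)) ((toEMink n).apply_symm_apply v)
  ext p
  have hfourier : minkFourierCLM n (minkFourierInvCLM n Φ) p
      = (𝓕 (SchwartzMap.compCLMOfContinuousLinearEquiv ℂ (toEMink n).symm
          (minkFourierInvCLM n Φ)) : 𝓢(EMink n, ℂ)) (toFrequency n p) := rfl
  rw [← minkFourierCLM_apply, hfourier, hcancel, fourier_fourierInv_eq,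
    SchwartzMap.compCLMOfContinuousLinearEquiv_apply, Function.comp_apply,
    ContinuousLinearEquiv.symm_apply_apply]

theorem integral_integral_exp_minkProd_mul {μ : Measure (Mink n)} [SFinite μ] {w h : Mink n → ℂ}
    (hw : Integrable w μ) (hh : Integrable h) :
    ∫ x, (∫ p, Complex.exp (Complex.I * (minkProd p x : ℂ)) * w p ∂μ) * h x
      = ∫ p, w p * minkFourier h p ∂μ := by
  have hint : Integrable (Function.uncurry fun x p : Mink n =>
      Complex.exp (Complex.I * (minkProd p x : ℂ)) * (h x * w p)) (volume.prod μ) := by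
    refine (hh.mul_prod hw).bdd_mul (c := 1) (Continuous.aestronglyMeasurable ?_)
      (.of_forall fun y => (norm_exp_I_mul_ofReal _).le)
    exact Complex.continuous_exp.comp (continuous_const.mul
      (Complex.continuous_ofReal.comp (continuous_minkProd.comp continuous_swap)))
  calc _ = ∫ x, ∫ p, Complex.exp (Complex.I * (minkProd p x : ℂ)) * (h x * w p) ∂μ := by
        simp only [← integral_mul_const, mul_assoc, mul_comm (h _)]
    _ = ∫ p, (∫ x, Complex.exp (Complex.I * (minkProd p x : ℂ)) * (h x * w p)) ∂μ :=
        integral_integral_swap hint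
    _ = _ := by
        simp only [minkFourier, ← mul_assoc, integral_mul_const, mul_comm (w _)]

end MinkowskiFourier

section DistributionalSupport

variable {E : Type*} [NormedAddCommGroup E] [NormedSpace ℝ E]

theorem dsupport_const_smul (T : 𝓢'(E, ℂ)) {c : ℂ} (hc : c ≠ 0) :
    Distribution.dsupport (c • T) = Distribution.dsupport T := by
  ext x
  simp only [Distribution.mem_dsupport_iff_forall_exists_ne, smul_apply, smul_ne_zero_iff, ne_eq,
    hc, not_false_eq_true, true_and]

variable [FiniteDimensional ℝ E] [MeasurableSpace E] [BorelSpace E]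

theorem exists_schwartz_tsupport_subset_integral_ne_zero (μ : Measure E) [μ.HasTemperateGrowth]
    {x : E} (hx : x ∈ μ.support) {s : Set E} (hs : s ∈ 𝓝 x) :
    ∃ g : 𝓢(E, ℂ), tsupport g ⊆ s ∧ ∫ y, g y ∂μ ≠ 0 := by
  obtain ⟨b, hbs, hbc, hb, hb01, hbx⟩ := exists_contDiff_tsupport_subset (n := ⊤) hs
  have hgc : HasCompactSupport fun y => ((b y : ℝ) : ℂ) := hbc.comp_left Complex.ofReal_zero
  let g : 𝓢(E, ℂ) := hgc.toSchwartzMap (Complex.ofRealCLM.contDiff.comp hb)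
  have hint : Integrable b μ := (g.integrable (μ := μ)).re
  have hpos : 0 < ∫ y, b y ∂μ := by
    rw [integral_pos_iff_support_of_nonneg (fun y => (hb01 (mem_range_self y)).1) hint]
    refine (μ.mem_support_iff_forall x).1 hx _ (hb.continuous.isOpen_support.mem_nhds ?_)
    simp [hbx]
  refine ⟨g, (tsupport_comp_subset Complex.ofReal_zero b).trans hbs, ?_⟩
  have hg : ∫ y, g y ∂μ = ((∫ y, b y ∂μ : ℝ) : ℂ) := integral_complex_ofReal
  rw [hg]
  exact_mod_cast hpos.ne'

theorem dsupport_toTemperedDistribution (μ : Measure E) [μ.HasTemperateGrowth] :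
    Distribution.dsupport μ.toTemperedDistribution = μ.support := by
  refine Subset.antisymm (fun x hx => ?_) fun x hx => ?_
  · by_contra hxs
    obtain ⟨u, hu, hμu⟩ := Measure.notMem_support_iff_exists.1 hxs
    obtain ⟨g, hgu, hg⟩ := (Distribution.mem_dsupport_iff_forall_exists_ne x).1 hx (interior u)
      (mem_interior_iff_mem_nhds.2 hu) isOpen_interior
    refine hg ?_
    rw [Measure.toTemperedDistribution_apply μ g]
    refine integral_eq_zero_of_ae ?_
    filter_upwards [measure_eq_zero_iff_ae_notMem.1 hμu] with y hy
    by_contra hgy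
    exact hy (interior_subset (hgu (subset_tsupport _ hgy)))
  · refine (Distribution.mem_dsupport_iff_forall_exists_ne x).2 fun s hxs hs => ?_
    simpa only [Measure.toTemperedDistribution_apply] using
      exists_schwartz_tsupport_subset_integral_ne_zero μ hx (hs.mem_nhds hxs)

end DistributionalSupport

section Damping

variable {α E : Type*} [MeasurableSpace α] {μ : Measure α} [NormedAddCommGroup E] [NormedSpace ℝ E]

theorem tendsto_integral_exp_neg_mul_smul {e : α → ℝ} {G : α → E} (he : ∀ᵐ a ∂μ, 0 ≤ e a)
    (hem : AEMeasurable e μ) (hG : Integrable G μ) :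
    Tendsto (fun ε : ℝ => ∫ a, Real.exp (-(ε * e a)) • G a ∂μ) (𝓝[>] 0) (𝓝 (∫ a, G a ∂μ)) := by
  refine tendsto_integral_filter_of_dominated_convergence (fun a => ‖G a‖)
    (.of_forall fun ε => ?_) ?_ hG.norm (.of_forall fun a => ?_)
  · exact (hem.const_mul ε).neg.exp.aestronglyMeasurable.smul hG.aestronglyMeasurable
  · filter_upwards [self_mem_nhdsWithin] with ε (hε : 0 < ε)
    filter_upwards [he] with a ha
    rw [norm_smul, Real.norm_of_nonneg (Real.exp_pos _).le]
    refine mul_le_of_le_one_left (norm_nonneg _) (Real.exp_le_one_iff.2 ?_)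
    nlinarith
  · have hcont : Continuous fun ε : ℝ => Real.exp (-(ε * e a)) • G a := by fun_prop
    simpa using (hcont.tendsto 0).mono_left nhdsWithin_le_nhds

end Damping

section WightmanDistribution

variable {n : ℕ}

theorem closure_futureCone : closure (futureCone n) = {p : Mink n | ‖p.2‖ ≤ p.1} := by
  refine Subset.antisymm (closure_minimal (fun p hp => le_of_lt (b := p.1) hp)
    (isClosed_le (by fun_prop) (by fun_prop))) fun p (hp : ‖p.2‖ ≤ p.1) => ?_
  have hshift : Tendsto (fun δ : ℝ => ((p.1 + δ, p.2) : Mink n)) (𝓝[>] 0) (𝓝 p) := by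
    have hcont : Continuous fun δ : ℝ => ((p.1 + δ, p.2) : Mink n) := by fun_prop
    simpa using (hcont.tendsto 0).mono_left nhdsWithin_le_nhds
  refine mem_closure_of_tendsto hshift ?_
  filter_upwards [self_mem_nhdsWithin] with δ (hδ : 0 < δ)
  exact show ‖p.2‖ < p.1 + δ by linarith

theorem wightmanPhase_sub_I_mul (ε : ℝ) (x p : Mink n) :
    wightmanPhase ((x.1 : ℂ) - Complex.I * ε) x.2 p
      = Complex.exp (Complex.I * (minkProd p x : ℂ)) *
        ((Real.exp (-(ε * p.1)) : ℂ) / (2 * π) ^ (n + 1)) := by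
  rw [wightmanPhase, minkProd, Complex.ofReal_exp, mul_div_assoc', ← Complex.exp_add]
  congr 2
  push_cast
  linear_combination (p.1 : ℂ) * ε * Complex.I_sq

theorem wightmanReg_eq_integral_exp_minkProd (hn : 1 ≤ n) {ν : ℝ} (hν : ν ∈ Ioo (0 : ℝ) 1)
    (f ε : ℝ) (x : Mink n) :
    wightmanReg n ν f ε x = ∫ p, Complex.exp (Complex.I * (minkProd p x : ℂ)) *
      ((Real.exp (-(ε * p.1)) : ℂ) / (2 * π) ^ (n + 1)) ∂wightmanMeasure n ν f := by
  simp only [wightmanReg, wightman_eq_integral hn hν, wightmanPhase_sub_I_mul]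

variable (hn : 1 ≤ n) {ν : ℝ} (hν : ν ∈ Ioo (0 : ℝ) 1)
include hn hν

theorem wightmanDensity_pos (f : ℝ) {p : Mink n} (hp : p ∈ futureCone n) :
    0 < wightmanDensity n ν f p := by
  rw [wightmanDensity_eq_indicator, indicator_of_mem hp]
  exact mul_pos (by linarith [Aconst_pos hn hν]) (spectralDensity_pos hν _ (negSq_pos hp))

theorem support_wightmanMeasure (f : ℝ) :
    (wightmanMeasure n ν f).support = {p : Mink n | ‖p.2‖ ≤ p.1} := by
  rw [← closure_futureCone]
  refine Subset.antisymm (Measure.support_subset_of_isClosed isClosed_closure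
    ((ae_mem_futureCone n ν f).mono fun p hp => subset_closure hp))
    (closure_minimal (fun p hp => ?_) Measure.isClosed_support)
  rw [Measure.mem_support_iff_forall]
  intro u hu
  have hcone : futureCone n ∩ u ∈ 𝓝 p := inter_mem (isOpen_futureCone.mem_nhds hp) hu
  have hzero := (withDensity_apply_eq_zero (μ := volume) (s := u)
    (measurable_wightmanDensity n ν f).ennreal_ofReal).not
  refine pos_iff_ne_zero.2 (hzero.2 ((Measure.measure_pos_of_mem_nhds volume hcone).trans_le
    (measure_mono (inter_subset_inter_left u fun k hk => ?_))).ne')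
  exact (ENNReal.ofReal_pos.2 (wightmanDensity_pos hn hν f hk)).ne'

theorem hasTemperateGrowth_wightmanMeasure (f : ℝ) :
    (wightmanMeasure n ν f).HasTemperateGrowth := by
  refine ⟨n + 3, (integrable_inv_one_add_fst_pow hn hν f).congr ?_⟩
  filter_upwards [ae_mem_futureCone n ν f] with p hp
  have : 0 ≤ p.1 := (norm_nonneg _).trans (le_of_lt hp)
  rw [norm_eq_fst_of_mem_futureCone hp, Real.rpow_neg (by positivity), Real.rpow_natCast]

theorem integrable_wightmanDensity_mul_schwartz (f : ℝ) (g : 𝓢(Mink n, ℂ)) :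
    Integrable fun p : Mink n => (wightmanDensity n ν f p : ℂ) * g p := by
  have := hasTemperateGrowth_wightmanMeasure hn hν f
  simpa only [Complex.real_smul] using (integrable_wightmanMeasure_iff hn hν f).1 g.integrable

theorem integral_wightmanMeasure_div (f : ℝ) (g : Mink n → ℂ) :
    ((2 * π : ℂ) ^ (n + 1))⁻¹ • ∫ p, g p ∂wightmanMeasure n ν f
      = ∫ p, (wightmanDensity n ν f p : ℂ) * g p / (2 * π) ^ (n + 1) := by
  rw [integral_wightmanMeasure hn hν, integral_div, smul_eq_mul, div_eq_inv_mul]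
  simp only [Complex.real_smul]

theorem integrable_exp_neg_div_two_pi_pow (f : ℝ) {ε : ℝ} (hε : 0 < ε) :
    Integrable (fun p : Mink n => (Real.exp (-(ε * p.1)) : ℂ) / (2 * π) ^ (n + 1))
      (wightmanMeasure n ν f) := by
  refine Integrable.div_const (integrable_wightmanMeasure_of_le_exp hn hν f
    (Continuous.aestronglyMeasurable (by fun_prop)) hε 0 zero_le_one fun p _ => ?_) _
  rw [Complex.norm_real, Real.norm_of_nonneg (Real.exp_pos _).le, pow_zero, one_mul, one_mul]

theorem integral_wightmanReg_mul (f : ℝ) {ε : ℝ} (hε : 0 < ε) {h : Mink n → ℂ}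
    (hh : Integrable h) :
    ∫ x, wightmanReg n ν f ε x * h x = ∫ p,
      (Real.exp (-(ε * p.1)) : ℂ) / (2 * π) ^ (n + 1) * minkFourier h p ∂wightmanMeasure n ν f := by
  simp only [wightmanReg_eq_integral_exp_minkProd hn hν]
  exact integral_integral_exp_minkProd_mul (integrable_exp_neg_div_two_pi_pow hn hν f hε) hh

theorem tendsto_integral_wightmanReg_mul (f : ℝ) {h : Mink n → ℂ} (hh : Integrable h)
    (hFh : Integrable (minkFourier h) (wightmanMeasure n ν f)) :
    Tendsto (fun ε : ℝ => ∫ x : Mink n, wightmanReg n ν f ε x * h x) (𝓝[>] 0)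
      (𝓝 (((2 * π : ℂ) ^ (n + 1))⁻¹ • ∫ p, minkFourier h p ∂wightmanMeasure n ν f)) := by
  have hlim := tendsto_integral_exp_neg_mul_smul
    ((ae_mem_futureCone n ν f).mono fun p hp => (norm_nonneg _).trans (le_of_lt hp))
    measurable_fst.aemeasurable hFh
  refine (hlim.const_smul _).congr' ?_
  filter_upwards [self_mem_nhdsWithin] with ε hε
  rw [integral_wightmanReg_mul hn hν f hε hh, ← integral_smul]
  congr 1
  ext p
  rw [smul_eq_mul, Complex.real_smul]
  ring

/-- The Fourier transform of the boundary value of the Wightman function. -/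
noncomputable def wightmanFourierDistribution (n : ℕ) (ν f : ℝ)
    [(wightmanMeasure n ν f).HasTemperateGrowth] : 𝓢'(Mink n, ℂ) :=
  ((2 * π : ℂ) ^ (n + 1))⁻¹ • (wightmanMeasure n ν f).toTemperedDistribution

/-- The boundary value of the Wightman function at real times. -/
noncomputable def wightmanDistribution (n : ℕ) (ν f : ℝ)
    [(wightmanMeasure n ν f).HasTemperateGrowth] : 𝓢'(Mink n, ℂ) :=
  ContinuousLinearMap.toPointwiseConvergenceCLM ℂ (RingHom.id ℂ) _ _
    ((((2 * π : ℂ) ^ (n + 1))⁻¹ • SchwartzMap.integralCLM ℂ (wightmanMeasure n ν f)).comp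
      (minkFourierCLM n))

theorem exists_wightman_distribution (f : ℝ) :
    ∃ T That : 𝓢'(Mink n, ℂ),
      (∀ h : 𝓢(Mink n, ℂ),
        Tendsto (fun ε : ℝ => ∫ x : Mink n, wightmanReg n ν f ε x * h x) (𝓝[>] 0) (𝓝 (T h))) ∧
      (∀ h : 𝓢(Mink n, ℂ),
        Integrable (fun p : Mink n => (wightmanDensity n ν f p : ℂ) * minkFourier h p) ∧
        T h = ∫ p : Mink n,
          (wightmanDensity n ν f p : ℂ) * minkFourier h p / (2 * π) ^ (n + 1)) ∧
      (∀ g : 𝓢(Mink n, ℂ),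
        Integrable (fun p : Mink n => (wightmanDensity n ν f p : ℂ) * g p) ∧
        That g = ∫ p : Mink n, (wightmanDensity n ν f p : ℂ) * g p / (2 * π) ^ (n + 1)) ∧
      Distribution.dsupport That = {p : Mink n | ‖p.2‖ ≤ p.1} := by
  have := hasTemperateGrowth_wightmanMeasure hn hν f
  have hfourier (h : 𝓢(Mink n, ℂ)) : ⇑(minkFourierCLM n h) = minkFourier h :=
    funext (minkFourierCLM_apply h)
  have hT (h : 𝓢(Mink n, ℂ)) : wightmanDistribution n ν f h
      = ((2 * π : ℂ) ^ (n + 1))⁻¹ • ∫ p, minkFourier h p ∂wightmanMeasure n ν f := by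
    rw [← hfourier]
    rfl
  refine ⟨wightmanDistribution n ν f, wightmanFourierDistribution n ν f, fun h => ?_, fun h => ?_,
    fun g => ⟨integrable_wightmanDensity_mul_schwartz hn hν f g,
      integral_wightmanMeasure_div hn hν f g⟩, ?_⟩
  · rw [hT]
    refine tendsto_integral_wightmanReg_mul hn hν f h.integrable ?_
    rw [← hfourier]
    exact (minkFourierCLM n h).integrable
  · rw [hT, integral_wightmanMeasure_div hn hν, ← hfourier]
    exact ⟨integrable_wightmanDensity_mul_schwartz hn hν f (minkFourierCLM n h), rfl⟩
  · exact (dsupport_const_smul _ (inv_ne_zero (by simp [pi_ne_zero]))).trans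
      ((dsupport_toTemperedDistribution _).trans (support_wightmanMeasure hn hν f))

end WightmanDistribution

/-! ### Bessel functions -/

section Bessel

open scoped Nat

theorem hasDerivAt_tsum_mul_pow {𝕜 : Type*} [RCLike 𝕜] {c : ℕ → 𝕜} {B : ℝ}
    (hc : ∀ m, ‖c m‖ ≤ B / m !) (x : 𝕜) :
    HasDerivAt (fun x => ∑' m, c m * x ^ m) (∑' m, c (m + 1) * (m + 1) * x ^ m) x := by
  set r : ℝ := ‖x‖ + 1
  have hx : x ∈ Metric.ball (0 : 𝕜) r := by simp [r]
  have hmajorant : Summable fun m : ℕ => B / m ! * (m * r ^ (m - 1)) := by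
    rw [← summable_nat_add_iff 1]
    refine ((Real.summable_pow_div_factorial r).mul_left B).congr fun m => ?_
    have hfac : (m ! : ℝ) ≠ 0 := by positivity
    have hsucc : (m : ℝ) + 1 ≠ 0 := by positivity
    simp only [Nat.factorial_succ, Nat.add_sub_cancel]
    push_cast
    field_simp
  have hterm : ∀ m : ℕ, ∀ y ∈ Metric.ball (0 : 𝕜) r,
      ‖c m * (m * y ^ (m - 1))‖ ≤ B / m ! * (m * r ^ (m - 1)) := by
    intro m y hy
    rw [norm_mul, norm_mul, norm_pow, RCLike.norm_natCast]
    have := (norm_nonneg _).trans (hc m)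
    gcongr
    · exact hc m
    · exact (mem_ball_zero_iff.1 hy).le
  have hsummable : Summable fun m => c m * x ^ m := by
    refine .of_norm_bounded ((Real.summable_pow_div_factorial ‖x‖).mul_left B) fun m => ?_
    rw [norm_mul, norm_pow, mul_div_left_comm, mul_comm]
    gcongr
    exact hc m
  refine (hasDerivAt_tsum_of_isPreconnected hmajorant Metric.isOpen_ball
    (convex_ball (0 : 𝕜) r).isPreconnected (fun m y _ => (hasDerivAt_pow m y).const_mul (c m))
    hterm hx hsummable hx).congr_deriv ?_
  rw [(Summable.of_norm_bounded hmajorant fun m => hterm m x hx).tsum_eq_zero_add]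
  simp [mul_assoc]

/-- The Taylor coefficients of `besselEntire` in powers of `s / 4`. -/
noncomputable def besselCoeff (μ : ℝ) (m : ℕ) : ℝ :=
  (-1) ^ m / ((m.factorial : ℝ) * Real.Gamma (m + μ + 1))

theorem besselEntire_eq_tsum (μ s : ℝ) :
    besselEntire μ s = ∑' m : ℕ, besselCoeff μ m * (s / 4) ^ m := rfl

theorem besselEntire_zero (μ : ℝ) : besselEntire μ 0 = (Real.Gamma (1 + μ))⁻¹ := by
  rw [besselEntire_eq_tsum, tsum_eq_single 0 fun m hm => by simp [hm]]
  simp [besselCoeff, add_comm]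

theorem besselCoeff_succ (μ : ℝ) (m : ℕ) :
    besselCoeff μ (m + 1) * (m + 1) = -besselCoeff (μ + 1) m := by
  have hm : (m : ℝ) + 1 ≠ 0 := by positivity
  have hindex : ((m + 1 : ℕ) : ℝ) + μ + 1 = m + (μ + 1) + 1 := by
    push_cast
    ring
  rw [besselCoeff, besselCoeff, hindex, Nat.factorial_succ, pow_succ]
  push_cast
  field_simp

variable {μ : ℝ}

theorem Gamma_nat_add_pos (hμ : -1 < μ) (m : ℕ) : 0 < Real.Gamma (m + μ + 1) := by
  have : (0 : ℝ) ≤ m := Nat.cast_nonneg m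
  exact Real.Gamma_pos_of_pos (by linarith)

theorem Gamma_nat_add_succ (hμ : -1 < μ) (m : ℕ) :
    Real.Gamma (m + (μ + 1) + 1) = (m + μ + 1) * Real.Gamma (m + μ + 1) := by
  have : (0 : ℝ) ≤ m := Nat.cast_nonneg m
  rw [← Real.Gamma_add_one (by linarith), add_assoc (m : ℝ) μ 1]

theorem besselCoeff_eq_mul (hμ : -1 < μ) (m : ℕ) :
    besselCoeff μ m = (m + μ + 1) * besselCoeff (μ + 1) m := by
  have : (0 : ℝ) ≤ m := Nat.cast_nonneg m
  have hfactor : (m : ℝ) + μ + 1 ≠ 0 := by linarith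
  have hGamma := (Gamma_nat_add_pos hμ m).ne'
  rw [besselCoeff, besselCoeff, Gamma_nat_add_succ hμ]
  field_simp

theorem exists_besselCoeff_bound (hμ : -1 < μ) :
    ∃ B : ℝ, ∀ m : ℕ, |besselCoeff μ m| ≤ B / m ! := by
  have hzero := Gamma_nat_add_pos hμ 0
  have hone := Gamma_nat_add_pos hμ 1
  have hmono : ∀ m : ℕ, Real.Gamma ((1 : ℕ) + μ + 1) ≤ Real.Gamma ((m + 1 : ℕ) + μ + 1) := by
    intro m
    induction m with
    | zero => rfl
    | succ m ih =>
      have hrec := Gamma_nat_add_succ hμ (m + 1)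
      have : (0 : ℝ) ≤ m := Nat.cast_nonneg m
      calc _ ≤ Real.Gamma ((m + 1 : ℕ) + μ + 1) := ih
        _ ≤ ((m + 1 : ℕ) + μ + 1) * Real.Gamma ((m + 1 : ℕ) + μ + 1) :=
          le_mul_of_one_le_left (Gamma_nat_add_pos hμ (m + 1)).le (by push_cast; linarith)
        _ = _ := by
          rw [← hrec]
          congr 1
          push_cast
          ring
  refine ⟨(Real.Gamma ((0 : ℕ) + μ + 1))⁻¹ + (Real.Gamma ((1 : ℕ) + μ + 1))⁻¹, fun m => ?_⟩
  have hGamma := Gamma_nat_add_pos hμ m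
  have hfac : (0 : ℝ) < m ! := by positivity
  rw [besselCoeff, abs_div, abs_pow, abs_neg, abs_one, one_pow, abs_of_pos (mul_pos hfac hGamma),
    one_div, mul_inv, div_eq_mul_inv, mul_comm]
  gcongr
  cases m with
  | zero => exact le_add_of_nonneg_right (inv_nonneg.2 hone.le)
  | succ m =>
    exact (inv_anti₀ hone (hmono m)).trans (le_add_of_nonneg_left (inv_nonneg.2 hzero.le))

theorem summable_besselEntire (hμ : -1 < μ) (s : ℝ) :
    Summable fun m : ℕ => besselCoeff μ m * (s / 4) ^ m := by
  obtain ⟨B, hB⟩ := exists_besselCoeff_bound hμ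
  refine .of_norm_bounded ((Real.summable_pow_div_factorial |s / 4|).mul_left B) fun m => ?_
  rw [norm_mul, norm_pow, Real.norm_eq_abs, Real.norm_eq_abs, mul_div_left_comm, mul_comm]
  gcongr
  exact hB m

theorem hasDerivAt_besselEntire (hμ : -1 < μ) (s : ℝ) :
    HasDerivAt (besselEntire μ) (-(besselEntire (μ + 1) s / 4)) s := by
  obtain ⟨B, hB⟩ := exists_besselCoeff_bound hμ
  refine ((hasDerivAt_tsum_mul_pow hB (s / 4)).comp s
    ((hasDerivAt_id s).div_const 4)).congr_deriv ?_
  rw [mul_one_div, besselEntire_eq_tsum, ← neg_div, ← tsum_neg]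
  simp only [besselCoeff_succ, neg_mul]

theorem contDiff_besselEntire (hμ : -1 < μ) : ContDiff ℝ ∞ (besselEntire μ) := by
  rw [contDiff_infty]
  intro m
  induction m generalizing μ with
  | zero =>
    exact contDiff_zero.2 (continuous_iff_continuousAt.2 fun s =>
      (hasDerivAt_besselEntire hμ s).continuousAt)
  | succ m ih =>
    have hderiv : deriv (besselEntire μ) = fun s => -(besselEntire (μ + 1) s / 4) :=
      funext fun s => (hasDerivAt_besselEntire hμ s).deriv
    push_cast
    rw [contDiff_succ_iff_deriv, hderiv]
    exact ⟨fun s => (hasDerivAt_besselEntire hμ s).differentiableAt, by simp,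
      ((ih (by linarith)).div_const 4).neg⟩

theorem besselEntire_recurrence (hμ : -1 < μ) (s : ℝ) :
    s / 4 * besselEntire (μ + 2) s = (μ + 1) * besselEntire (μ + 1) s - besselEntire μ s := by
  have hsum := summable_besselEntire hμ s
  have hsum_succ := (summable_besselEntire (μ := μ + 1) (by linarith) s).mul_left (μ + 1)
  have hconst : (μ + 1) * (besselCoeff (μ + 1) 0 * (s / 4) ^ 0)
      - besselCoeff μ 0 * (s / 4) ^ 0 = 0 := by
    rw [besselCoeff_eq_mul hμ 0]
    simp
  rw [besselEntire_eq_tsum μ, besselEntire_eq_tsum (μ + 1), besselEntire_eq_tsum (μ + 2),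
    ← tsum_mul_left, ← tsum_mul_left, ← hsum_succ.tsum_sub hsum,
    (hsum_succ.sub hsum).tsum_eq_zero_add, hconst, zero_add]
  refine tsum_congr fun m => ?_
  have hcoeff := besselCoeff_succ (μ + 1) m
  rw [show μ + 1 + 1 = μ + 2 by ring] at hcoeff
  rw [besselCoeff_eq_mul hμ (m + 1), pow_succ]
  push_cast
  linear_combination ((s / 4) ^ m * (s / 4)) * hcoeff

/-- An energy `ϕ'² + ϕ² / (4 s)` for `ϕ = besselEntire μ`, decreasing in `s`: it controls the growth
of Bessel functions. -/
noncomputable def besselEnergy (μ s : ℝ) : ℝ :=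
  besselEntire (μ + 1) s ^ 2 / 16 + besselEntire μ s ^ 2 / (4 * s)

theorem hasDerivAt_besselEnergy (hμ : -1 < μ) {s : ℝ} (hs : 0 < s) :
    HasDerivAt (besselEnergy μ) (-((μ + 1) * besselEntire (μ + 1) s ^ 2 / (8 * s)
      + besselEntire μ s ^ 2 / (4 * s ^ 2))) s := by
  have hkinetic :=
    ((hasDerivAt_besselEntire (μ := μ + 1) (by linarith) s).pow 2).div_const 16
  have hpotential := ((hasDerivAt_besselEntire hμ s).pow 2).div
    ((hasDerivAt_id s).const_mul 4) (by simpa using hs.ne')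
  refine (hkinetic.add hpotential).congr_deriv ?_
  have hrec : besselEntire (μ + 2) s
      = ((μ + 1) * besselEntire (μ + 1) s - besselEntire μ s) * 4 / s := by
    rw [← besselEntire_recurrence hμ s]
    field_simp
  rw [show μ + 1 + 1 = μ + 2 by ring, hrec]
  simp only [id, Pi.pow_apply]
  field_simp
  ring

theorem antitoneOn_besselEnergy (hμ : -1 < μ) : AntitoneOn (besselEnergy μ) (Ioi 0) := by
  refine antitoneOn_of_deriv_nonpos (convex_Ioi 0) (fun s hs => ?_) (fun s hs => ?_)
    fun s hs => ?_
  · exact (hasDerivAt_besselEnergy hμ hs).continuousAt.continuousWithinAt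
  · rw [interior_Ioi] at hs
    exact (hasDerivAt_besselEnergy hμ hs).differentiableAt.differentiableWithinAt
  · rw [interior_Ioi] at hs
    have : 0 < s := hs
    have : 0 < μ + 1 := by linarith
    rw [(hasDerivAt_besselEnergy hμ hs).deriv]
    exact neg_nonpos.2 (by positivity)

theorem exists_besselEntire_bound (hμ : -1 < μ) :
    ∃ C : ℝ, 0 ≤ C ∧ ∀ s : ℝ, 0 ≤ s → |besselEntire μ s| ≤ C * (1 + s) := by
  obtain ⟨C, hC⟩ := isCompact_Icc.exists_bound_of_continuousOn (s := Icc (0 : ℝ) 1)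
    (contDiff_besselEntire hμ).continuous.continuousOn
  have hC0 : 0 ≤ C := (norm_nonneg _).trans (hC 0 ⟨le_rfl, zero_le_one⟩)
  have henergy_one : 0 ≤ besselEnergy μ 1 := by
    unfold besselEnergy
    positivity
  set D := 2 * √(besselEnergy μ 1)
  have hD : 0 ≤ D := by positivity
  refine ⟨C + D, by positivity, fun s hs => ?_⟩
  rcases le_total s 1 with hs1 | hs1
  · have hbound : |besselEntire μ s| ≤ C := hC s ⟨hs, hs1⟩
    nlinarith
  · have hs0 : 0 < s := one_pos.trans_le hs1
    have henergy : besselEntire μ s ^ 2 / (4 * s) ≤ besselEnergy μ 1 :=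
      (le_add_of_nonneg_left (by positivity)).trans
        (antitoneOn_besselEnergy hμ (mem_Ioi.2 one_pos) hs0 hs1)
    rw [div_le_iff₀ (by positivity)] at henergy
    have hbound : |besselEntire μ s| ≤ D * s := by
      refine abs_le_of_sq_le_sq ?_ (by positivity)
      rw [mul_pow, mul_pow, Real.sq_sqrt henergy_one]
      nlinarith [mul_nonneg henergy_one hs]
    nlinarith

end Bessel

/-! ### The radial Klein-Gordon equation -/

section RadialEquation

/-- A smooth solution `u` on `Z > 0` of the radial Klein-Gordon equation
`Z² u'' - (d - 1) Z u' + (s Z² - μ² + d² / 4) u = 0` at squared radial momentum `s = -p²`. -/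
structure IsRadialSolution (d μ s : ℝ) (u : ℝ → ℝ) : Prop where
  contDiffOn : ContDiffOn ℝ ∞ u (Ioi 0)
  equation : ∀ Z : ℝ, 0 < Z →
    Z ^ 2 * deriv (deriv u) Z - (d - 1) * Z * deriv u Z
      + (s * Z ^ 2 - (μ ^ 2 - (d / 2) ^ 2)) * u Z = 0

namespace IsRadialSolution

variable {d μ s : ℝ} {u v : ℝ → ℝ}

theorem differentiableAt (hu : IsRadialSolution d μ s u) {Z : ℝ} (hZ : 0 < Z) :
    DifferentiableAt ℝ u Z :=
  (hu.contDiffOn.contDiffAt (Ioi_mem_nhds hZ)).differentiableAt (by simp)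

theorem differentiableAt_deriv (hu : IsRadialSolution d μ s u) {Z : ℝ} (hZ : 0 < Z) :
    DifferentiableAt ℝ (deriv u) Z :=
  ((hu.contDiffOn.deriv_of_isOpen (m := ∞) isOpen_Ioi le_rfl).contDiffAt
    (Ioi_mem_nhds hZ)).differentiableAt (by simp)

theorem const_mul (hu : IsRadialSolution d μ s u) (c : ℝ) :
    IsRadialSolution d μ s fun Z => c * u Z where
  contDiffOn := contDiffOn_const.mul hu.contDiffOn
  equation Z hZ := by
    simp only [deriv_const_mul_field']
    linear_combination c * hu.equation Z hZ

theorem add (hu : IsRadialSolution d μ s u) (hv : IsRadialSolution d μ s v) :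
    IsRadialSolution d μ s fun Z => u Z + v Z where
  contDiffOn := hu.contDiffOn.add hv.contDiffOn
  equation Z hZ := by
    have deriv_add_eq : ∀ W : ℝ, 0 < W → deriv (fun Z => u Z + v Z) W = deriv u W + deriv v W :=
      fun W hW => deriv_fun_add (hu.differentiableAt hW) (hv.differentiableAt hW)
    have deriv_add_eventuallyEq :
        deriv (fun Z => u Z + v Z) =ᶠ[𝓝 Z] fun W => deriv u W + deriv v W := by
      filter_upwards [Ioi_mem_nhds hZ] using deriv_add_eq
    rw [deriv_add_eventuallyEq.deriv_eq, deriv_add_eq Z hZ,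
      deriv_fun_add (hu.differentiableAt_deriv hZ) (hv.differentiableAt_deriv hZ)]
    linear_combination hu.equation Z hZ + hv.equation Z hZ

theorem congr (hu : IsRadialSolution d μ s u) (h : EqOn v u (Ioi 0)) :
    IsRadialSolution d μ s v where
  contDiffOn := hu.contDiffOn.congr h
  equation Z hZ := by
    have hvu : v =ᶠ[𝓝 Z] u := h.eventuallyEq_of_mem (Ioi_mem_nhds hZ)
    rw [hvu.deriv.deriv_eq, hvu.deriv_eq, hvu.eq_of_nhds]
    exact hu.equation Z hZ

end IsRadialSolution

/-- The boundary behaviour `u ∼ a Z ^ (d / 2 - ν) + b Z ^ (d / 2 + ν)` as `Z → 0⁺`. -/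
structure HasBoundaryExpansion (d ν a b : ℝ) (u : ℝ → ℝ) : Prop where
  leading : Tendsto (fun Z : ℝ => Z ^ (-(d / 2 - ν)) * u Z) (𝓝[>] 0) (𝓝 a)
  subleading : Tendsto (fun Z : ℝ => Z ^ (-(d / 2 + ν)) * (u Z - a * Z ^ (d / 2 - ν)))
    (𝓝[>] 0) (𝓝 b)

namespace HasBoundaryExpansion

variable {d ν a b : ℝ} {u v : ℝ → ℝ}

theorem mul_const (hu : HasBoundaryExpansion d ν a b u) (c : ℝ) :
    HasBoundaryExpansion d ν (a * c) (b * c) fun Z => u Z * c where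
  leading := (hu.leading.mul_const c).congr fun Z => by ring
  subleading := (hu.subleading.mul_const c).congr fun Z => by ring

theorem congr (hu : HasBoundaryExpansion d ν a b u) (h : EqOn v u (Ioi 0)) :
    HasBoundaryExpansion d ν a b v where
  leading := hu.leading.congr' <| by
    filter_upwards [self_mem_nhdsWithin] with Z hZ
    rw [h hZ]
  subleading := hu.subleading.congr' <| by
    filter_upwards [self_mem_nhdsWithin] with Z hZ
    rw [h hZ]

end HasBoundaryExpansion

end RadialEquation

section RadialSolution

/-- The Frobenius solution `Z ^ β · besselEntire μ (s Z²)`. For `β = d / 2 + μ` and `s > 0` it is a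
constant multiple of `Z ^ (d / 2) J_μ(√s Z)`. -/
noncomputable def radialSol (β μ s Z : ℝ) : ℝ := Z ^ β * besselEntire μ (s * Z ^ 2)

/-- The derivative of `radialSol β μ s` with respect to `Z`. -/
noncomputable def radialSolDeriv (β μ s Z : ℝ) : ℝ :=
  β * radialSol (β - 1) μ s Z - s / 2 * radialSol (β + 1) (μ + 1) s Z

variable (β : ℝ) {μ : ℝ}

theorem hasDerivAt_radialSol (hμ : -1 < μ) (s : ℝ) {Z : ℝ} (hZ : 0 < Z) :
    HasDerivAt (radialSol β μ s) (radialSolDeriv β μ s Z) Z := by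
  have hpow : HasDerivAt (fun Z : ℝ => Z ^ β) (β * Z ^ (β - 1)) Z :=
    Real.hasDerivAt_rpow_const (Or.inl hZ.ne')
  have hsq : HasDerivAt (fun Z : ℝ => s * Z ^ 2) (s * (2 * Z)) Z := by
    simpa using (hasDerivAt_pow 2 Z).const_mul s
  refine (hpow.mul ((hasDerivAt_besselEntire hμ (s * Z ^ 2)).comp Z hsq)).congr_deriv ?_
  simp only [radialSolDeriv, radialSol, Function.comp_apply]
  rw [Real.rpow_add_one hZ.ne']
  ring

theorem contDiffOn_radialSol (hμ : -1 < μ) (s : ℝ) :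
    ContDiffOn ℝ ∞ (radialSol β μ s) (Ioi 0) := by
  refine ContDiffOn.mul (fun Z hZ => ?_) ?_
  · exact (Real.contDiffAt_rpow_const_of_ne (ne_of_gt hZ)).contDiffWithinAt
  · exact ((contDiff_besselEntire hμ).comp (by fun_prop)).contDiffOn

theorem radialSol_add_one (s : ℝ) {Z : ℝ} (hZ : 0 < Z) :
    radialSol (β + 1) μ s Z = Z * radialSol β μ s Z := by
  rw [radialSol, radialSol, Real.rpow_add_one hZ.ne']
  ring

theorem radialSol_sub_one (s : ℝ) {Z : ℝ} (hZ : 0 < Z) :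
    radialSol (β - 1) μ s Z = radialSol β μ s Z / Z := by
  rw [radialSol, radialSol, Real.rpow_sub_one hZ.ne']
  ring

theorem isRadialSolution_radialSol (d : ℝ) (hμ : -1 < μ) (s : ℝ) :
    IsRadialSolution d μ s (radialSol (d / 2 + μ) μ s) where
  contDiffOn := contDiffOn_radialSol _ hμ s
  equation Z hZ := by
    have deriv_eq : deriv (radialSol (d / 2 + μ) μ s) =ᶠ[𝓝 Z] radialSolDeriv (d / 2 + μ) μ s := by
      filter_upwards [Ioi_mem_nhds hZ] with W hW
      exact (hasDerivAt_radialSol _ hμ s hW).deriv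
    have deriv_deriv : HasDerivAt (radialSolDeriv (d / 2 + μ) μ s)
        ((d / 2 + μ) * radialSolDeriv (d / 2 + μ - 1) μ s Z
          - s / 2 * radialSolDeriv (d / 2 + μ + 1) (μ + 1) s Z) Z :=
      ((hasDerivAt_radialSol (d / 2 + μ - 1) hμ s hZ).const_mul _).sub
        ((hasDerivAt_radialSol (d / 2 + μ + 1) (by linarith : -1 < μ + 1) s hZ).const_mul _)
    rw [deriv_eq.deriv_eq, deriv_eq.eq_of_nhds, deriv_deriv.deriv]
    simp only [radialSolDeriv, radialSol_add_one _ _ hZ, radialSol_sub_one _ _ hZ,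
      add_sub_cancel_right, sub_add_cancel]
    simp only [radialSol, add_assoc μ 1 1, one_add_one_eq_two]
    have recurrence := besselEntire_recurrence hμ (s * Z ^ 2)
    generalize Z ^ (d / 2 + μ) = P
    field_simp at recurrence ⊢
    linear_combination (P * s * Z ^ 2) * recurrence

end RadialSolution

section RadialSolutionBoundary

variable {μ r : ℝ}

theorem tendsto_rpow_nhdsGT_zero (hr : 0 < r) : Tendsto (fun Z : ℝ => Z ^ r) (𝓝[>] 0) (𝓝 0) := by
  have h := (Real.continuousAt_rpow_const 0 r (Or.inr hr.le)).tendsto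
  rw [Real.zero_rpow hr.ne'] at h
  exact h.mono_left nhdsWithin_le_nhds

theorem tendsto_mul_sq_nhdsGT_zero (s : ℝ) : Tendsto (fun Z : ℝ => s * Z ^ 2) (𝓝[>] 0) (𝓝 0) := by
  have : Continuous fun Z : ℝ => s * Z ^ 2 := by fun_prop
  simpa using (this.tendsto 0).mono_left nhdsWithin_le_nhds

variable (β : ℝ) (hμ : -1 < μ) (s : ℝ)
include hμ

theorem tendsto_rpow_neg_mul_radialSol :
    Tendsto (fun Z : ℝ => Z ^ (-β) * radialSol β μ s Z) (𝓝[>] 0) (𝓝 (besselEntire μ 0)) := by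
  have h := ((contDiff_besselEntire hμ).continuous.tendsto 0).comp (tendsto_mul_sq_nhdsGT_zero s)
  refine h.congr' ?_
  filter_upwards [self_mem_nhdsWithin] with Z hZ
  rw [radialSol, ← mul_assoc, ← Real.rpow_add hZ, neg_add_cancel, Real.rpow_zero, one_mul,
    Function.comp_apply]

theorem tendsto_rpow_mul_radialSol_zero (hr : 0 < r + β) :
    Tendsto (fun Z : ℝ => Z ^ r * radialSol β μ s Z) (𝓝[>] 0) (𝓝 0) := by
  have h := (tendsto_rpow_nhdsGT_zero hr).mul (tendsto_rpow_neg_mul_radialSol β hμ s)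
  rw [zero_mul] at h
  refine h.congr' ?_
  filter_upwards [self_mem_nhdsWithin] with Z hZ
  rw [← mul_assoc, ← Real.rpow_add hZ, add_neg_cancel_right]

theorem tendsto_rpow_mul_radialSol_sub (hr : 0 < r + β + 2) :
    Tendsto (fun Z : ℝ => Z ^ r * (radialSol β μ s Z - besselEntire μ 0 * Z ^ β)) (𝓝[>] 0)
      (𝓝 0) := by
  have hslope : ContinuousAt (dslope (besselEntire μ) 0) 0 :=
    continuousAt_dslope_same.2 (hasDerivAt_besselEntire hμ 0).differentiableAt
  have h := ((tendsto_rpow_nhdsGT_zero hr).mul_const s).mul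
    (hslope.tendsto.comp (tendsto_mul_sq_nhdsGT_zero s))
  rw [zero_mul, zero_mul] at h
  refine h.congr' ?_
  filter_upwards [self_mem_nhdsWithin] with Z hZ
  have slope_eq := sub_smul_dslope (besselEntire μ) 0 (s * Z ^ 2)
  rw [sub_zero, smul_eq_mul] at slope_eq
  rw [radialSol, Real.rpow_add hZ, Real.rpow_add hZ, Real.rpow_two, Function.comp_apply]
  linear_combination Z ^ r * Z ^ β * slope_eq

end RadialSolutionBoundary

section RobinProfile

variable (n : ℕ) {ν : ℝ}

theorem Gamma_one_add_pos (hν : ν ∈ Ioo (0 : ℝ) 1) : 0 < Real.Gamma (1 + ν) :=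
  Real.Gamma_pos_of_pos (by linarith [hν.1])

theorem Gamma_one_sub_pos (hν : ν ∈ Ioo (0 : ℝ) 1) : 0 < Real.Gamma (1 - ν) :=
  Real.Gamma_pos_of_pos (by linarith [hν.2])

theorem robinProfile_eq_radialSol (ν γ s : ℝ) {Z : ℝ} (hZ : 0 < Z) :
    robinProfile n ν γ Z s
      = Real.cos γ * Real.Gamma (1 + ν) * radialSol (((n : ℝ) + 1) / 2 + ν) ν s Z
        + Real.sin γ * Real.Gamma (1 - ν) * radialSol (((n : ℝ) + 1) / 2 + -ν) (-ν) s Z := by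
  unfold robinProfile radialSol
  rw [Real.div_rpow hZ.le zero_le_two, Real.div_rpow hZ.le zero_le_two, Real.rpow_add hZ,
    Real.rpow_add hZ]
  have : (2 : ℝ) ^ ν ≠ 0 := by positivity
  have : (2 : ℝ) ^ (-ν) ≠ 0 := by positivity
  field_simp

theorem isRadialSolution_robinProfile (hν : ν ∈ Ioo (0 : ℝ) 1) (γ s : ℝ) :
    IsRadialSolution (n + 1) ν s fun Z => robinProfile n ν γ Z s := by
  have plus := isRadialSolution_radialSol (n + 1) (by linarith [hν.1] : -1 < ν) s
  have minus := isRadialSolution_radialSol (n + 1) (by linarith [hν.2] : -1 < -ν) s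
  have minus' : IsRadialSolution (n + 1) ν s (radialSol (((n : ℝ) + 1) / 2 + -ν) (-ν) s) :=
    ⟨minus.contDiffOn, by simpa only [neg_sq] using minus.equation⟩
  exact ((plus.const_mul _).add (minus'.const_mul _)).congr fun Z hZ =>
    robinProfile_eq_radialSol n ν γ s hZ

theorem hasBoundaryExpansion_robinProfile (hν : ν ∈ Ioo (0 : ℝ) 1) (γ s : ℝ) :
    HasBoundaryExpansion (n + 1) ν (Real.sin γ) (Real.cos γ) fun Z => robinProfile n ν γ Z s := by
  obtain ⟨hν0, hν1⟩ := hν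
  set d : ℝ := (n : ℝ) + 1
  have profile_eq : ∀ Z : ℝ, 0 < Z → robinProfile n ν γ Z s
      = Real.cos γ * Real.Gamma (1 + ν) * radialSol (d / 2 + ν) ν s Z
        + Real.sin γ * Real.Gamma (1 - ν) * radialSol (d / 2 + -ν) (-ν) s Z :=
    fun Z => robinProfile_eq_radialSol n ν γ s
  have hplus : -1 < ν := by linarith
  have hminus : -1 < -ν := by linarith
  have leading_value : Real.sin γ * Real.Gamma (1 - ν) * besselEntire (-ν) 0 = Real.sin γ := by
    rw [besselEntire_zero, ← sub_eq_add_neg,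
      mul_inv_cancel_right₀ (Gamma_one_sub_pos ⟨hν0, hν1⟩).ne']
  have subleading_value : Real.cos γ * Real.Gamma (1 + ν) * besselEntire ν 0 = Real.cos γ := by
    rw [besselEntire_zero, mul_inv_cancel_right₀ (Gamma_one_add_pos ⟨hν0, hν1⟩).ne']
  constructor
  · have h := ((tendsto_rpow_mul_radialSol_zero (r := -(d / 2 + -ν)) (d / 2 + ν) hplus s
      (by linarith)).const_mul (Real.cos γ * Real.Gamma (1 + ν))).add
      ((tendsto_rpow_neg_mul_radialSol (d / 2 + -ν) hminus s).const_mul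
        (Real.sin γ * Real.Gamma (1 - ν)))
    rw [mul_zero, zero_add, leading_value] at h
    refine h.congr' ?_
    filter_upwards [self_mem_nhdsWithin] with Z hZ
    rw [profile_eq Z hZ, sub_eq_add_neg (d / 2)]
    ring
  · have h := ((tendsto_rpow_neg_mul_radialSol (d / 2 + ν) hplus s).const_mul
      (Real.cos γ * Real.Gamma (1 + ν))).add
      ((tendsto_rpow_mul_radialSol_sub (r := -(d / 2 + ν)) (d / 2 + -ν) hminus s
        (by linarith)).const_mul (Real.sin γ * Real.Gamma (1 - ν)))
    rw [mul_zero, add_zero, subleading_value] at h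
    refine h.congr' ?_
    filter_upwards [self_mem_nhdsWithin] with Z hZ
    rw [profile_eq Z hZ, sub_eq_add_neg (d / 2)]
    linear_combination (-(Z ^ (-(d / 2 + ν)) * Z ^ (d / 2 + -ν))) * leading_value

theorem exists_radialSol_bound (β : ℝ) {μ : ℝ} (hμ : -1 < μ) {a b : ℝ} (ha : 0 < a) :
    ∃ C : ℝ, 0 ≤ C ∧ ∀ Z ∈ Icc a b, ∀ s : ℝ, 0 ≤ s → |radialSol β μ s Z| ≤ C * (1 + s) := by
  obtain ⟨C, hC, bessel_le⟩ := exists_besselEntire_bound hμ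
  have rpow_continuousOn : ContinuousOn (fun Z : ℝ => Z ^ β) (Icc a b) :=
    continuousOn_id.rpow_const fun Z hZ => Or.inl (ha.trans_le hZ.1).ne'
  obtain ⟨K, rpow_le⟩ := isCompact_Icc.exists_bound_of_continuousOn rpow_continuousOn
  refine ⟨|K| * C * (1 + b ^ 2), by positivity, fun Z hZ s hs => ?_⟩
  have Z_sq_le : Z ^ 2 ≤ b ^ 2 := pow_le_pow_left₀ (ha.trans_le hZ.1).le hZ.2 2
  calc |radialSol β μ s Z| = ‖Z ^ β‖ * |besselEntire μ (s * Z ^ 2)| := abs_mul _ _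
    _ ≤ |K| * (C * (1 + s * Z ^ 2)) := mul_le_mul ((rpow_le Z hZ).trans (le_abs_self K))
        (bessel_le _ (by positivity)) (abs_nonneg _) (abs_nonneg _)
    _ ≤ |K| * (C * ((1 + b ^ 2) * (1 + s))) := by
        gcongr
        nlinarith [mul_le_mul_of_nonneg_left Z_sq_le hs, sq_nonneg b]
    _ = |K| * C * (1 + b ^ 2) * (1 + s) := by ring

theorem exists_robinProfile_bound (hν : ν ∈ Ioo (0 : ℝ) 1) (γ : ℝ) {a b : ℝ} (ha : 0 < a) :
    ∃ C : ℝ, 0 ≤ C ∧ ∀ Z ∈ Icc a b, ∀ s : ℝ, 0 ≤ s → |robinProfile n ν γ Z s| ≤ C * (1 + s) := by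
  obtain ⟨Cp, hCp, plus_le⟩ :=
    exists_radialSol_bound (((n : ℝ) + 1) / 2 + ν) (by linarith [hν.1] : -1 < ν) (b := b) ha
  obtain ⟨Cm, hCm, minus_le⟩ :=
    exists_radialSol_bound (((n : ℝ) + 1) / 2 + -ν) (by linarith [hν.2] : -1 < -ν) (b := b) ha
  refine ⟨|Real.cos γ * Real.Gamma (1 + ν)| * Cp + |Real.sin γ * Real.Gamma (1 - ν)| * Cm,
    by positivity, fun Z hZ s hs => ?_⟩
  rw [robinProfile_eq_radialSol n ν γ s (ha.trans_le hZ.1)]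
  refine (abs_add_le _ _).trans ?_
  rw [abs_mul _ (radialSol _ _ _ _), abs_mul _ (radialSol _ _ _ _), add_mul, mul_assoc, mul_assoc]
  gcongr
  exacts [plus_le Z hZ s hs, minus_le Z hZ s hs]

theorem measurable_robinProfile (hν : ν ∈ Ioo (0 : ℝ) 1) (γ : ℝ) :
    Measurable fun y : ℝ × ℝ => robinProfile n ν γ y.1 y.2 := by
  have := (contDiff_besselEntire (by linarith [hν.1] : -1 < ν)).continuous.measurable
  have := (contDiff_besselEntire (by linarith [hν.2] : -1 < -ν)).continuous.measurable
  unfold robinProfile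
  fun_prop

theorem contDiff_robinProfile (hν : ν ∈ Ioo (0 : ℝ) 1) (γ Z : ℝ) :
    ContDiff ℝ ∞ (robinProfile n ν γ Z) := by
  have := contDiff_besselEntire (by linarith [hν.1] : -1 < ν)
  have := contDiff_besselEntire (by linarith [hν.2] : -1 < -ν)
  unfold robinProfile
  fun_prop

end RobinProfile

section RobinMode

/-- The identification of the boundary condition: `a = f A_ν` is the double-trace coupling, and the
two equations are `cot α = -a` and `cot γ = -2 ^ (-2 ν) Γ(1 - ν) / Γ(1 + ν) cot α` with the
denominators cleared. -/
structure RobinAngles (ν a α γ : ℝ) : Prop where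
  sin_α_pos : 0 < Real.sin α
  sin_γ_pos : 0 < Real.sin γ
  cos_α_eq : Real.cos α = -(a * Real.sin α)
  cos_γ_eq : Real.cos γ * (2 ^ ν * Real.Gamma (1 + ν))
    = a * (Real.sin γ * 2 ^ (-ν) * Real.Gamma (1 - ν))

theorem RobinAngles.of_cot {ν a α γ : ℝ} (hν : ν ∈ Ioo (0 : ℝ) 1) (hα : α ∈ Ioo 0 π)
    (hγ : γ ∈ Ioo 0 π) (hcα : Real.cot α = -a)
    (hcγ : Real.cot γ =
      -(2 ^ (-(2 * ν)) * Real.Gamma (1 - ν) / Real.Gamma (1 + ν) * Real.cot α)) :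
    RobinAngles ν a α γ := by
  have sin_α_pos := Real.sin_pos_of_mem_Ioo hα
  have sin_γ_pos := Real.sin_pos_of_mem_Ioo hγ
  rw [hcα, Real.cot_eq_cos_div_sin, div_eq_iff sin_γ_pos.ne'] at hcγ
  rw [Real.cot_eq_cos_div_sin, div_eq_iff sin_α_pos.ne', neg_mul] at hcα
  refine ⟨sin_α_pos, sin_γ_pos, hcα, ?_⟩
  have two_rpow : (2 : ℝ) ^ (-(2 * ν)) * 2 ^ ν = 2 ^ (-ν) := by
    rw [← Real.rpow_add two_pos]
    ring_nf
  have := (Gamma_one_add_pos hν).ne'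
  rw [hcγ, ← two_rpow]
  field_simp

variable {n : ℕ} {ν a α γ q Z : ℝ}

theorem robinMode_eq_of_cos (n : ℕ) (ν Z : ℝ) (hsin : 0 < Real.sin α)
    (hcos : Real.cos α = -(a * Real.sin α)) :
    robinMode n ν α q Z = -(Z ^ ((n : ℝ) / 2) * √(q * Z) *
      (a * besselJ ν (q * Z) + q ^ (2 * ν) * besselJ (-ν) (q * Z)) /
        √(q ^ (4 * ν) + a * (2 * Real.cos (π * ν)) * q ^ (2 * ν) + a ^ 2)) := by
  have denom_eq : Real.cos α ^ 2 - 2 * Real.sin α * Real.cos α * Real.cos (π * ν) * q ^ (2 * ν)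
      + Real.sin α ^ 2 * q ^ (4 * ν) = Real.sin α ^ 2 *
        (q ^ (4 * ν) + a * (2 * Real.cos (π * ν)) * q ^ (2 * ν) + a ^ 2) := by
    rw [hcos]
    ring
  have num_eq : Real.cos α * besselJ ν (q * Z) - Real.sin α * q ^ (2 * ν) * besselJ (-ν) (q * Z)
      = Real.sin α * -(a * besselJ ν (q * Z) + q ^ (2 * ν) * besselJ (-ν) (q * Z)) := by
    rw [hcos]
    ring
  rw [robinMode, denom_eq, num_eq, Real.sqrt_mul (sq_nonneg _), Real.sqrt_sq hsin.le,
    mul_left_comm, mul_div_mul_left _ _ hsin.ne', mul_neg, neg_div]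

theorem robinProfile_eq_of_cos (n : ℕ)
    (hcos : Real.cos γ * (2 ^ ν * Real.Gamma (1 + ν))
      = a * (Real.sin γ * 2 ^ (-ν) * Real.Gamma (1 - ν))) (hq : 0 < q) (hZ : 0 < Z) :
    robinProfile n ν γ Z (q ^ 2) = Real.sin γ * 2 ^ (-ν) * Real.Gamma (1 - ν) *
      (Z ^ ((n : ℝ) / 2) * √Z * (q ^ ν)⁻¹ *
        (a * besselJ ν (q * Z) + q ^ (2 * ν) * besselJ (-ν) (q * Z))) := by
  have q_rpow_neg : (q ^ 2) ^ (-ν / 2) = (q ^ ν)⁻¹ := by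
    rw [← Real.rpow_two, ← Real.rpow_mul hq.le, ← Real.rpow_neg hq.le]
    ring_nf
  have q_rpow : (q ^ 2) ^ (ν / 2) = (q ^ ν)⁻¹ * q ^ (2 * ν) := by
    rw [← Real.rpow_two, ← Real.rpow_mul hq.le, ← Real.rpow_neg hq.le, ← Real.rpow_add hq]
    ring_nf
  have Z_rpow : Z ^ (((n : ℝ) + 1) / 2) = Z ^ ((n : ℝ) / 2) * √Z := by
    rw [Real.sqrt_eq_rpow, ← Real.rpow_add hZ]
    ring_nf
  rw [robinProfile_eq n ν γ hZ (by positivity), Real.sqrt_sq hq.le, q_rpow_neg, q_rpow, Z_rpow]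
  linear_combination ((q ^ ν)⁻¹ * (Z ^ ((n : ℝ) / 2) * √Z * besselJ ν (q * Z))) * hcos

/-- The factor by which the normalized mode of radial momentum `q` differs from the Robin profile;
see `robinMode_eq_modeCoeff_mul`. -/
noncomputable def modeCoeff (ν a γ q : ℝ) : ℝ :=
  -(√(q * spectralDensity ν a (q ^ 2) / Real.sin (π * ν))
    / (Real.sin γ * 2 ^ (-ν) * Real.Gamma (1 - ν)))

theorem sqrt_mul_spectralDensity_sq (hν : ν ∈ Ioo (0 : ℝ) 1) (a : ℝ) (hq : 0 < q) :
    √(q * spectralDensity ν a (q ^ 2) / Real.sin (π * ν))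
      = √q * q ^ ν / √(q ^ (4 * ν) + a * (2 * Real.cos (π * ν)) * q ^ (2 * ν) + a ^ 2) := by
  have q_rpow : (q ^ 2) ^ ν = q ^ (2 * ν) := by
    rw [← Real.rpow_two, ← Real.rpow_mul hq.le]
  have q_rpow_two : (q ^ 2) ^ (2 * ν) = q ^ (4 * ν) := by
    rw [← Real.rpow_two, ← Real.rpow_mul hq.le]
    ring_nf
  have q_rpow_sq : q ^ (2 * ν) = (q ^ ν) ^ 2 := by
    rw [← Real.rpow_two, ← Real.rpow_mul hq.le, mul_comm]
  rw [spectralDensity, q_rpow, q_rpow_two, mul_left_comm, mul_div_cancel_left₀ _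
    (sin_pi_mul_pos hν).ne', ← mul_div_assoc, Real.sqrt_div (by positivity), Real.sqrt_mul hq.le]
  nth_rewrite 1 [q_rpow_sq]
  rw [Real.sqrt_sq (by positivity)]

theorem modeCoeff_neg (hν : ν ∈ Ioo (0 : ℝ) 1) (a : ℝ) (hγ : 0 < Real.sin γ) (hq : 0 < q) :
    modeCoeff ν a γ q < 0 := by
  have := sin_pi_mul_pos hν
  have := spectralDensity_pos hν a (s := q ^ 2) (by positivity)
  have := Gamma_one_sub_pos hν
  unfold modeCoeff
  rw [neg_lt_zero]
  positivity

theorem robinMode_eq_modeCoeff_mul (n : ℕ) (hν : ν ∈ Ioo (0 : ℝ) 1) (h : RobinAngles ν a α γ)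
    (hq : 0 < q) (hZ : 0 < Z) :
    robinMode n ν α q Z = modeCoeff ν a γ q * robinProfile n ν γ Z (q ^ 2) := by
  have := h.sin_γ_pos
  have := Gamma_one_sub_pos hν
  rw [robinMode_eq_of_cos n ν Z h.sin_α_pos h.cos_α_eq, robinProfile_eq_of_cos n h.cos_γ_eq hq hZ,
    modeCoeff, sqrt_mul_spectralDensity_sq hν a hq, Real.sqrt_mul hq.le]
  field_simp

theorem isRadialSolution_robinMode (n : ℕ) (hν : ν ∈ Ioo (0 : ℝ) 1) (h : RobinAngles ν a α γ)
    (hq : 0 < q) : IsRadialSolution (n + 1) ν (q ^ 2) (robinMode n ν α q) :=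
  ((isRadialSolution_robinProfile n hν γ (q ^ 2)).const_mul (modeCoeff ν a γ q)).congr
    fun _ hZ => robinMode_eq_modeCoeff_mul n hν h hq hZ

theorem hasBoundaryExpansion_robinMode (n : ℕ) (hν : ν ∈ Ioo (0 : ℝ) 1) (h : RobinAngles ν a α γ)
    (hq : 0 < q) :
    HasBoundaryExpansion (n + 1) ν (Real.sin γ * modeCoeff ν a γ q)
      (Real.cos γ * modeCoeff ν a γ q) (robinMode n ν α q) :=
  ((hasBoundaryExpansion_robinProfile n hν γ (q ^ 2)).mul_const (modeCoeff ν a γ q)).congr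
    fun _ hZ => (robinMode_eq_modeCoeff_mul n hν h hq hZ).trans (mul_comm _ _)

end RobinMode

/-! ### Map to the bulk -/

section BulkPlaneWave

variable {n : ℕ} {ν γ : ℝ}

/-- The `p`-component of the bulk Wightman function at a pair of bulk points: a boundary plane wave
dressed with the Robin profile of either point, with the factor `(2π)^{-d}` included. -/
noncomputable def bulkPlaneWave (ν γ : ℝ) (X : Bulk n × Bulk n) (p : Mink n) : ℂ :=
  Complex.exp (Complex.I * (minkProd p (X.1.1 - X.2.1) : ℂ)) *
    ((robinProfile n ν γ X.1.2 (negSq p) * robinProfile n ν γ X.2.2 (negSq p) : ℝ) : ℂ)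
    / (2 * π) ^ (n + 1)

theorem measurable_bulkPlaneWave (hν : ν ∈ Ioo (0 : ℝ) 1) (γ : ℝ) :
    Measurable fun y : (Bulk n × Bulk n) × Mink n => bulkPlaneWave ν γ y.1 y.2 := by
  have profile_measurable := measurable_robinProfile n hν γ
  have negSq_measurable : Measurable fun y : (Bulk n × Bulk n) × Mink n => negSq y.2 :=
    continuous_negSq.measurable.comp measurable_snd
  have phase_continuous : Continuous fun y : (Bulk n × Bulk n) × Mink n =>
      minkProd y.2 (y.1.1.1 - y.1.2.1) :=
    continuous_minkProd.comp (by fun_prop :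
      Continuous fun y : (Bulk n × Bulk n) × Mink n => (y.2, y.1.1.1 - y.1.2.1))
  refine ((Continuous.measurable (by fun_prop)).mul
    (Complex.measurable_ofReal.comp (Measurable.mul ?_ ?_))).div_const _
  · exact profile_measurable.comp ((by fun_prop : Measurable
      fun y : (Bulk n × Bulk n) × Mink n => y.1.1.2).prodMk negSq_measurable)
  · exact profile_measurable.comp ((by fun_prop : Measurable
      fun y : (Bulk n × Bulk n) × Mink n => y.1.2.2).prodMk negSq_measurable)

theorem one_add_negSq_le {p : Mink n} (hp : 0 ≤ p.1) : 1 + negSq p ≤ (1 + p.1) ^ 2 := by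
  unfold negSq
  nlinarith [sq_nonneg ‖p.2‖]

theorem norm_bulkPlaneWave_le (ν γ : ℝ) (X : Bulk n × Bulk n) (p : Mink n) :
    ‖bulkPlaneWave ν γ X p‖
      ≤ |robinProfile n ν γ X.1.2 (negSq p)| * |robinProfile n ν γ X.2.2 (negSq p)| := by
  rw [bulkPlaneWave, norm_div, norm_mul, norm_exp_I_mul_ofReal, one_mul, Complex.norm_real,
    Real.norm_eq_abs, abs_mul, norm_two_pi_pow]
  exact div_le_self (by positivity) (one_le_two_pi_pow _)

theorem exists_bulkPlaneWave_bound (hν : ν ∈ Ioo (0 : ℝ) 1) (γ : ℝ) {a b : ℝ} (ha : 0 < a) :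
    ∃ C, 0 ≤ C ∧ ∀ X : Bulk n × Bulk n, X.1.2 ∈ Icc a b → X.2.2 ∈ Icc a b →
      ∀ p ∈ futureCone n, ‖bulkPlaneWave ν γ X p‖ ≤ C * (1 + p.1) ^ 4 := by
  obtain ⟨C, hC, profile_le⟩ := exists_robinProfile_bound n hν γ (b := b) ha
  refine ⟨C ^ 2, sq_nonneg C, fun X h₁ h₂ p hp => ?_⟩
  have hs := (negSq_pos hp).le
  have hp₀ : 0 ≤ p.1 := (norm_nonneg _).trans (le_of_lt hp)
  calc ‖bulkPlaneWave ν γ X p‖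
      ≤ |robinProfile n ν γ X.1.2 (negSq p)| * |robinProfile n ν γ X.2.2 (negSq p)| :=
        norm_bulkPlaneWave_le ν γ X p
    _ ≤ (C * (1 + negSq p)) * (C * (1 + negSq p)) :=
        mul_le_mul (profile_le _ h₁ _ hs) (profile_le _ h₂ _ hs) (abs_nonneg _) (by positivity)
    _ ≤ (C * (1 + p.1) ^ 2) * (C * (1 + p.1) ^ 2) := by
        have := one_add_negSq_le hp₀
        gcongr
    _ = C ^ 2 * (1 + p.1) ^ 4 := by ring

theorem integrable_exp_neg_smul_bulkPlaneWave (hn : 1 ≤ n) (hν : ν ∈ Ioo (0 : ℝ) 1) (f γ : ℝ)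
    {ε : ℝ} (hε : 0 < ε) {X : Bulk n × Bulk n} (h₁ : 0 < X.1.2) (h₂ : 0 < X.2.2) :
    Integrable (fun p => Real.exp (-(ε * p.1)) • bulkPlaneWave ν γ X p)
      (wightmanMeasure n ν f) := by
  obtain ⟨C, hC, hb⟩ := exists_bulkPlaneWave_bound (n := n) hν γ (b := max X.1.2 X.2.2)
    (lt_min h₁ h₂)
  have wave_measurable := (measurable_bulkPlaneWave hν γ).comp (measurable_prodMk_left (x := X))
  have damping_measurable : Measurable fun p : Mink n => Real.exp (-(ε * p.1)) := by fun_prop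
  refine integrable_wightmanMeasure_of_le_exp hn hν f
    (damping_measurable.smul wave_measurable).aestronglyMeasurable hε 4 hC fun p hp => ?_
  rw [norm_smul, Real.norm_of_nonneg (Real.exp_pos _).le, mul_comm]
  gcongr
  exact hb X ⟨min_le_left _ _, le_max_left _ _⟩ ⟨min_le_right _ _, le_max_right _ _⟩ p hp

end BulkPlaneWave

section BulkWightman

/-- The ratio of the image of the boundary Wightman function under the Robin kernels to the bulk
Wightman function. -/
noncomputable def mappingConst (n : ℕ) (ν γ : ℝ) : ℝ :=
  2 * π ^ (((n : ℝ) + 1) / 2) * Real.Gamma (1 - ν)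
    / Real.Gamma (((n : ℝ) + 1) / 2 - ν) * Real.sin γ ^ 2

variable {n : ℕ} (hn : 1 ≤ n) {ν : ℝ} (hν : ν ∈ Ioo (0 : ℝ) 1)
include hν

theorem mappingConst_mul_pi (n : ℕ) (γ : ℝ) :
    mappingConst n ν γ * π = 2 * Aconst n ν * Real.sin (π * ν) *
      (Real.sin γ * 2 ^ (-ν) * Real.Gamma (1 - ν)) ^ 2 := by
  have reflection : Real.Gamma ν * Real.Gamma (1 - ν) * Real.sin (π * ν) = π := by
    rw [Real.Gamma_mul_Gamma_one_sub, div_mul_cancel₀ _ (sin_pi_mul_pos hν).ne']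
  have two_rpow : (2 : ℝ) ^ (2 * ν) * (2 ^ (-ν)) ^ 2 = 1 := by
    rw [← Real.rpow_mul_natCast zero_le_two, ← Real.rpow_add two_pos, Nat.cast_ofNat,
      neg_mul, mul_comm ν, add_neg_cancel, Real.rpow_zero]
  rw [mappingConst, Aconst]
  set Γ := Real.Gamma (((n : ℝ) + 1) / 2 - ν)
  linear_combination (-(2 * π ^ (((n : ℝ) + 1) / 2) * Real.Gamma (1 - ν) * Real.sin γ ^ 2 / Γ))
    * ((2 ^ (2 * ν) * (2 ^ (-ν)) ^ 2) * reflection + π * two_rpow)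

theorem two_mul_Aconst_mul_spectralDensity (n : ℕ) (a : ℝ) {γ : ℝ} (hγ : 0 < Real.sin γ) {q : ℝ}
    (hq : 0 < q) :
    2 * Aconst n ν * spectralDensity ν a (q ^ 2) * q
      = mappingConst n ν γ * π * modeCoeff ν a γ q ^ 2 := by
  have hsin := sin_pi_mul_pos hν
  have := Gamma_one_sub_pos hν
  have := spectralDensity_pos hν a (s := q ^ 2) (by positivity)
  rw [mappingConst_mul_pi hν, modeCoeff, neg_sq, div_pow, Real.sq_sqrt (by positivity)]
  field_simp

variable {f α γ : ℝ}

theorem shellDensity_mul_robinProfile_mul (h : RobinAngles ν (f * Aconst n ν) α γ) {Z₁ Z₂ : ℝ}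
    (h₁ : 0 < Z₁) (h₂ : 0 < Z₂) {y : EuclideanSpace ℝ (Fin n) × ℝ} (hy : 0 < y.2) :
    shellDensity n ν f y * (robinProfile n ν γ Z₁ (y.2 ^ 2) * robinProfile n ν γ Z₂ (y.2 ^ 2))
      = mappingConst n ν γ * (2 * π) *
        (robinMode n ν α y.2 Z₁ * robinMode n ν α y.2 Z₂ / (2 * energy y.1 y.2)) := by
  have : energy y.1 y.2 ≠ 0 := (energy_pos y.1 hy).ne'
  have normalization :=
    two_mul_Aconst_mul_spectralDensity hν n (f * Aconst n ν) h.sin_γ_pos hy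
  rw [robinMode_eq_modeCoeff_mul n hν h hy h₁, robinMode_eq_modeCoeff_mul n hν h hy h₂,
    shellDensity]
  generalize spectralDensity ν (f * Aconst n ν) (y.2 ^ 2) = ρ at normalization ⊢
  generalize modeCoeff ν (f * Aconst n ν) γ y.2 = c at normalization ⊢
  field_simp
  linear_combination (robinProfile n ν γ Z₁ (y.2 ^ 2) * robinProfile n ν γ Z₂ (y.2 ^ 2)) *
    normalization

theorem shellDensity_smul_bulkPlaneWave (h : RobinAngles ν (f * Aconst n ν) α γ) (ε : ℝ)
    {X : Bulk n × Bulk n} (h₁ : 0 < X.1.2) (h₂ : 0 < X.2.2)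
    {y : EuclideanSpace ℝ (Fin n) × ℝ} (hy : 0 < y.2) :
    shellDensity n ν f y • Real.exp (-(ε * (shell y).1)) • bulkPlaneWave ν γ X (shell y)
      = (mappingConst n ν γ : ℂ) * bulkIntegrand n ν α ε X.1 X.2 y := by
  have amplitude := congrArg Complex.ofReal (shellDensity_mul_robinProfile_mul hν h h₁ h₂ hy)
  have phase := wightmanPhase_sub_I_mul ε (X.1.1 - X.2.1) (shell y)
  have : (π : ℂ) ≠ 0 := Complex.ofReal_ne_zero.2 pi_ne_zero
  have hintegrand : bulkIntegrand n ν α ε X.1 X.2 y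
      = wightmanPhase (((X.1.1 - X.2.1).1 : ℂ) - Complex.I * ε) (X.1.1 - X.2.1).2 (shell y) *
        (2 * π * ((robinMode n ν α y.2 X.1.2 * robinMode n ν α y.2 X.2.2 /
          (2 * energy y.1 y.2) : ℝ) : ℂ)) := by
    rw [bulkIntegrand, wightmanPhase]
    simp only [shell, Prod.fst_sub, Prod.snd_sub, pow_succ]
    field_simp
  have hnegSq : negSq (shell y) = y.2 ^ 2 := negSq_energy y.1 y.2
  rw [hintegrand, phase, bulkPlaneWave, hnegSq, Complex.real_smul, Complex.real_smul]
  rw [Complex.ofReal_mul, Complex.ofReal_mul (mappingConst n ν γ * (2 * π))] at amplitude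
  push_cast at amplitude ⊢
  linear_combination (Complex.exp (-(ε * (shell y).1)) *
    Complex.exp (Complex.I * (minkProd (shell y) (X.1.1 - X.2.1) : ℂ)) / (2 * π) ^ (n + 1)) *
    amplitude

include hn

theorem mappingConst_pos (hγ : 0 < Real.sin γ) : 0 < mappingConst n ν γ := by
  have hn' : (1 : ℝ) ≤ n := by exact_mod_cast hn
  have := Gamma_one_sub_pos hν
  have : 0 < Real.Gamma (((n : ℝ) + 1) / 2 - ν) := Real.Gamma_pos_of_pos (by linarith [hν.2])
  unfold mappingConst
  positivity

theorem integrableOn_bulkIntegrand (h : RobinAngles ν (f * Aconst n ν) α γ) {ε : ℝ} (hε : 0 < ε)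
    {X : Bulk n × Bulk n} (h₁ : 0 < X.1.2) (h₂ : 0 < X.2.2) :
    IntegrableOn (bulkIntegrand n ν α ε X.1 X.2) (shellDomain n) := by
  have hc : (mappingConst n ν γ : ℂ) ≠ 0 :=
    Complex.ofReal_ne_zero.2 (mappingConst_pos hn hν h.sin_γ_pos).ne'
  have hwave := integrable_exp_neg_smul_bulkPlaneWave hn hν f γ hε h₁ h₂
  rw [← map_shell_shellMeasure] at hwave
  have hshell := (integrable_shellMeasure_iff hn hν f).1
    (hwave.comp_aemeasurable continuous_shell.aemeasurable)
  exact (integrable_const_mul_iff (isUnit_iff_ne_zero.2 hc) _).1 <| hshell.congr_fun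
    (fun y hy => shellDensity_smul_bulkPlaneWave hν h ε h₁ h₂ hy.2) measurableSet_shellDomain

theorem mappingConst_mul_bulkWightman (h : RobinAngles ν (f * Aconst n ν) α γ) {ε : ℝ} (hε : 0 < ε)
    {X : Bulk n × Bulk n} (h₁ : 0 < X.1.2) (h₂ : 0 < X.2.2) :
    (mappingConst n ν γ : ℂ) * bulkWightman n ν α ε X.1 X.2
      = ∫ p, Real.exp (-(ε * p.1)) • bulkPlaneWave ν γ X p ∂wightmanMeasure n ν f := by
  have hwave := integrable_exp_neg_smul_bulkPlaneWave hn hν f γ hε h₁ h₂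
  rw [← map_shell_shellMeasure] at hwave ⊢
  rw [integral_map continuous_shell.aemeasurable hwave.aestronglyMeasurable,
    integral_shellMeasure hn hν, setIntegral_congr_fun measurableSet_shellDomain fun y hy =>
      shellDensity_smul_bulkPlaneWave hν h ε h₁ h₂ hy.2, integral_const_mul]
  rfl

end BulkWightman

section RobinKernel

variable {n : ℕ}

theorem minkProd_sub_right (p x y : Mink n) :
    minkProd p (x - y) = minkProd p x - minkProd p y := by
  simp only [minkProd, Prod.fst_sub, Prod.snd_sub, inner_sub_right]
  ring

theorem minkProd_neg_left (p x : Mink n) : minkProd (-p) x = -minkProd p x := by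
  simp only [minkProd, Prod.fst_neg, Prod.snd_neg, inner_neg_left]
  ring

theorem exp_I_mul_minkProd_sub (p x y : Mink n) :
    Complex.exp (Complex.I * (minkProd p (x - y) : ℂ))
      = Complex.exp (Complex.I * (minkProd p x : ℂ)) *
        Complex.exp (Complex.I * (minkProd (-p) y : ℂ)) := by
  rw [← Complex.exp_add, minkProd_sub_right, minkProd_neg_left]
  push_cast
  ring_nf

theorem negSq_neg (p : Mink n) : negSq (-p) = negSq p := by
  simp only [negSq, Prod.fst_neg, Prod.snd_neg, neg_sq, norm_neg]

/-- The momentum-space Robin kernel of the bulk point `X`, regulated by the cutoff `χ` at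
scale `Λ`. -/
noncomputable def robinSymbol (ν γ : ℝ) (χ : Mink n → ℝ) (Λ : ℝ) (X : Bulk n) (p : Mink n) : ℂ :=
  Complex.exp (Complex.I * (minkProd p X.1 : ℂ)) *
    ((χ (Λ⁻¹ • p) * robinProfile n ν γ X.2 (negSq p) : ℝ) : ℂ)

variable {ν : ℝ} {χ : Mink n → ℝ}

theorem contDiff_robinSymbol (hν : ν ∈ Ioo (0 : ℝ) 1) (γ : ℝ) (hχ : IsCutoff χ) (Λ : ℝ)
    (X : Bulk n) : ContDiff ℝ ∞ (robinSymbol ν γ χ Λ X) := by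
  have phase : ContDiff ℝ ∞ fun p : Mink n => minkProd p X.1 := by
    unfold minkProd
    exact (contDiff_fst.mul contDiff_const).neg.add (contDiff_snd.inner ℝ contDiff_const)
  have negSq_smooth : ContDiff ℝ ∞ (negSq : Mink n → ℝ) := by
    unfold negSq
    exact (contDiff_fst.pow 2).sub (contDiff_snd.norm_sq ℝ)
  have amplitude := (hχ.smooth.comp (contDiff_const_smul Λ⁻¹)).mul
    ((contDiff_robinProfile n hν γ X.2).comp negSq_smooth)
  exact (contDiff_const.mul (Complex.ofRealCLM.contDiff.comp phase)).cexp.mul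
    (Complex.ofRealCLM.contDiff.comp amplitude)

theorem hasCompactSupport_robinSymbol (ν γ : ℝ) (hχ : IsCutoff χ) {Λ : ℝ} (hΛ : Λ ≠ 0)
    (X : Bulk n) : HasCompactSupport (robinSymbol ν γ χ Λ X) := by
  have scaled_cutoff : HasCompactSupport fun p : Mink n => χ (Λ⁻¹ • p) :=
    hχ.compact.comp_homeomorph (Homeomorph.smulOfNeZero _ (inv_ne_zero hΛ))
  refine scaled_cutoff.mono fun p hp hzero => hp ?_
  have hzero : χ (Λ⁻¹ • p) = 0 := hzero
  rw [robinSymbol, hzero, zero_mul, Complex.ofReal_zero, mul_zero]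

theorem robinKernel_eq_minkFourierInvCLM (hν : ν ∈ Ioo (0 : ℝ) 1) (γ : ℝ) (hχ : IsCutoff χ)
    {Λ : ℝ} (hΛ : Λ ≠ 0) (X : Bulk n) :
    (fun x => robinKernel ν γ χ Λ x X) = minkFourierInvCLM n
      ((hasCompactSupport_robinSymbol ν γ hχ hΛ X).toSchwartzMap
        (contDiff_robinSymbol hν γ hχ Λ X)) := by
  ext x
  rw [minkFourierInvCLM_apply, robinKernel, ← integral_div]
  congr 1
  ext p
  rw [exp_I_mul_minkProd_sub, minkProd_neg_left]
  simp only [HasCompactSupport.toSchwartzMap_toFun, robinSymbol]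
  push_cast
  ring_nf

theorem integrable_robinKernel (hν : ν ∈ Ioo (0 : ℝ) 1) (γ : ℝ) (hχ : IsCutoff χ) {Λ : ℝ}
    (hΛ : Λ ≠ 0) (X : Bulk n) : Integrable fun x => robinKernel ν γ χ Λ x X := by
  rw [robinKernel_eq_minkFourierInvCLM hν γ hχ hΛ X]
  exact SchwartzMap.integrable _

theorem minkFourier_robinKernel (hν : ν ∈ Ioo (0 : ℝ) 1) (γ : ℝ) (hχ : IsCutoff χ) {Λ : ℝ}
    (hΛ : Λ ≠ 0) (X : Bulk n) :
    minkFourier (fun x => robinKernel ν γ χ Λ x X) = robinSymbol ν γ χ Λ X := by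
  rw [robinKernel_eq_minkFourierInvCLM hν γ hχ hΛ X, minkFourier_minkFourierInvCLM]
  rfl

end RobinKernel

section MappedWightman

variable {n : ℕ}

theorem integrable_exp_minkProd_sub_mul {μ : Measure (Mink n)} {K₁ K₂ w : Mink n → ℂ}
    (h₁ : Integrable K₁) (h₂ : Integrable K₂) (hw : Integrable w μ) :
    Integrable (Function.uncurry fun (x : Mink n × Mink n) (p : Mink n) =>
      Complex.exp (Complex.I * (minkProd p (x.1 - x.2) : ℂ)) * (K₁ x.1 * K₂ x.2 * w p))
      (volume.prod μ) := by
  refine ((h₁.mul_prod h₂).mul_prod hw).bdd_mul (c := 1) (Continuous.aestronglyMeasurable ?_)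
    (.of_forall fun y => (norm_exp_I_mul_ofReal _).le)
  exact Complex.continuous_exp.comp (continuous_const.mul (Complex.continuous_ofReal.comp
    (continuous_minkProd.comp (by fun_prop :
      Continuous fun y : (Mink n × Mink n) × Mink n => (y.2, y.1.1 - y.1.2)))))

theorem integral_exp_minkProd_sub_mul (K₁ K₂ : Mink n → ℂ) (p : Mink n) :
    ∫ x : Mink n × Mink n,
      Complex.exp (Complex.I * (minkProd p (x.1 - x.2) : ℂ)) * (K₁ x.1 * K₂ x.2)
      = minkFourier K₁ p * minkFourier K₂ (-p) := by
  rw [minkFourier, minkFourier, ← integral_prod_mul, Measure.volume_eq_prod]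
  congr 1
  ext x
  rw [exp_I_mul_minkProd_sub]
  ring

variable (hn : 1 ≤ n) {ν : ℝ} (hν : ν ∈ Ioo (0 : ℝ) 1) (f : ℝ)
include hn hν

theorem mul_mul_wightmanReg_eq_integral (K₁ K₂ : Mink n → ℂ) (ε : ℝ) (x : Mink n × Mink n) :
    K₁ x.1 * K₂ x.2 * wightmanReg n ν f ε (x.1 - x.2)
      = ∫ p, Complex.exp (Complex.I * (minkProd p (x.1 - x.2) : ℂ)) * (K₁ x.1 * K₂ x.2 *
        ((Real.exp (-(ε * p.1)) : ℂ) / (2 * π) ^ (n + 1))) ∂wightmanMeasure n ν f := by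
  rw [wightmanReg_eq_integral_exp_minkProd hn hν, ← integral_const_mul]
  simp only [mul_left_comm (K₁ x.1 * K₂ x.2)]

variable {ε : ℝ} (hε : 0 < ε)
include hε

theorem integrable_mul_mul_wightmanReg {K₁ K₂ : Mink n → ℂ} (h₁ : Integrable K₁)
    (h₂ : Integrable K₂) :
    Integrable fun x : Mink n × Mink n =>
      K₁ x.1 * K₂ x.2 * wightmanReg n ν f ε (x.1 - x.2) := by
  simp only [mul_mul_wightmanReg_eq_integral hn hν]
  exact (integrable_exp_minkProd_sub_mul h₁ h₂
    (integrable_exp_neg_div_two_pi_pow hn hν f hε)).integral_prod_left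

theorem integral_mul_mul_wightmanReg {K₁ K₂ : Mink n → ℂ} (h₁ : Integrable K₁)
    (h₂ : Integrable K₂) :
    ∫ x : Mink n × Mink n, K₁ x.1 * K₂ x.2 * wightmanReg n ν f ε (x.1 - x.2)
      = ∫ p, (Real.exp (-(ε * p.1)) : ℂ) / (2 * π) ^ (n + 1) *
        (minkFourier K₁ p * minkFourier K₂ (-p)) ∂wightmanMeasure n ν f := by
  simp only [mul_mul_wightmanReg_eq_integral hn hν]
  rw [integral_integral_swap (integrable_exp_minkProd_sub_mul h₁ h₂
    (integrable_exp_neg_div_two_pi_pow hn hν f hε))]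
  refine congrArg (integral _) (funext fun p => ?_)
  rw [← integral_exp_minkProd_sub_mul, ← integral_const_mul]
  exact congrArg (integral _) (funext fun x => by ring)

variable (γ : ℝ) {χ₁ χ₂ : Mink n → ℝ} (hχ₁ : IsCutoff χ₁) (hχ₂ : IsCutoff χ₂)
include hχ₁ hχ₂

theorem integrable_mappedIntegrand {Λ₁ Λ₂ : ℝ} (hΛ₁ : Λ₁ ≠ 0) (hΛ₂ : Λ₂ ≠ 0) (X₁ X₂ : Bulk n) :
    Integrable (mappedIntegrand ν γ f ε χ₁ χ₂ Λ₁ Λ₂ X₁ X₂) := by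
  have hproduct := integrable_mul_mul_wightmanReg hn hν f hε
    (integrable_robinKernel hν γ hχ₁ hΛ₁ X₁) (integrable_robinKernel hν γ hχ₂ hΛ₂ X₂)
  exact hproduct

theorem integral_mappedIntegrand {Λ₁ Λ₂ : ℝ} (hΛ₁ : Λ₁ ≠ 0) (hΛ₂ : Λ₂ ≠ 0)
    (X : Bulk n × Bulk n) :
    ∫ x, mappedIntegrand ν γ f ε χ₁ χ₂ Λ₁ Λ₂ X.1 X.2 x
      = ∫ p, (χ₁ (Λ₁⁻¹ • p) * χ₂ (Λ₂⁻¹ • -p)) •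
        (Real.exp (-(ε * p.1)) • bulkPlaneWave ν γ X p) ∂wightmanMeasure n ν f := by
  have hfourier := integral_mul_mul_wightmanReg hn hν f hε (integrable_robinKernel hν γ hχ₁ hΛ₁ X.1)
    (integrable_robinKernel hν γ hχ₂ hΛ₂ X.2)
  rw [minkFourier_robinKernel hν γ hχ₁ hΛ₁, minkFourier_robinKernel hν γ hχ₂ hΛ₂] at hfourier
  refine hfourier.trans (congrArg (integral _) (funext fun p => ?_))
  rw [robinSymbol, robinSymbol, bulkPlaneWave, negSq_neg, exp_I_mul_minkProd_sub,
    Complex.real_smul, Complex.real_smul]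
  push_cast
  ring

end MappedWightman

section CutoffRemoval

variable {n : ℕ}

theorem IsCutoff.tendsto_comp_inv_smul {χ : Mink n → ℝ} (hχ : IsCutoff χ) {ι : Type*}
    {l : Filter ι} {Λ : ι → ℝ} (hΛ : Tendsto Λ l atTop) (p : Mink n) :
    Tendsto (fun i => χ ((Λ i)⁻¹ • p)) l (𝓝 1) := by
  have hscale := (tendsto_inv_atTop_zero.comp hΛ).smul_const p
  rw [zero_smul] at hscale
  exact hχ.one ▸ (hχ.smooth.continuous.tendsto 0).comp hscale

variable {χ₁ χ₂ : Mink n → ℝ} (hχ₁ : IsCutoff χ₁) (hχ₂ : IsCutoff χ₂)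
include hχ₁ hχ₂

theorem tendsto_integral_cutoff_smul {E : Type*} [NormedAddCommGroup E] [NormedSpace ℝ E]
    {μ : Measure (Mink n)} {G : Mink n → E} (hG : Integrable G μ) :
    Tendsto (fun Λ : ℝ × ℝ => ∫ p, (χ₁ (Λ.1⁻¹ • p) * χ₂ (Λ.2⁻¹ • -p)) • G p ∂μ)
      (atTop ×ˢ atTop) (𝓝 (∫ p, G p ∂μ)) := by
  have cont₁ := hχ₁.smooth.continuous
  have cont₂ := hχ₂.smooth.continuous
  obtain ⟨C₁, hC₁⟩ := hχ₁.compact.exists_bound_of_continuous cont₁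
  obtain ⟨C₂, hC₂⟩ := hχ₂.compact.exists_bound_of_continuous cont₂
  have hC₁₀ : 0 ≤ C₁ := (norm_nonneg _).trans (hC₁ 0)
  refine tendsto_integral_filter_of_dominated_convergence (fun p => C₁ * C₂ * ‖G p‖)
    (.of_forall fun Λ => ?_) (.of_forall fun Λ => .of_forall fun p => ?_)
    (hG.norm.const_mul _) (.of_forall fun p => ?_)
  · exact (Continuous.aestronglyMeasurable (by fun_prop)).smul hG.aestronglyMeasurable
  · rw [norm_smul, norm_mul]
    gcongr
    exacts [hC₁ _, hC₂ _]
  · simpa using ((hχ₁.tendsto_comp_inv_smul tendsto_fst p).mul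
      (hχ₂.tendsto_comp_inv_smul tendsto_snd (-p))).smul_const (G p)

theorem tendsto_integral_mappedIntegrand (hn : 1 ≤ n) {ν : ℝ} (hν : ν ∈ Ioo (0 : ℝ) 1)
    {f α γ ε : ℝ} (h : RobinAngles ν (f * Aconst n ν) α γ) (hε : 0 < ε) {X : Bulk n × Bulk n}
    (h₁ : 0 < X.1.2) (h₂ : 0 < X.2.2) :
    Tendsto (fun Λ : ℝ × ℝ =>
      ∫ x : Mink n × Mink n, mappedIntegrand ν γ f ε χ₁ χ₂ Λ.1 Λ.2 X.1 X.2 x) (atTop ×ˢ atTop)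
      (𝓝 ((mappingConst n ν γ : ℂ) * bulkWightman n ν α ε X.1 X.2)) := by
  rw [mappingConst_mul_bulkWightman hn hν h hε h₁ h₂]
  refine (tendsto_integral_cutoff_smul hχ₁ hχ₂
    (integrable_exp_neg_smul_bulkPlaneWave hn hν f γ hε h₁ h₂)).congr' ?_
  filter_upwards [tendsto_fst.eventually (eventually_ne_atTop 0),
    tendsto_snd.eventually (eventually_ne_atTop 0)] with Λ hΛ₁ hΛ₂
  exact (integral_mappedIntegrand hn hν f hε γ hχ₁ hχ₂ hΛ₁ hΛ₂ X).symm

end CutoffRemoval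

/-! ### Removal of the regulator -/

/-- Test functions of pairs of points of the bulk `Z > 0`, on which boundary values in the regulator
`ε` are evaluated. -/
structure IsBulkTest {n : ℕ} (F : Bulk n × Bulk n → ℂ) : Prop where
  smooth : ContDiff ℝ ∞ F
  compact : HasCompactSupport F
  subset : tsupport F ⊆ {X | 0 < X.1.2 ∧ 0 < X.2.2}

/-- The pairing of a function of two bulk points with `bulkPlaneWave`, the bulk substitute for its
Fourier transform. -/
noncomputable def bulkFourier {n : ℕ} (ν γ : ℝ) (F : Bulk n × Bulk n → ℂ) (p : Mink n) : ℂ :=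
  ∫ X, F X * bulkPlaneWave ν γ X p

/-- The direction of the first time coordinate, along which `bulkPlaneWave` has the eigenvalue
`-I * p.1`. -/
def timeDir (n : ℕ) : Bulk n × Bulk n := (((1, 0), 0), 0)

instance instIsAddHaarMeasureBulkPair (n : ℕ) :
    (volume : Measure (Bulk n × Bulk n)).IsAddHaarMeasure :=
  have : (volume : Measure (Bulk n)).IsAddHaarMeasure :=
    Measure.prod.instIsAddHaarMeasure volume volume
  Measure.prod.instIsAddHaarMeasure volume volume

theorem bulkPlaneWave_add_smul_timeDir {n : ℕ} (ν γ : ℝ) (p : Mink n) (X : Bulk n × Bulk n)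
    (t : ℝ) :
    bulkPlaneWave ν γ (X + t • timeDir n) p
      = Complex.exp (-(Complex.I * p.1) * t) * bulkPlaneWave ν γ X p := by
  have phase : minkProd p ((X + t • timeDir n).1.1 - (X + t • timeDir n).2.1)
      = -(p.1 * t) + minkProd p (X.1.1 - X.2.1) := by
    simp only [timeDir, minkProd, Prod.fst_add, Prod.snd_add, Prod.smul_fst, Prod.smul_snd,
      Prod.fst_sub, Prod.snd_sub, smul_eq_mul, mul_one, smul_zero, add_zero]
    ring
  have height₁ : (X + t • timeDir n).1.2 = X.1.2 := by simp [timeDir]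
  have height₂ : (X + t • timeDir n).2.2 = X.2.2 := by simp [timeDir]
  rw [bulkPlaneWave, bulkPlaneWave, phase, height₁, height₂, Complex.ofReal_add, mul_add,
    Complex.exp_add]
  push_cast
  ring_nf

theorem hasLineDerivAt_bulkPlaneWave {n : ℕ} (ν γ : ℝ) (p : Mink n) (X : Bulk n × Bulk n) :
    HasLineDerivAt ℝ (fun X => bulkPlaneWave ν γ X p)
      (-(Complex.I * p.1) * bulkPlaneWave ν γ X p) X (timeDir n) := by
  have hlinear : HasDerivAt (fun t : ℝ => -(Complex.I * p.1) * (t : ℂ)) (-(Complex.I * p.1)) 0 := by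
    simpa using (Complex.ofRealCLM.hasDerivAt (x := (0 : ℝ))).const_mul (-(Complex.I * p.1))
  simp only [HasLineDerivAt, bulkPlaneWave_add_smul_timeDir]
  simpa using hlinear.cexp.mul_const (bulkPlaneWave ν γ X p)

namespace IsBulkTest

variable {n : ℕ} {F : Bulk n × Bulk n → ℂ} (hF : IsBulkTest F)
include hF

theorem fderiv_apply (v : Bulk n × Bulk n) : IsBulkTest fun X => fderiv ℝ F X v where
  smooth := (hF.smooth.fderiv_right (m := ∞) (by simp)).clm_apply contDiff_const
  compact := hF.compact.fderiv_apply ℝ v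
  subset := (tsupport_fderiv_apply_subset ℝ v).trans hF.subset

theorem integrable : Integrable F :=
  hF.smooth.continuous.integrable_of_hasCompactSupport hF.compact

theorem exists_height_bounds : ∃ a b : ℝ, 0 < a ∧
    ∀ X ∈ tsupport F, X.1.2 ∈ Icc a b ∧ X.2.2 ∈ Icc a b := by
  rcases (tsupport F).eq_empty_or_nonempty with hempty | hne
  · exact ⟨1, 1, one_pos, by simp [hempty]⟩
  obtain ⟨A, hA, hmin⟩ := hF.compact.isCompact.exists_isMinOn hne
    (f := fun X : Bulk n × Bulk n => min X.1.2 X.2.2) (by fun_prop)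
  obtain ⟨B, -, hmax⟩ := hF.compact.isCompact.exists_isMaxOn hne
    (f := fun X : Bulk n × Bulk n => max X.1.2 X.2.2) (by fun_prop)
  exact ⟨_, _, lt_min (hF.subset hA).1 (hF.subset hA).2, fun X hX =>
    ⟨⟨(hmin hX).trans (min_le_left _ _), (le_max_left _ _).trans (hmax hX)⟩,
      (hmin hX).trans (min_le_right _ _), (le_max_right _ _).trans (hmax hX)⟩⟩

variable {ν : ℝ} (hν : ν ∈ Ioo (0 : ℝ) 1) (γ : ℝ)
include hν

theorem exists_norm_mul_bulkPlaneWave_le : ∃ C, 0 ≤ C ∧ ∀ p ∈ futureCone n, ∀ X,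
    ‖F X * bulkPlaneWave ν γ X p‖ ≤ ‖F X‖ * (C * (1 + p.1) ^ 4) := by
  obtain ⟨a, b, ha, height_mem⟩ := hF.exists_height_bounds
  obtain ⟨C, hC, wave_le⟩ := exists_bulkPlaneWave_bound (n := n) hν γ (b := b) ha
  refine ⟨C, hC, fun p hp X => ?_⟩
  by_cases hX : X ∈ tsupport F
  · rw [norm_mul]
    gcongr
    exact wave_le X (height_mem X hX).1 (height_mem X hX).2 p hp
  · simp [image_eq_zero_of_notMem_tsupport hX]

theorem measurable_mul_bulkPlaneWave :
    Measurable fun y : (Bulk n × Bulk n) × Mink n => F y.1 * bulkPlaneWave ν γ y.1 y.2 :=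
  (hF.smooth.continuous.measurable.comp measurable_fst).mul (measurable_bulkPlaneWave hν γ)

theorem integrable_mul_bulkPlaneWave {p : Mink n} (hp : p ∈ futureCone n) :
    Integrable fun X => F X * bulkPlaneWave ν γ X p := by
  obtain ⟨C, -, hb⟩ := hF.exists_norm_mul_bulkPlaneWave_le hν γ
  exact (hF.integrable.norm.mul_const _).mono' ((hF.measurable_mul_bulkPlaneWave hν γ).comp
    measurable_prodMk_right).aestronglyMeasurable (.of_forall (hb p hp))

theorem bulkFourier_fderiv {p : Mink n} (hp : p ∈ futureCone n) :
    bulkFourier ν γ (fun X => fderiv ℝ F X (timeDir n)) p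
      = Complex.I * p.1 * bulkFourier ν γ F p := by
  have hwave := hF.integrable_mul_bulkPlaneWave hν γ hp
  have hwave' := (hF.fderiv_apply (timeDir n)).integrable_mul_bulkPlaneWave hν γ hp
  have by_parts := integral_bilinear_hasLineDerivAt_right_eq_neg_left_of_integrable
    (μ := (volume : Measure (Bulk n × Bulk n))) (B := ContinuousLinearMap.mul ℝ ℂ)
    (f := F) (f' := fun X => fderiv ℝ F X (timeDir n)) (g := fun X => bulkPlaneWave ν γ X p)
    (g' := fun X => -(Complex.I * p.1) * bulkPlaneWave ν γ X p) (v := timeDir n) hwave'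
    ((hwave.const_mul (-(Complex.I * p.1))).congr (.of_forall fun X => mul_left_comm _ _ _)) hwave
    (fun X _ => (hF.smooth.differentiable (by simp) X).hasFDerivAt.hasLineDerivAt _)
    (fun X _ => hasLineDerivAt_bulkPlaneWave ν γ p X)
  simp only [ContinuousLinearMap.mul_apply', mul_left_comm (F _), integral_const_mul] at by_parts
  unfold bulkFourier
  linear_combination by_parts

omit hF in
theorem exists_pow_mul_norm_bulkFourier_le (N : ℕ) :
    ∀ {F : Bulk n × Bulk n → ℂ}, IsBulkTest F → ∃ C, ∀ p ∈ futureCone n,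
      (1 + p.1) ^ N * ‖bulkFourier ν γ F p‖ ≤ C * (1 + p.1) ^ 4 := by
  induction N with
  | zero =>
    intro F hF
    obtain ⟨C, -, hb⟩ := hF.exists_norm_mul_bulkPlaneWave_le hν γ
    refine ⟨(∫ X, ‖F X‖) * C, fun p hp => ?_⟩
    rw [pow_zero, one_mul, mul_assoc, ← integral_mul_const]
    exact norm_integral_le_of_norm_le (hF.integrable.norm.mul_const _) (.of_forall (hb p hp))
  | succ N ih =>
    intro F hF
    obtain ⟨C, hC⟩ := ih hF
    obtain ⟨C', hC'⟩ := ih (hF.fderiv_apply (timeDir n))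
    refine ⟨C + C', fun p hp => ?_⟩
    have hp₀ : 0 ≤ p.1 := (norm_nonneg _).trans (le_of_lt hp)
    have hderiv := hC' p hp
    rw [hF.bulkFourier_fderiv hν γ hp, norm_mul, norm_mul, Complex.norm_I, Complex.norm_real,
      Real.norm_of_nonneg hp₀] at hderiv
    linear_combination hC p hp + hderiv

variable (hn : 1 ≤ n) (f : ℝ)
include hn

theorem integrable_bulkFourier : Integrable (bulkFourier ν γ F) (wightmanMeasure n ν f) := by
  obtain ⟨C, hC⟩ := exists_pow_mul_norm_bulkFourier_le hν γ (n + 7) hF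
  refine integrable_wightmanMeasure_of_le hn hν f (C := C) ?_ fun p hp => ?_
  · exact (hF.measurable_mul_bulkPlaneWave hν γ).stronglyMeasurable.integral_prod_left'
      |>.aestronglyMeasurable
  · have : 0 < 1 + p.1 := by linarith [(norm_nonneg _).trans (le_of_lt hp)]
    rw [← div_eq_mul_inv, le_div_iff₀ (by positivity)]
    refine le_of_mul_le_mul_right ?_ (show 0 < (1 + p.1) ^ 4 by positivity)
    linear_combination hC p hp

theorem integrable_prod_mul_bulkPlaneWave {ε : ℝ} (hε : 0 < ε) :
    Integrable (Function.uncurry fun (X : Bulk n × Bulk n) (p : Mink n) =>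
      F X * Real.exp (-(ε * p.1)) • bulkPlaneWave ν γ X p)
      (volume.prod (wightmanMeasure n ν f)) := by
  obtain ⟨C, hC, hb⟩ := hF.exists_norm_mul_bulkPlaneWave_le hν γ
  have hdamping : Integrable (fun p : Mink n => C * (1 + p.1) ^ 4 * Real.exp (-(ε * p.1)))
      (wightmanMeasure n ν f) := by
    refine integrable_wightmanMeasure_of_le_exp hn hν f
      (Continuous.aestronglyMeasurable (by fun_prop)) hε 4 hC fun p hp => ?_
    have : 0 ≤ p.1 := (norm_nonneg _).trans (le_of_lt hp)
    rw [Real.norm_of_nonneg (by positivity)]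
  have damping_measurable : Measurable fun y : (Bulk n × Bulk n) × Mink n =>
      Real.exp (-(ε * y.2.1)) := by fun_prop
  simp only [Function.uncurry_def, mul_smul_comm]
  refine (hF.integrable.norm.mul_prod hdamping).mono'
    (damping_measurable.smul (hF.measurable_mul_bulkPlaneWave hν γ)).aestronglyMeasurable ?_
  filter_upwards [Measure.quasiMeasurePreserving_snd.ae (ae_mem_futureCone n ν f)] with y hy
  rw [norm_smul, Real.norm_of_nonneg (Real.exp_pos _).le, mul_comm, ← mul_assoc]
  gcongr
  exact hb y.2 hy y.1

variable {γ f} {α : ℝ} (h : RobinAngles ν (f * Aconst n ν) α γ)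
include h

theorem mappingConst_mul_bulkWightman_mul {ε : ℝ} (hε : 0 < ε) (X : Bulk n × Bulk n) :
    (mappingConst n ν γ : ℂ) * (bulkWightman n ν α ε X.1 X.2 * F X)
      = ∫ p, F X * Real.exp (-(ε * p.1)) • bulkPlaneWave ν γ X p ∂wightmanMeasure n ν f := by
  by_cases hX : X ∈ tsupport F
  · rw [integral_const_mul, ← mappingConst_mul_bulkWightman hn hν h hε (hF.subset hX).1
      (hF.subset hX).2]
    ring
  · simp [image_eq_zero_of_notMem_tsupport hX]

theorem integrable_bulkWightman_mul {ε : ℝ} (hε : 0 < ε) :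
    Integrable fun X => bulkWightman n ν α ε X.1 X.2 * F X := by
  have hc : (mappingConst n ν γ : ℂ) ≠ 0 :=
    Complex.ofReal_ne_zero.2 (mappingConst_pos hn hν h.sin_γ_pos).ne'
  have hprod := (hF.integrable_prod_mul_bulkPlaneWave hν γ hn f hε).integral_prod_left
  simp only [Function.uncurry_apply_pair, ← hF.mappingConst_mul_bulkWightman_mul hν hn h hε]
    at hprod
  exact (integrable_const_mul_iff (isUnit_iff_ne_zero.2 hc) _).1 hprod

theorem mappingConst_mul_integral_bulkWightman_mul {ε : ℝ} (hε : 0 < ε) :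
    (mappingConst n ν γ : ℂ) * ∫ X, bulkWightman n ν α ε X.1 X.2 * F X
      = ∫ p, Real.exp (-(ε * p.1)) • bulkFourier ν γ F p ∂wightmanMeasure n ν f := by
  rw [← integral_const_mul]
  simp only [hF.mappingConst_mul_bulkWightman_mul hν hn h hε]
  rw [integral_integral_swap (hF.integrable_prod_mul_bulkPlaneWave hν γ hn f hε)]
  simp only [mul_smul_comm, integral_smul, bulkFourier]

theorem exists_tendsto_integral_bulkWightman_mul : ∃ ℓ : ℂ,
    Tendsto (fun ε : ℝ => ∫ X, bulkWightman n ν α ε X.1 X.2 * F X) (𝓝[>] 0) (𝓝 ℓ) := by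
  have hc : (mappingConst n ν γ : ℂ) ≠ 0 :=
    Complex.ofReal_ne_zero.2 (mappingConst_pos hn hν h.sin_γ_pos).ne'
  have energy_nonneg : ∀ᵐ p ∂wightmanMeasure n ν f, 0 ≤ p.1 := by
    filter_upwards [ae_mem_futureCone n ν f] with p hp using (norm_nonneg _).trans (le_of_lt hp)
  have hlimit := (tendsto_integral_exp_neg_mul_smul energy_nonneg measurable_fst.aemeasurable
    (hF.integrable_bulkFourier hν γ hn f)).const_mul (mappingConst n ν γ : ℂ)⁻¹
  refine ⟨_, hlimit.congr' ?_⟩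
  filter_upwards [self_mem_nhdsWithin] with ε hε
  rw [← hF.mappingConst_mul_integral_bulkWightman_mul hν hn h hε, inv_mul_cancel_left₀ hc]

end IsBulkTest

end RobinHolography

theorem mainTheorem6 (n : ℕ) (hn : 1 ≤ n) (ν : ℝ) (hν : ν ∈ Ioo (0 : ℝ) 1)
    (f : ℝ) (hf : 0 ≤ f) :
    -- the Schwinger function at nonzero Euclidean time is well defined, and the boundary Wightman
    -- function at complex times in the lower half-plane is its analytic continuation
    ((∀ τ : ℝ, τ ≠ 0 →
        (∀ k : EuclideanSpace ℝ (Fin n), k ≠ 0 →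
          Tendsto (schwingerCutoff n ν f τ k) atTop (𝓝 (schwingerMode n ν f τ k))) ∧
        Integrable (schwingerMode n ν f τ)) ∧
      (∀ (z : ℂ) (x : EuclideanSpace ℝ (Fin n)), z.im < 0 →
        Integrable (wightmanIntegrand n ν f z x)) ∧
      (∀ x : EuclideanSpace ℝ (Fin n),
        DifferentiableOn ℂ (fun z => wightman n ν f z x) {z : ℂ | z.im < 0}) ∧
      (∀ (τ : ℝ) (x : EuclideanSpace ℝ (Fin n)), τ ≠ 0 →
        schwinger n ν f τ x = wightman n ν f (-(Complex.I * ((|τ| : ℝ) : ℂ))) x)) ∧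
    -- its boundary value is a tempered distribution, whose Fourier transform is supported on the
    -- closed future light cone
    (∃ T That : 𝓢'(Mink n, ℂ),
      (∀ h : 𝓢(Mink n, ℂ),
        Tendsto (fun ε : ℝ => ∫ x : Mink n, wightmanReg n ν f ε x * h x) (𝓝[>] 0) (𝓝 (T h))) ∧
      (∀ h : 𝓢(Mink n, ℂ),
        Integrable (fun p : Mink n => (wightmanDensity n ν f p : ℂ) * minkFourier h p) ∧
        T h = ∫ p : Mink n,
          (wightmanDensity n ν f p : ℂ) * minkFourier h p / (2 * π) ^ (n + 1)) ∧
      (∀ g : 𝓢(Mink n, ℂ),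
        Integrable (fun p : Mink n => (wightmanDensity n ν f p : ℂ) * g p) ∧
        That g = ∫ p : Mink n, (wightmanDensity n ν f p : ℂ) * g p / (2 * π) ^ (n + 1)) ∧
      Distribution.dsupport That = {p : Mink n | ‖p.2‖ ≤ p.1}) ∧
    -- with the Robin parameters identified, the kernel maps the boundary Wightman function to the
    -- bulk Wightman function
    (∀ α ∈ Ioo 0 π, ∀ γ ∈ Ioo 0 π,
      Real.cot α = -(f * Aconst n ν) →
      Real.cot γ =
        -(2 ^ (-(2 * ν)) * Real.Gamma (1 - ν) / Real.Gamma (1 + ν) * Real.cot α) →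
      -- the bulk modes solve the radial Klein-Gordon equation and obey the boundary condition
      -- `φ₊ = cos γ φ`, `φ₋ = sin γ φ`
      (∀ q : ℝ, 0 < q →
        ContDiffOn ℝ ∞ (robinMode n ν α q) (Ioi 0) ∧
        (∀ Z : ℝ, 0 < Z →
          Z ^ 2 * deriv (deriv (robinMode n ν α q)) Z - n * Z * deriv (robinMode n ν α q) Z
            + (q ^ 2 * Z ^ 2 - (ν ^ 2 - (((n : ℝ) + 1) / 2) ^ 2)) * robinMode n ν α q Z = 0) ∧
        ∃ φ : ℝ, φ ≠ 0 ∧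
          Tendsto (fun Z : ℝ => Z ^ (-(((n : ℝ) + 1) / 2 - ν)) * robinMode n ν α q Z)
            (𝓝[>] 0) (𝓝 (Real.sin γ * φ)) ∧
          Tendsto (fun Z : ℝ => Z ^ (-(((n : ℝ) + 1) / 2 + ν)) *
              (robinMode n ν α q Z - Real.sin γ * φ * Z ^ (((n : ℝ) + 1) / 2 - ν)))
            (𝓝[>] 0) (𝓝 (Real.cos γ * φ))) ∧
      -- the image of the boundary Wightman function, at every value of the regulator `ε`
      (∀ ε : ℝ, 0 < ε → ∀ X₁ X₂ : Bulk n, 0 < X₁.2 → 0 < X₂.2 →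
        IntegrableOn (bulkIntegrand n ν α ε X₁ X₂) (univ ×ˢ Ioi (0 : ℝ)) ∧
        ∀ χ₁ χ₂ : Mink n → ℝ, IsCutoff χ₁ → IsCutoff χ₂ →
          (∀ Λ₁ Λ₂ : ℝ, 0 < Λ₁ → 0 < Λ₂ →
            Integrable (mappedIntegrand ν γ f ε χ₁ χ₂ Λ₁ Λ₂ X₁ X₂)) ∧
          Tendsto (fun Λ : ℝ × ℝ =>
              ∫ x : Mink n × Mink n, mappedIntegrand ν γ f ε χ₁ χ₂ Λ.1 Λ.2 X₁ X₂ x)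
            (atTop ×ˢ atTop)
            (𝓝 (((2 * π ^ (((n : ℝ) + 1) / 2) * Real.Gamma (1 - ν)
                / Real.Gamma (((n : ℝ) + 1) / 2 - ν) * Real.sin γ ^ 2 : ℝ) : ℂ)
              * bulkWightman n ν α ε X₁ X₂))) ∧
      -- the regulator can be removed in the sense of distributions on pairs of bulk points
      (∀ F : Bulk n × Bulk n → ℂ, ContDiff ℝ ∞ F → HasCompactSupport F →
        tsupport F ⊆ {X | 0 < X.1.2 ∧ 0 < X.2.2} →
        (∀ ε : ℝ, 0 < ε → Integrable fun X => bulkWightman n ν α ε X.1 X.2 * F X) ∧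
        ∃ ℓ : ℂ, Tendsto (fun ε : ℝ => ∫ X, bulkWightman n ν α ε X.1 X.2 * F X)
          (𝓝[>] 0) (𝓝 ℓ))) := by
  refine ⟨⟨fun τ hτ => ⟨fun k hk => schwingerMode_eq hn hν hf hτ hk ▸
        tendsto_schwingerCutoff hn hν hf hτ hk, integrable_schwingerMode hn hν hf hτ⟩,
      fun z x hz => integrable_wightmanIntegrand hn hν f hz x,
      differentiableOn_wightman hn hν f,
      fun τ x hτ => schwinger_eq_wightman hn hν hf hτ x⟩,
    exists_wightman_distribution hn hν f, fun α hα γ hγ hcα hcγ => ?_⟩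
  have h : RobinAngles ν (f * Aconst n ν) α γ := .of_cot hν hα hγ hcα hcγ
  refine ⟨fun q hq => ?_, fun ε hε X₁ X₂ h₁ h₂ => ?_, fun F hsmooth hcompact hsub => ?_⟩
  · have solution := isRadialSolution_robinMode n hν h hq
    have boundary := hasBoundaryExpansion_robinMode n hν h hq
    exact ⟨solution.contDiffOn, by simpa only [add_sub_cancel_right] using solution.equation,
      modeCoeff ν (f * Aconst n ν) γ q, (modeCoeff_neg hν _ h.sin_γ_pos hq).ne,
      boundary.leading, boundary.subleading⟩
  · exact ⟨integrableOn_bulkIntegrand hn hν h hε (X := (X₁, X₂)) h₁ h₂, fun χ₁ χ₂ hχ₁ hχ₂ =>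
      ⟨fun Λ₁ Λ₂ hΛ₁ hΛ₂ =>
        integrable_mappedIntegrand hn hν f hε γ hχ₁ hχ₂ hΛ₁.ne' hΛ₂.ne' X₁ X₂,
      tendsto_integral_mappedIntegrand hχ₁ hχ₂ hn hν h hε (X := (X₁, X₂)) h₁ h₂⟩⟩
  · have hF : IsBulkTest F := ⟨hsmooth, hcompact, hsub⟩
    exact ⟨fun ε hε => hF.integrable_bulkWightman_mul hν hn h hε,
      hF.exists_tendsto_integral_bulkWightman_mul hν hn h⟩
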